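/- Conventions. A cube complex is a union of finite-dimensional cubes glued by isometries along faces, such that every cube is embedded and two cubes are either disjoint or meet exactly in a common face; it is CAT(0) if it is (non-empty, connected and) simply connected and the link of every vertex is a flag complex. It is endowed with the graph metric $d$ of its one-skeleton, and we write $x\in X$ for a vertex. A hyperplane is a class of edges for the equivalence relation generated by being opposite edges of a square; removing its edges from the one-skeleton leaves two components, the halfspaces it delimits. A group acts geometrically on a cube complex if it acts by automorphisms, $\{h : d(x,hx)\le r\}$ is finite for every vertex $x$ and every $r\geq 0$, and there are finitely many orbits of cubes. The median point $\mu(x,y,z)$ of three vertices of a CAT(0) cube complex is the unique vertex $m$ with $d(a,b)=d(a,m)+d(m,b)$ for all distinct members $a,b$ of the triple; a median subalgebra is a set of vertices stable under $\mu$. A wallspace is a set $Y$ with a collection of walls, i.e. partitions $\{A,A^c\}$ of $Y$ into two non-empty halfspaces, any two points being separated by finitely many walls. An orientation chooses one halfspace of each wall, in such a way that $A\subset B$ and $A$ chosen imply $B$ chosen; the principal orientation of $x\in Y$ chooses the halfspaces containing $x$. The cubulation of a wallspace has as vertices the orientations differing from a principal one on finitely many walls, as edges the pairs of orientations differing on exactly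 one wall, and an $n$-cube filling in every subgraph isomorphic to the one-skeleton of an $n$-cube. The cubulation of a median subalgebra $M$ is the cubulation of the wallspace $M$ whose walls are the partitions of $M$ into two non-empty subsets which are convex in $M$, where $A \subset M$ is convex in $M$ if $z\in A$ whenever $x,y\in A$, $z\in M$ and $\mu(x,y,z)=z$. An axis of an isometry $g$ is a bi-infinite geodesic on which $g$ acts as a translation of length $\min_x d(x,gx)>0$. The median set $\mathrm{Med}_X(g)$ of an isometry $g$ of a CAT(0) cube complex $X$ is: if $g$ has bounded orbits, the union of the cubes of minimal dimension among those stabilised by $g$; if $g$ has an axis, the union of all its axes; if $g$ has unbounded orbits and some power of $g$ inverts a hyperplane (stabilises it and swaps its two halfspaces), the preimage of the union of all the axes of $g$ in $X/\mathcal J$ under the canonical map $X\to X/\mathcal J$ sending a vertex to its principal orientation, where $\mathcal J$ is the set of all hyperplanes inverted by powers of $g$ and $X/\mathcal J$ is the cubulation of the wallspace given by the vertex set of $X$ and the hyperplanes of $X$ not in $\mathcal J$. **Theorem.** Let $G$ be a group acting geometrically on a CAT(0) cube complex $X$, and let $g\in G$ be an element of infinite order. Let $X'$ be the cubical barycentric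 subdivision of $X$: its vertices are the cubes of $X$, and for every pair of cubes $C\subseteq D$ of $X$ the cubes $E$ with $C\subseteq E\subseteq D$ are the vertices of a cube of $X'$. Then $X'$ is a CAT(0) cube complex; the median set $\mathrm{Med}_{X'}(g)$ is a median subalgebra of $X'$ which is invariant under the centraliser $C_G(g)$; its cubulation is a CAT(0) cube complex; and the action of $C_G(g)$ on this cubulation induced by its action on $\mathrm{Med}_{X'}(g)$ is geometric. In particular, $C_G(g)$ acts geometrically on a CAT(0) cube complex. -/

import Mathlib

/-! ### Cube complexes -/

/-- The vertices `x`, `y` of the cube `{0,1}ⁿ` are joined by an edge of its one-skeleton. -/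
def HypercubeAdj {n : ℕ} (x y : Fin n → Bool) : Prop := ∃! i, x i ≠ y i

/-- The face of `{0,1}ⁿ` through `a` on which the coordinates in `S` are constant. -/
def hypercubeFace {n : ℕ} (a : Fin n → Bool) (S : Set (Fin n)) : Set (Fin n → Bool) :=
  {x | ∀ i ∈ S, x i = a i}

/-- A family of cubes on a set `V` of vertices, each cube being recorded by its set of vertices.
It describes a cube complex when it satisfies `CubeSystem.IsCubeComplex`. -/
structure CubeSystem (V : Type*) where
  cubes : Set (Set V)

namespace CubeSystem

variable {V : Type*}

/-- A cube complex: a union of cubes, each of which is embedded and comes with all its faces, such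
that two cubes are either disjoint or meet exactly in a common face. -/
structure IsCubeComplex (K : CubeSystem V) : Prop where
  singleton_mem : ∀ v, {v} ∈ K.cubes
  exists_chart : ∀ C ∈ K.cubes, ∃ (n : ℕ) (φ : (Fin n → Bool) → V),
    Function.Injective φ ∧ Set.range φ = C ∧
      ∀ D ⊆ C, D ∈ K.cubes ↔ ∃ a S, D = φ '' hypercubeFace a S
  inter_mem : ∀ C ∈ K.cubes, ∀ D ∈ K.cubes, (C ∩ D).Nonempty → C ∩ D ∈ K.cubes

/-- The one-skeleton. Its graph metric is the combinatorial metric. -/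
def graph (K : CubeSystem V) : SimpleGraph V where
  Adj v w := v ≠ w ∧ {v, w} ∈ K.cubes
  symm := ⟨fun v w h => ⟨h.1.symm, Set.pair_comm v w ▸ h.2⟩⟩
  loopless := ⟨fun _ h => h.1 rfl⟩

/-- The simplices of the link of the vertex `v` (together with the empty one): the vertices of the
link are the edges at `v`, each recorded by its other endpoint, and each cube containing `v`
contributes the simplex spanned by its edges at `v`. -/
def link (K : CubeSystem V) (v : V) : Set (Set V) :=
  {s | ∃ C ∈ K.cubes, v ∈ C ∧ s = {w ∈ C | K.graph.Adj v w}}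

/-- Non-positive curvature: the links are flag complexes. -/
def IsNonpositivelyCurved (K : CubeSystem V) : Prop :=
  ∀ (v : V) (s : Set V), s.Finite → (∀ w ∈ s, K.graph.Adj v w) →
    (∀ a ∈ s, ∀ b ∈ s, a ≠ b → {a, b} ∈ K.link v) → s ∈ K.link v

/-- Homotopy, relative to the endpoints, of edge paths in the two-skeleton: it is generated by
removing or inserting backtracks and by replacing half of the boundary of a square by the other
half. -/
inductive Homotopic (K : CubeSystem V) :
    ∀ {u v : V}, K.graph.Walk u v → K.graph.Walk u v → Prop
  | refl {u v : V} (p : K.graph.Walk u v) : Homotopic K p p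
  | symm {u v : V} {p q : K.graph.Walk u v} : Homotopic K p q → Homotopic K q p
  | trans {u v : V} {p q r : K.graph.Walk u v} :
      Homotopic K p q → Homotopic K q r → Homotopic K p r
  | cons {u v w : V} (h : K.graph.Adj u v) {p q : K.graph.Walk v w} :
      Homotopic K p q → Homotopic K (.cons h p) (.cons h q)
  | backtrack {u v w : V} (h : K.graph.Adj u v) (p : K.graph.Walk u w) :
      Homotopic K (.cons h (.cons h.symm p)) p
  | square {a b c d w : V} (hab : K.graph.Adj a b) (hbc : K.graph.Adj b c)
      (had : K.graph.Adj a d) (hdc : K.graph.Adj d c) (hsq : {a, b, c, d} ∈ K.cubes)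
      (p : K.graph.Walk c w) :
      Homotopic K (.cons hab (.cons hbc p)) (.cons had (.cons hdc p))

/-- The complex is (non-empty and) connected, and every closed edge path is null-homotopic. -/
structure IsSimplyConnected (K : CubeSystem V) : Prop where
  connected : K.graph.Connected
  nullHomotopic : ∀ (v : V) (p : K.graph.Walk v v), K.Homotopic p .nil

/-- A CAT(0) cube complex: a simply connected non-positively curved cube complex. -/
structure IsCAT0 (K : CubeSystem V) : Prop where
  isCubeComplex : K.IsCubeComplex
  nonpositivelyCurved : K.IsNonpositivelyCurved
  simplyConnected : K.IsSimplyConnected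

/-! ### Automorphisms and geometric actions -/

/-- The group of automorphisms of a cube complex. -/
def Aut (K : CubeSystem V) : Subgroup (Equiv.Perm V) where
  carrier := {f | ∀ C, f '' C ∈ K.cubes ↔ C ∈ K.cubes}
  one_mem' := fun C => by simp
  mul_mem' := fun {f g} hf hg C => by
    rw [Equiv.Perm.coe_mul, Set.image_comp, hf, hg]
  inv_mem' := fun {f} hf C => by
    rw [← hf, ← Set.image_comp, ← Equiv.Perm.coe_mul, mul_inv_cancel]; simp

/-- An action on a cube complex by automorphisms is geometric if it is (metrically) proper and
cocompact, the latter meaning that there are finitely many orbits of cubes. -/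
structure ActsGeometrically {G : Type*} [Group G] {K : CubeSystem V} (ρ : G →* K.Aut) : Prop where
  proper : ∀ (v : V) (r : ℕ), {h : G | K.graph.dist v ((ρ h : Equiv.Perm V) v) ≤ r}.Finite
  cocompact : ∃ F ⊆ K.cubes, F.Finite ∧
    ∀ C ∈ K.cubes, ∃ h : G, ∃ D ∈ F, (ρ h : Equiv.Perm V) '' D = C

/-! ### Barycentric subdivision -/

/-- The (cubical) barycentric subdivision: its vertices are (the barycentres of) the cubes, and its
cubes correspond to the pairs of cubes `C ⊆ D`, the vertices of the corresponding cube being the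
cubes `E` with `C ⊆ E ⊆ D`. -/
def subdivision (K : CubeSystem V) : CubeSystem K.cubes where
  cubes := {S | ∃ C D : K.cubes, C ≤ D ∧ S = Set.Icc C D}

/-- The permutation of the cubes induced by an automorphism. -/
def cubesPerm (K : CubeSystem V) (f : K.Aut) : Equiv.Perm K.cubes where
  toFun C := ⟨(f : Equiv.Perm V) '' C, (f.2 _).2 C.2⟩
  invFun C := ⟨((f⁻¹ : K.Aut) : Equiv.Perm V) '' C, ((f⁻¹ : K.Aut).2 _).2 C.2⟩
  left_inv C := Subtype.ext (by simp [Set.image_image])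
  right_inv C := Subtype.ext (by simp [Set.image_image])

theorem cubesPerm_le_iff (K : CubeSystem V) (f : K.Aut) (C D : K.cubes) :
    K.cubesPerm f C ≤ K.cubesPerm f D ↔ C ≤ D :=
  Set.image_subset_image_iff (f : Equiv.Perm V).injective

theorem cubesPerm_image_Icc (K : CubeSystem V) (f : K.Aut) (C D : K.cubes) :
    K.cubesPerm f '' Set.Icc C D = Set.Icc (K.cubesPerm f C) (K.cubesPerm f D) := by
  ext E
  obtain ⟨E, rfl⟩ := (K.cubesPerm f).surjective E
  simp [Set.mem_Icc, cubesPerm_le_iff]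

/-- The action of the automorphisms of a cube complex on its barycentric subdivision. -/
def subdivisionHom (K : CubeSystem V) : K.Aut →* K.subdivision.Aut where
  toFun f := ⟨K.cubesPerm f, fun S => by
    constructor
    · rintro ⟨C, D, hCD, h⟩
      obtain ⟨C, rfl⟩ := (K.cubesPerm f).surjective C
      obtain ⟨D, rfl⟩ := (K.cubesPerm f).surjective D
      rw [← cubesPerm_image_Icc] at h
      exact ⟨C, D, (K.cubesPerm_le_iff f C D).1 hCD, (K.cubesPerm f).injective.image_injective h⟩
    · rintro ⟨C, D, hCD, rfl⟩
      exact ⟨_, _, (K.cubesPerm_le_iff f C D).2 hCD, K.cubesPerm_image_Icc f C D⟩⟩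
  map_one' := by
    exact Subtype.ext (Equiv.ext fun C => Subtype.ext (by simp [cubesPerm]))
  map_mul' f g := by
    exact Subtype.ext (Equiv.ext fun C => Subtype.ext (by simp [cubesPerm, Set.image_image]))

end CubeSystem

/-! ### Cubulations of wallspaces -/

/-- The cube system obtained from a graph by filling in every subgraph isomorphic to the
one-skeleton of a cube. -/
def SimpleGraph.fillCubes {V : Type*} (Γ : SimpleGraph V) : CubeSystem V where
  cubes := {C | ∃ (n : ℕ) (φ : (Fin n → Bool) → V), Function.Injective φ ∧
    (∀ x y, HypercubeAdj x y → Γ.Adj (φ x) (φ y)) ∧ Set.range φ = C}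

section Wallspace

/-! A collection of walls `{A, Aᶜ}` on a set `α` is recorded by its collection `H` of halfspaces. -/

variable {α : Type*}

/-- An orientation of the wallspace `(α, H)`. -/
structure IsOrientation (H : Set (Set α)) (σ : Set (Set α)) : Prop where
  subset : σ ⊆ H
  exactly_one : ∀ A ∈ H, Xor (A ∈ σ) (Aᶜ ∈ σ)
  upward : ∀ A ∈ H, ∀ B ∈ H, A ⊆ B → A ∈ σ → B ∈ σ

/-- The principal orientation defined by a point. -/
def principalOrientation (H : Set (Set α)) (x : α) : Set (Set α) := {A ∈ H | x ∈ A}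

/-- The vertices of the cubulation of `(α, H)`: the orientations which are commensurable to
principal orientations. -/
def CubulationVertex (H : Set (Set α)) : Type _ :=
  {σ : Set (Set α) // IsOrientation H σ ∧ ∃ x, (symmDiff σ (principalOrientation H x)).Finite}

/-- The one-skeleton of the cubulation: two orientations are joined by an edge if their symmetric
difference has cardinality two. -/
def cubulationGraph (H : Set (Set α)) : SimpleGraph (CubulationVertex H) where
  Adj σ τ := (symmDiff σ.1 τ.1).ncard = 2
  symm := ⟨fun σ τ h => by rw [symmDiff_comm]; exact h⟩
  loopless := ⟨fun σ h => by simp at h⟩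

/-- The cubulation of the wallspace `(α, H)`. -/
def cubulation (H : Set (Set α)) : CubeSystem (CubulationVertex H) :=
  (cubulationGraph H).fillCubes

/-- The map induced on the cubulation by a permutation which preserves the walls. -/
def cubulationMap (H : Set (Set α)) (f : Equiv.Perm α) (hf : ∀ A, f '' A ∈ H ↔ A ∈ H)
    (σ : CubulationVertex H) : CubulationVertex H :=
  ⟨(fun A => f '' A) '' σ.1, by
    have hinj : Function.Injective (fun A : Set α => f '' A) := f.injective.image_injective
    obtain ⟨hσ, x, hx⟩ := σ.2
    refine ⟨⟨?_, ?_, ?_⟩, f x, ?_⟩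
    · rintro _ ⟨A, hA, rfl⟩
      exact (hf A).2 (hσ.subset hA)
    · intro A hA
      obtain ⟨B, rfl⟩ := f.surjective.image_surjective A
      rw [← Set.image_compl_eq f.bijective, hinj.mem_set_image,
        show f '' Bᶜ ∈ (fun A => f '' A) '' σ.1 ↔ Bᶜ ∈ σ.1 from hinj.mem_set_image]
      exact hσ.exactly_one B ((hf B).1 hA)
    · rintro _ - B hB hAB ⟨A, hA, rfl⟩
      obtain ⟨B, rfl⟩ := f.surjective.image_surjective B
      exact ⟨B, hσ.upward A (hσ.subset hA) B ((hf B).1 hB)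
        ((Set.image_subset_image_iff f.injective).1 hAB) hA, rfl⟩
    · have : principalOrientation H (f x) = (fun A => f '' A) '' principalOrientation H x := by
        ext A
        obtain ⟨B, rfl⟩ := f.surjective.image_surjective A
        rw [hinj.mem_set_image]
        simp [principalOrientation, hf]
      rw [this, ← Set.image_symmDiff hinj]
      exact hx.image _⟩

end Wallspace

/-! ### Translation lengths and axes -/

/-- The translation length `min {d(x, f x)}`. -/
noncomputable def translationLength {V : Type*} (Γ : SimpleGraph V) (f : V → V) : ℕ :=
  sInf (Set.range fun x => Γ.dist x (f x))

/-- `γ` is an axis of `f`: a bi-infinite geodesic on which `f` acts as a translation whose length is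
the translation length of `f`, which is positive. -/
structure IsAxis {V : Type*} (Γ : SimpleGraph V) (f : V → V) (γ : ℤ → V) : Prop where
  geodesic : ∀ i j, Γ.dist (γ i) (γ j) = (i - j).natAbs
  pos : 0 < translationLength Γ f
  translates : ∀ i, f (γ i) = γ (i + translationLength Γ f)

namespace CubeSystem

variable {V : Type*}

/-! ### Hyperplanes -/

/-- The edges `e` and `e'` are opposite edges of a square `a, b, c, d`. -/
def OppositeEdges (K : CubeSystem V) (e e' : Sym2 V) : Prop :=
  ∃ a b c d : V, a ≠ c ∧ b ≠ d ∧ K.graph.Adj a b ∧ K.graph.Adj b c ∧ K.graph.Adj c d ∧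
    K.graph.Adj d a ∧ {a, b, c, d} ∈ K.cubes ∧ e = s(a, b) ∧ e' = s(d, c)

/-- The hyperplanes: the equivalence classes of edges for the equivalence relation generated by
being opposite in a square. -/
def hyperplanes (K : CubeSystem V) : Set (Set (Sym2 V)) :=
  {J | ∃ e ∈ K.graph.edgeSet, J = {e' | Relation.EqvGen K.OppositeEdges e e'}}

/-- The halfspaces delimited by `J`: the components of the graph obtained by removing the edges in
`J`. -/
def sides (K : CubeSystem V) (J : Set (Sym2 V)) : Set (Set V) :=
  {A | ∃ v, A = {w | (K.graph.deleteEdges J).Reachable v w}}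

/-- `f` inverts `J`: it stabilises `J` and swaps the halfspaces delimited by `J`. -/
def Inverts (K : CubeSystem V) (f : K.Aut) (J : Set (Sym2 V)) : Prop :=
  Sym2.map (f : Equiv.Perm V) '' J = J ∧
    ∀ A ∈ K.sides J, (f : Equiv.Perm V) '' A ∈ K.sides J ∧ (f : Equiv.Perm V) '' A ≠ A

/-- The hyperplanes inverted by powers of `g`. -/
def invertedHyperplanes (K : CubeSystem V) (g : K.Aut) : Set (Set (Sym2 V)) :=
  {J ∈ K.hyperplanes | ∃ n : ℤ, K.Inverts (g ^ n) J}

/-- The halfspaces of the wallspace given by all the hyperplanes which do not belong to `𝒥`. The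
cubical quotient of the complex by `𝒥` is the cubulation of this wallspace. -/
def quotientHalfspaces (K : CubeSystem V) (𝒥 : Set (Set (Sym2 V))) : Set (Set V) :=
  {A | ∃ J ∈ K.hyperplanes, J ∉ 𝒥 ∧ A ∈ K.sides J}

theorem aut_adj_iff (K : CubeSystem V) (f : K.Aut) (v w : V) :
    K.graph.Adj ((f : Equiv.Perm V) v) ((f : Equiv.Perm V) w) ↔ K.graph.Adj v w := by
  have := f.2 {v, w}
  rw [Set.image_pair] at this
  simp [graph, this]

theorem OppositeEdges.map {K : CubeSystem V} (f : K.Aut) {e e' : Sym2 V}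
    (h : K.OppositeEdges e e') :
    K.OppositeEdges (e.map (f : Equiv.Perm V)) (e'.map (f : Equiv.Perm V)) := by
  obtain ⟨a, b, c, d, hac, hbd, hab, hbc, hcd, hda, hQ, rfl, rfl⟩ := h
  have hQ' := (f.2 _).2 hQ
  simp only [Set.image_insert_eq, Set.image_singleton] at hQ'
  exact ⟨_, _, _, _, (f : Equiv.Perm V).injective.ne hac, (f : Equiv.Perm V).injective.ne hbd,
    (K.aut_adj_iff f _ _).2 hab, (K.aut_adj_iff f _ _).2 hbc, (K.aut_adj_iff f _ _).2 hcd,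
    (K.aut_adj_iff f _ _).2 hda, hQ', rfl, rfl⟩

theorem eqvGen_map {K : CubeSystem V} (f : K.Aut) {e e' : Sym2 V}
    (h : Relation.EqvGen K.OppositeEdges e e') :
    Relation.EqvGen K.OppositeEdges (e.map (f : Equiv.Perm V)) (e'.map (f : Equiv.Perm V)) := by
  induction h with
  | rel _ _ h => exact .rel _ _ (h.map f)
  | refl _ => exact .refl _
  | symm _ _ _ ih => exact .symm _ _ ih
  | trans _ _ _ _ _ ih ih' => exact .trans _ _ _ ih ih'

theorem sym2_map_inv {K : CubeSystem V} (f : K.Aut) (e : Sym2 V) :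
    (e.map ((f⁻¹ : K.Aut) : Equiv.Perm V)).map (f : Equiv.Perm V) = e := by
  induction e with | _ a b => simp

theorem sym2_image_inv {K : CubeSystem V} (f : K.Aut) (J : Set (Sym2 V)) :
    Sym2.map (f : Equiv.Perm V) '' (Sym2.map ((f⁻¹ : K.Aut) : Equiv.Perm V) '' J) = J := by
  rw [Set.image_image]
  simp only [sym2_map_inv, Set.image_id']

theorem hyperplanes_map {K : CubeSystem V} (f : K.Aut) {J : Set (Sym2 V)}
    (h : J ∈ K.hyperplanes) : Sym2.map (f : Equiv.Perm V) '' J ∈ K.hyperplanes := by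
  obtain ⟨e, he, rfl⟩ := h
  refine ⟨e.map (f : Equiv.Perm V), ?_, ?_⟩
  · induction e with | _ a b => exact (K.aut_adj_iff f a b).2 he
  · ext e'
    constructor
    · rintro ⟨e', h, rfl⟩
      exact eqvGen_map f h
    · intro h
      refine ⟨e'.map ((f⁻¹ : K.Aut) : Equiv.Perm V), ?_, sym2_map_inv f e'⟩
      have := eqvGen_map f⁻¹ h
      rwa [show (e.map (f : Equiv.Perm V)).map ((f⁻¹ : K.Aut) : Equiv.Perm V) = e by
        simpa using sym2_map_inv f⁻¹ e] at this

theorem reachable_map {K : CubeSystem V} (f : K.Aut) {J : Set (Sym2 V)} {v w : V}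
    (h : (K.graph.deleteEdges J).Reachable v w) :
    (K.graph.deleteEdges (Sym2.map (f : Equiv.Perm V) '' J)).Reachable
      ((f : Equiv.Perm V) v) ((f : Equiv.Perm V) w) := by
  refine h.map (⟨(f : Equiv.Perm V), fun {a b} hab => ?_⟩ : K.graph.deleteEdges J →g
    K.graph.deleteEdges (Sym2.map (f : Equiv.Perm V) '' J))
  rw [SimpleGraph.deleteEdges_adj] at hab ⊢
  refine ⟨(K.aut_adj_iff f a b).2 hab.1, fun hm => hab.2 ?_⟩
  rwa [← Sym2.map_mk, (Sym2.map.injective (f : Equiv.Perm V).injective).mem_set_image] at hm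

theorem sides_map {K : CubeSystem V} (f : K.Aut) {J : Set (Sym2 V)} {A : Set V}
    (h : A ∈ K.sides J) :
    (f : Equiv.Perm V) '' A ∈ K.sides (Sym2.map (f : Equiv.Perm V) '' J) := by
  obtain ⟨v, rfl⟩ := h
  refine ⟨(f : Equiv.Perm V) v, ?_⟩
  ext w
  constructor
  · rintro ⟨w, h, rfl⟩
    exact reachable_map f h
  · intro h
    refine ⟨((f⁻¹ : K.Aut) : Equiv.Perm V) w, ?_, by simp⟩
    have := reachable_map f⁻¹ h
    rw [show Sym2.map ((f⁻¹ : K.Aut) : Equiv.Perm V) '' (Sym2.map (f : Equiv.Perm V) '' J) = J by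
      simpa using sym2_image_inv f⁻¹ J] at this
    simpa using this

theorem Inverts.map {K : CubeSystem V} {f g : K.Aut} (hfg : Commute f g) {J : Set (Sym2 V)}
    (h : K.Inverts f J) : K.Inverts f (Sym2.map (g : Equiv.Perm V) '' J) := by
  have hc : ∀ x, (f : Equiv.Perm V) ((g : Equiv.Perm V) x) =
      (g : Equiv.Perm V) ((f : Equiv.Perm V) x) := fun x =>
    congrArg (fun k : K.Aut => (k : Equiv.Perm V) x) hfg.eq
  have hc2 : ∀ e : Sym2 V, (e.map (g : Equiv.Perm V)).map (f : Equiv.Perm V) =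
      (e.map (f : Equiv.Perm V)).map (g : Equiv.Perm V) := by
    intro e
    induction e with | _ a b => simp [hc]
  have hJ : Sym2.map (f : Equiv.Perm V) '' (Sym2.map (g : Equiv.Perm V) '' J) =
      Sym2.map (g : Equiv.Perm V) '' J := by
    conv_rhs => rw [← h.1]
    simp only [Set.image_image, hc2]
  refine ⟨hJ, fun A hA => ⟨?_, fun hA' => ?_⟩⟩
  · simpa only [hJ] using sides_map f hA
  · have hB := sides_map g⁻¹ hA
    rw [show Sym2.map ((g⁻¹ : K.Aut) : Equiv.Perm V) '' (Sym2.map (g : Equiv.Perm V) '' J) = J by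
      simpa using sym2_image_inv g⁻¹ J] at hB
    refine (h.2 _ hB).2 ?_
    apply (g : Equiv.Perm V).injective.image_injective
    simp only [Set.image_image, ← hc]
    simpa using hA'

theorem invertedHyperplanes_map {K : CubeSystem V} {f g : K.Aut} (hfg : Commute f g)
    {J : Set (Sym2 V)} (h : J ∈ K.invertedHyperplanes g) :
    Sym2.map (f : Equiv.Perm V) '' J ∈ K.invertedHyperplanes g := by
  obtain ⟨hJ, n, hn⟩ := h
  exact ⟨hyperplanes_map f hJ, n, hn.map (hfg.symm.zpow_left n)⟩

theorem image_mem_quotientHalfspaces {K : CubeSystem V} {f g : K.Aut} (hfg : Commute f g)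
    {A : Set V} (h : A ∈ K.quotientHalfspaces (K.invertedHyperplanes g)) :
    (f : Equiv.Perm V) '' A ∈ K.quotientHalfspaces (K.invertedHyperplanes g) := by
  obtain ⟨J, hJ, hJ', hA⟩ := h
  refine ⟨_, hyperplanes_map f hJ, fun hf => hJ' ?_, sides_map f hA⟩
  have := invertedHyperplanes_map (f := f⁻¹) hfg.inv_left hf
  rwa [show Sym2.map ((f⁻¹ : K.Aut) : Equiv.Perm V) '' (Sym2.map (f : Equiv.Perm V) '' J) = J by
    simpa using sym2_image_inv f⁻¹ J] at this

theorem image_mem_quotientHalfspaces_iff (K : CubeSystem V) (g : K.Aut) (A : Set V) :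
    (g : Equiv.Perm V) '' A ∈ K.quotientHalfspaces (K.invertedHyperplanes g) ↔
      A ∈ K.quotientHalfspaces (K.invertedHyperplanes g) := by
  refine ⟨fun h => ?_, image_mem_quotientHalfspaces (Commute.refl g)⟩
  have := image_mem_quotientHalfspaces (Commute.refl g).inv_left h
  rw [Set.image_image] at this
  simpa using this

/-! ### Isometries and their median sets -/

/-- `g` is elliptic: its orbits are bounded. -/
def IsElliptic (K : CubeSystem V) (g : K.Aut) : Prop :=
  ∀ v, ∃ N : ℕ, ∀ n : ℤ, K.graph.dist v (((g ^ n : K.Aut) : Equiv.Perm V) v) ≤ N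

/-- `g` is inverting: its orbits are unbounded and one of its powers inverts a hyperplane. -/
def IsInverting (K : CubeSystem V) (g : K.Aut) : Prop :=
  ¬ K.IsElliptic g ∧ (K.invertedHyperplanes g).Nonempty

/-- `g` is loxodromic: it has an axis. -/
def IsLoxodromic (K : CubeSystem V) (g : K.Aut) : Prop :=
  ∃ γ, IsAxis K.graph (g : Equiv.Perm V) γ

/-- `C` is a cube stabilised by `g`, of minimal dimension among the cubes stabilised by `g` (a cube
of dimension `d` has `2 ^ d` vertices). -/
def IsMinimalStableCube (K : CubeSystem V) (g : K.Aut) (C : Set V) : Prop :=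
  C ∈ K.cubes ∧ (g : Equiv.Perm V) '' C = C ∧
    ∀ D ∈ K.cubes, (g : Equiv.Perm V) '' D = D → C.ncard ≤ D.ncard

/-- The isometry induced by `g` on the cubical quotient by the hyperplanes inverted by powers of
`g`. -/
def quotientMap (K : CubeSystem V) (g : K.Aut) :
    CubulationVertex (K.quotientHalfspaces (K.invertedHyperplanes g)) →
      CubulationVertex (K.quotientHalfspaces (K.invertedHyperplanes g)) :=
  cubulationMap _ g (K.image_mem_quotientHalfspaces_iff g)

/-- The median set of `g`:
* if `g` is elliptic, the union of the cubes of minimal dimension stabilised by `g`;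
* if `g` is loxodromic, the union of the axes of `g`;
* if `g` is inverting, the preimage, under the canonical map sending a vertex to its principal
  orientation, of the union of the axes of `g` in the cubical quotient of the complex by the
  hyperplanes inverted by powers of `g`. -/
def medianSet (K : CubeSystem V) (g : K.Aut) : Set V :=
  {v | (K.IsElliptic g ∧ ∃ C, K.IsMinimalStableCube g C ∧ v ∈ C) ∨
    (K.IsLoxodromic g ∧ ∃ γ, IsAxis K.graph (g : Equiv.Perm V) γ ∧ v ∈ Set.range γ) ∨
    (K.IsInverting g ∧ ∃ γ, IsAxis (cubulationGraph _) (K.quotientMap g) γ ∧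
      ∃ i, (γ i).1 = principalOrientation (K.quotientHalfspaces (K.invertedHyperplanes g)) v)}

/-! ### Median subalgebras and their cubulations -/

/-- `m` is the median point of `x`, `y`, `z`. -/
def IsMedianPoint (K : CubeSystem V) (x y z m : V) : Prop :=
  K.graph.dist x y = K.graph.dist x m + K.graph.dist m y ∧
  K.graph.dist x z = K.graph.dist x m + K.graph.dist m z ∧
  K.graph.dist y z = K.graph.dist y m + K.graph.dist m z

/-- `M` is a median subalgebra: it is stable under the median operation. -/
def IsMedianSubalgebra (K : CubeSystem V) (M : Set V) : Prop :=
  ∀ x ∈ M, ∀ y ∈ M, ∀ z ∈ M, ∀ m, K.IsMedianPoint x y z m → m ∈ M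

/-- A subset `A` of a median subalgebra `M` is convex in the median algebra `M` if it contains the
interval `{z ∈ M | μ(x, y, z) = z}` for all `x`, `y` in `A`. -/
def IsMedianConvex (K : CubeSystem V) (M : Set V) (A : Set M) : Prop :=
  ∀ x ∈ A, ∀ y ∈ A, ∀ z : M, K.IsMedianPoint x y z z → z ∈ A

/-- The halfspaces of the walls of the median algebra `M`: the subsets `A` such that `A` and its
complement in `M` are convex and non-empty. -/
def medianHalfspaces (K : CubeSystem V) (M : Set V) : Set (Set M) :=
  {A | A.Nonempty ∧ Aᶜ.Nonempty ∧ K.IsMedianConvex M A ∧ K.IsMedianConvex M Aᶜ}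

/-- The cubulation of the median algebra `M`, i.e. of the wallspace given by all its walls. -/
def medianCubulation (K : CubeSystem V) (M : Set V) :
    CubeSystem (CubulationVertex (K.medianHalfspaces M)) :=
  cubulation (K.medianHalfspaces M)

/-- The median set of an automorphism of `K` in the barycentric subdivision of `K`. -/
def subdivisionMedianSet (K : CubeSystem V) (g : K.Aut) : Set K.cubes :=
  K.subdivision.medianSet (K.subdivisionHom g)

end CubeSystem

/-! Everything is expressed through halfspaces of one-skeletons. In a CAT(0) cube complex the flag
condition makes edge paths have reduced forms which are unique up to exchanging the two halves of
squares, and homotopies do not change these forms. Simple connectivity then yields two metric facts: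
the one-skeleton is bipartite (`IsCAT0.dist_ne`) and satisfies the quadrangle condition
(`IsCAT0.quadrangle`). From these, every edge is cut by exactly one pair of complementary convex
halfspaces, the distance counts the halfspaces containing one point and not the other
(`IsCAT0.finite_separating`), and medians exist (`IsCAT0.exists_median`).

Conversely, `IsCode` recognises CAT(0) complexes: vertices are coded by sets, edges toggle one
element, and conditions on pairs of elements decide which codes occur. It applies to cubulations of
wallspaces (`isCode_cubulation`) and to the subdivision, where a cube is coded by the halfspaces
containing it (`IsCAT0.isCode_subdivision`).

The subdivision serves to remove inversions. Inclusion of cubes orients the edges dual to a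
hyperplane coherently, and automorphisms of the original complex preserve inclusion, so none of them
swaps two complementary halfspaces of the subdivision (`IsCAT0.subdivision_image_ne_compl`). An
element of infinite order fixes no vertex of the subdivision, because stabilisers of cubes are
finite. The forward orbit of a vertex of minimal displacement then crosses each hyperplane at most
once (`IsMinDisplacement.orbitMonotone`), so translates of a geodesic from the vertex to its image
form an axis, and the median set is the set of vertices of minimal displacement (`medianSet_eq`).
Monotone orbits pass to medians by a majority argument and force minimal displacement by comparison
of growth, so this set is a median subalgebra.

The cubulation of this subalgebra has no vertices besides its points (`exists_principal`) and is
locally finite (`finite_adj_principal`). Finiteness of stabilisers is inherited. Cocompactness holds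
because the points of given displacement yield, after translation into finitely many
representatives, only finitely many conjugates of the element (`exists_finite_centralizer_orbits`).
-/

namespace CubeSystem

variable {V : Type*}

/-! ### Coordinates in hypercubes -/

/-- Switch the `i`-th coordinate. -/
def toggle {n : ℕ} (x : Fin n → Bool) (i : Fin n) : Fin n → Bool := Function.update x i (!x i)

@[simp] theorem toggle_same {n : ℕ} (x : Fin n → Bool) (i : Fin n) : toggle x i i = !x i := by
  simp [toggle]

@[simp] theorem toggle_of_ne {n : ℕ} (x : Fin n → Bool) {i j : Fin n} (h : j ≠ i) :
    toggle x i j = x j := by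
  simp [toggle, h]

theorem toggle_comm {n : ℕ} (x : Fin n → Bool) (i j : Fin n) :
    toggle (toggle x i) j = toggle (toggle x j) i := by
  ext k
  by_cases hi : k = i <;> by_cases hj : k = j <;> simp_all [toggle, Function.update_apply]

@[simp] theorem toggle_toggle {n : ℕ} (x : Fin n → Bool) (i : Fin n) :
    toggle (toggle x i) i = x := by
  simp [toggle]

theorem toggle_ne {n : ℕ} (x : Fin n → Bool) (i : Fin n) : toggle x i ≠ x := fun h => by
  have := congrFun h i
  simp at this

theorem toggle_injective {n : ℕ} (x : Fin n → Bool) : Function.Injective (toggle x) := by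
  intro i j h
  by_contra hij
  have := congrFun h i
  simp [hij] at this

theorem hypercubeAdj_iff {n : ℕ} {x y : Fin n → Bool} : HypercubeAdj x y ↔ ∃ i, y = toggle x i := by
  constructor
  · rintro ⟨i, hi, h⟩
    refine ⟨i, funext fun j => ?_⟩
    by_cases hj : j = i
    · subst hj; simp only [toggle_same]; revert hi; cases x j <;> cases y j <;> simp
    · rw [toggle_of_ne _ hj]; by_contra hne; exact hj (h j (Ne.symm hne))
  · rintro ⟨i, rfl⟩
    refine ⟨i, by simp, fun j hj => ?_⟩
    by_contra hne
    simp [hne] at hj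

theorem hypercubeFace_eq {n : ℕ} {a b : Fin n → Bool} {S : Set (Fin n)} (h : b ∈ hypercubeFace a S) :
    hypercubeFace a S = hypercubeFace b S := by
  ext x
  exact forall₂_congr fun i hi => by rw [h i hi]

theorem mem_hypercubeFace_self {n : ℕ} (a : Fin n → Bool) (S : Set (Fin n)) :
    a ∈ hypercubeFace a S := fun _ _ => rfl

theorem toggle_mem_hypercubeFace {n : ℕ} {a : Fin n → Bool} {S : Set (Fin n)} {i : Fin n} :
    toggle a i ∈ hypercubeFace a S ↔ i ∉ S := by
  refine ⟨fun h hi => by simpa using h i hi, fun hi j hj => toggle_of_ne _ ?_⟩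
  rintro rfl; exact hi hj

theorem hypercubeFace_empty {n : ℕ} (a : Fin n → Bool) : hypercubeFace a ∅ = Set.univ := by
  ext; simp [hypercubeFace]

/-- Any two points of a hypercube are related by an equivalence relation which relates all
neighbours. -/
theorem hypercube_induction {n : ℕ} {P : (Fin n → Bool) → Prop} (x : Fin n → Bool) (hx : P x)
    (h : ∀ y i, P y → P (toggle y i)) (z : Fin n → Bool) : P z := by
  classical
  suffices H : ∀ (s : Finset (Fin n)) (z : Fin n → Bool), (∀ i, z i ≠ x i → i ∈ s) → P z from
    H Finset.univ z fun i _ => Finset.mem_univ i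
  intro s
  induction s using Finset.induction_on with
  | empty =>
    intro z hz
    rwa [show z = x from funext fun i => by by_contra hi; simpa using hz i hi]
  | insert i s _ ih =>
    intro z hz
    by_cases hi : z i = x i
    · refine ih z fun j hj => ?_
      rcases Finset.mem_insert.1 (hz j hj) with rfl | h'
      · exact absurd hi hj
      · exact h'
    · rw [← toggle_toggle z i]
      refine h _ i (ih _ fun j hj => ?_)
      have hji : j ≠ i := by
        rintro rfl
        apply hj
        revert hi
        simp only [toggle_same]
        cases z j <;> cases x j <;> simp
      rw [toggle_of_ne _ hji] at hj
      exact (Finset.mem_insert.1 (hz j hj)).resolve_left hji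

/-! ### Charts of cubes -/

/-- A parametrisation of the cube `C` which identifies its faces. -/
structure IsChart (K : CubeSystem V) (C : Set V) {n : ℕ} (φ : (Fin n → Bool) → V) : Prop where
  inj : Function.Injective φ
  range_eq : Set.range φ = C
  mem_cubes_iff : ∀ D ⊆ C, D ∈ K.cubes ↔ ∃ a S, D = φ '' hypercubeFace a S

variable {K : CubeSystem V} {C : Set V} {n : ℕ} {φ : (Fin n → Bool) → V}

theorem IsCubeComplex.chart (hK : K.IsCubeComplex) (hC : C ∈ K.cubes) :
    ∃ (n : ℕ) (φ : (Fin n → Bool) → V), K.IsChart C φ := by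
  obtain ⟨n, φ, h1, h2, h3⟩ := hK.exists_chart C hC
  exact ⟨n, φ, h1, h2, h3⟩

theorem IsChart.mem (h : K.IsChart C φ) (x : Fin n → Bool) : φ x ∈ C := h.range_eq ▸ ⟨x, rfl⟩

theorem IsChart.exists_eq (h : K.IsChart C φ) {v : V} (hv : v ∈ C) : ∃ x, φ x = v := by
  rwa [← h.range_eq] at hv

theorem IsChart.image_subset (h : K.IsChart C φ) (S : Set (Fin n → Bool)) : φ '' S ⊆ C := by
  rintro _ ⟨x, -, rfl⟩; exact h.mem x

theorem IsChart.face_mem (h : K.IsChart C φ) (a : Fin n → Bool) (S : Set (Fin n)) :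
    φ '' hypercubeFace a S ∈ K.cubes :=
  (h.mem_cubes_iff _ (h.image_subset _)).2 ⟨a, S, rfl⟩

theorem IsChart.exists_face (h : K.IsChart C φ) {D : Set V} (hD : D ∈ K.cubes) (hDC : D ⊆ C)
    {x : Fin n → Bool} (hx : φ x ∈ D) : ∃ S, D = φ '' hypercubeFace x S := by
  obtain ⟨a, S, rfl⟩ := (h.mem_cubes_iff D hDC).1 hD
  exact ⟨S, by rw [hypercubeFace_eq (h.inj.mem_set_image.1 hx)]⟩

theorem IsChart.adj_iff (h : K.IsChart C φ) {x y : Fin n → Bool} :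
    K.graph.Adj (φ x) (φ y) ↔ ∃ i, y = toggle x i := by
  constructor
  · rintro ⟨hne, hm⟩
    obtain ⟨S, hS⟩ := h.exists_face hm (by rintro _ (rfl | rfl) <;> exact h.mem _)
      (x := x) (by simp)
    rw [← Set.image_pair, h.inj.image_injective.eq_iff] at hS
    have hxy : x ≠ y := fun e => hne (e ▸ rfl)
    have hyS : y ∈ hypercubeFace x S := hS ▸ by simp
    obtain ⟨i, hi⟩ := Function.ne_iff.1 hxy
    have hiS : i ∉ S := fun hi' => hi (hyS i hi').symm
    have : toggle x i ∈ ({x, y} : Set _) := hS ▸ toggle_mem_hypercubeFace.2 hiS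
    rcases this with h' | h'
    · exact absurd h' (toggle_ne x i)
    · exact ⟨i, h'.symm⟩
  · rintro ⟨i, rfl⟩
    refine ⟨fun e => toggle_ne x i (h.inj e).symm, ?_⟩
    rw [← Set.image_pair]
    convert h.face_mem x {i}ᶜ using 2
    ext z
    constructor
    · rintro (rfl | rfl)
      · exact mem_hypercubeFace_self _ _
      · exact toggle_mem_hypercubeFace.2 (by simp)
    · intro hz
      have hz' : ∀ j, j ≠ i → z j = x j := fun j hj => hz j (by simpa using hj)
      by_cases hi : z i = x i
      · left; ext j; by_cases hj : j = i
        · rw [hj, hi]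
        · rw [hz' j hj]
      · right; ext j; by_cases hj : j = i
        · subst hj; simp only [toggle_same]; revert hi; cases z j <;> cases x j <;> simp
        · rw [hz' j hj, toggle_of_ne _ hj]

theorem IsCubeComplex.ncard_eq (hK : K.IsCubeComplex) (hC : C ∈ K.cubes) :
    ∃ n, C.ncard = 2 ^ n := by
  obtain ⟨n, φ, h⟩ := hK.chart hC
  refine ⟨n, ?_⟩
  rw [← h.range_eq, ← Set.image_univ, Set.ncard_image_of_injective _ h.inj, Set.ncard_univ]
  simp

theorem IsCubeComplex.finite (hK : K.IsCubeComplex) (hC : C ∈ K.cubes) : C.Finite := by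
  obtain ⟨n, φ, h⟩ := hK.chart hC
  rw [← h.range_eq]
  exact Set.finite_range φ

theorem IsCubeComplex.nonempty (hK : K.IsCubeComplex) (hC : C ∈ K.cubes) : C.Nonempty := by
  obtain ⟨n, φ, h⟩ := hK.chart hC
  exact ⟨_, h.mem fun _ => true⟩

/-- A cube which contains a vertex of another cube and all its neighbours in this other cube
contains this other cube. -/
theorem IsCubeComplex.subset_of_neighbors (hK : K.IsCubeComplex) {C D : Set V} (hC : C ∈ K.cubes)
    (hD : D ∈ K.cubes) {v : V} (hvC : v ∈ C) (hvD : v ∈ D)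
    (h : ∀ w ∈ C, K.graph.Adj v w → w ∈ D) : C ⊆ D := by
  obtain ⟨n, φ, hφ⟩ := hK.chart hC
  obtain ⟨x, rfl⟩ := hφ.exists_eq hvC
  obtain ⟨S, hS⟩ := hφ.exists_face (hK.inter_mem C hC D hD ⟨_, hvC, hvD⟩) Set.inter_subset_left
    ⟨hvC, hvD⟩
  -- A coordinate held constant on the face `C ∩ D` would exclude the neighbour of `v` in that
  -- direction.
  have : S = ∅ := by
    rw [Set.eq_empty_iff_forall_notMem]
    intro i
    have := h _ (hφ.mem (toggle x i)) (hφ.adj_iff.2 ⟨i, rfl⟩)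
    have h2 : φ (toggle x i) ∈ C ∩ D := ⟨hφ.mem _, this⟩
    rw [hS, hφ.inj.mem_set_image, toggle_mem_hypercubeFace] at h2
    exact h2
  rw [this, hypercubeFace_empty, Set.image_univ, hφ.range_eq] at hS
  exact fun v hv => (hS.symm ▸ hv : v ∈ C ∩ D).2

/-! ### Squares -/

/-- `u`, `a`, `c`, `d` are the consecutive vertices of a square. -/
structure IsSquare (K : CubeSystem V) (u a c d : V) : Prop where
  adj₁ : K.graph.Adj u a
  adj₂ : K.graph.Adj a c
  adj₃ : K.graph.Adj u d
  adj₄ : K.graph.Adj d c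
  ne : a ≠ d
  ne' : u ≠ c
  mem : {u, a, c, d} ∈ K.cubes

theorem IsSquare.swap {u a c d : V} (h : K.IsSquare u a c d) : K.IsSquare u d c a :=
  ⟨h.3, h.4, h.1, h.2, h.5.symm, h.6, by
    convert h.7 using 1; ext; simp; tauto⟩

theorem IsSquare.rotate {u a c d : V} (h : K.IsSquare u a c d) : K.IsSquare a c d u :=
  ⟨h.2, h.4.symm, h.1.symm, h.3, h.6.symm, h.5, by
    convert h.7 using 1; ext; simp; tauto⟩

/-- Otherwise the two squares would meet in exactly three vertices, whereas the intersection is a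
cube and the number of its vertices is a power of two. -/
theorem IsSquare.unique (hK : K.IsCubeComplex) {u a c d d' : V} (h : K.IsSquare u a c d)
    (h' : K.IsSquare u a c d') : d = d' := by
  by_contra hne
  have hm := hK.inter_mem _ h.mem _ h'.mem ⟨u, by simp, by simp⟩
  have : ({u, a, c, d} ∩ {u, a, c, d'} : Set V) = {u, a, c} := by
    ext x
    simp only [Set.mem_inter_iff, Set.mem_insert_iff, Set.mem_singleton_iff]
    constructor
    · rintro ⟨h1, h2⟩
      by_contra hx
      simp only [not_or] at hx
      exact hne (by rw [← show x = d by tauto, ← show x = d' by tauto])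
    · tauto
  rw [this] at hm
  obtain ⟨n, hn⟩ := hK.ncard_eq hm
  have h3 : ({u, a, c} : Set V).ncard = 3 :=
    Set.ncard_eq_three.2 ⟨u, a, c, h.adj₁.ne, h.ne', h.adj₂.ne, rfl⟩
  rw [h3] at hn
  rcases n with _ | _ | n
  · omega
  · omega
  · rw [pow_succ, pow_succ] at hn; omega

theorem IsSquare.unique' (hK : K.IsCubeComplex) {u a c d c' : V} (h : K.IsSquare u a c d)
    (h' : K.IsSquare u a c' d) : c = c' :=
  h.swap.rotate.rotate.rotate.unique hK h'.swap.rotate.rotate.rotate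

theorem IsChart.isSquare (h : K.IsChart C φ) (x : Fin n → Bool) {i j : Fin n} (hij : i ≠ j) :
    K.IsSquare (φ x) (φ (toggle x i)) (φ (toggle (toggle x i) j)) (φ (toggle x j)) := by
  refine ⟨h.adj_iff.2 ⟨i, rfl⟩, h.adj_iff.2 ⟨j, rfl⟩, h.adj_iff.2 ⟨j, rfl⟩,
    h.adj_iff.2 ⟨i, toggle_comm _ _ _⟩, fun e => hij (toggle_injective x (h.inj e)), fun e => ?_, ?_⟩
  · have := congrFun (h.inj e) i
    simp [hij] at this
  · have := h.face_mem x {i, j}ᶜ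
    convert this using 1
    have h4 : ({φ x, φ (toggle x i), φ (toggle (toggle x i) j), φ (toggle x j)} : Set V) =
        φ '' {x, toggle x i, toggle (toggle x i) j, toggle x j} := by
      simp [Set.image_insert_eq]
    rw [h4]
    congr 1
    ext z
    constructor
    · rintro (rfl | rfl | rfl | rfl) k hk <;>
      · simp only [Set.mem_compl_iff, Set.mem_insert_iff, Set.mem_singleton_iff, not_or] at hk
        simp [hk.1, hk.2]
    · intro hz
      have hz' : ∀ k, k ≠ i → k ≠ j → z k = x k := fun k h1 h2 => hz k (by simp [h1, h2])
      have key : ∀ y : Fin n → Bool, (∀ k, k ≠ i → k ≠ j → y k = x k) → z i = y i → z j = y j →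
          z = y := by
        intro y hy h1 h2
        ext k
        by_cases hk : k = i
        · rw [hk, h1]
        by_cases hk' : k = j
        · rw [hk', h2]
        rw [hz' k hk hk', hy k hk hk']
      have hb : ∀ {b c : Bool}, b ≠ c → b = !c := by decide
      by_cases h1 : z i = x i <;> by_cases h2 : z j = x j
      · exact Or.inl (key _ (fun _ _ _ => rfl) h1 h2)
      · exact Or.inr (Or.inr (Or.inr (key _ (fun k _ h2 => by simp [h2])
          (by simp [hij, h1]) (by simp [hb h2]))))
      · exact Or.inr (Or.inl (key _ (fun k h1 _ => by simp [h1])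
          (by simp [hb h1]) (by simp [hij.symm, h2])))
      · exact Or.inr (Or.inr (Or.inl (key _ (fun k h1 h2 => by simp [h1, h2])
          (by simp [hij, hb h1]) (by simp [hij.symm, hb h2]))))

theorem IsSquare.not_adj (hK : K.IsCubeComplex) {u a c d : V} (h : K.IsSquare u a c d) :
    ¬ K.graph.Adj u c := by
  intro hc
  obtain ⟨n, φ, hφ⟩ := hK.chart h.mem
  obtain ⟨x, rfl⟩ := hφ.exists_eq (v := u) (by simp)
  obtain ⟨_, rfl⟩ := hφ.exists_eq (v := a) (by simp)
  obtain ⟨_, rfl⟩ := hφ.exists_eq (v := c) (by simp)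
  obtain ⟨i, rfl⟩ := hφ.adj_iff.1 h.adj₁
  obtain ⟨k, rfl⟩ := hφ.adj_iff.1 hc
  obtain ⟨l, hl⟩ := hφ.adj_iff.1 h.adj₂
  have h1 := congrFun hl k
  by_cases hki : k = i
  · subst hki
    exact toggle_ne _ _ hl.symm
  by_cases hkl : k = l
  · subst hkl
    have h2 := congrFun hl i
    simp [Ne.symm hki] at h2
  · simp [hki, hkl] at h1

theorem IsSquare.mem_link (hK : K.IsCubeComplex) {u a c d : V} (h : K.IsSquare u a c d) :
    {a, d} ∈ K.link u := by
  refine ⟨_, h.mem, by simp, ?_⟩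
  ext x
  simp only [Set.mem_insert_iff, Set.mem_singleton_iff, Set.mem_ofPred_eq]
  constructor
  · rintro (rfl | rfl)
    · exact ⟨by simp, h.adj₁⟩
    · exact ⟨by simp, h.adj₃⟩
  · rintro ⟨rfl | rfl | rfl | rfl, hx⟩
    · exact absurd hx (K.graph.loopless.irrefl _)
    · exact Or.inl rfl
    · exact absurd hx (h.not_adj hK)
    · exact Or.inr rfl

/-- Three squares around a vertex of a nonpositively curved complex span a cube. -/
theorem exists_isSquare_of_three (hK : K.IsCubeComplex) (hN : K.IsNonpositivelyCurved)
    {w b₀ b₁ b₂ c c' t : V} (h₁ : K.IsSquare w b₀ c b₁) (h₂ : K.IsSquare w b₁ c' b₂)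
    (h₃ : K.IsSquare b₁ c t c') :
    ∃ a, K.IsSquare w b₀ a b₂ ∧ K.IsSquare b₀ c t a ∧ K.IsSquare b₂ c' t a := by
  have hl₁ : {w, c} ∈ K.link b₁ := h₁.swap.rotate.swap.mem_link hK
  have hl₂ : {w, c'} ∈ K.link b₁ := h₂.rotate.swap.mem_link hK
  have hl₃ : {c, c'} ∈ K.link b₁ := h₃.mem_link hK
  -- The three squares at `b₁` make the neighbours `w`, `c`, `c'` pairwise joined in the link, so
  -- flagness produces a cube in which they are three coordinate directions.
  obtain ⟨C, hC, hb, hs⟩ := hN b₁ {w, c, c'} (by simp) (by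
    rintro x (rfl | rfl | rfl)
    exacts [h₁.adj₃.symm, h₁.adj₄, h₂.adj₂]) (by
    rintro x (rfl | rfl | rfl) y (rfl | rfl | rfl) hxy
    exacts [absurd rfl hxy, hl₁, hl₂, Set.pair_comm _ _ ▸ hl₁, absurd rfl hxy, hl₃,
      Set.pair_comm _ _ ▸ hl₂, Set.pair_comm _ _ ▸ hl₃, absurd rfl hxy])
  obtain ⟨n, φ, hφ⟩ := hK.chart hC
  have h₁' : w ∈ {w ∈ C | K.graph.Adj b₁ w} := hs ▸ by simp
  have h₂' : c ∈ {w ∈ C | K.graph.Adj b₁ w} := hs ▸ by simp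
  have h₃' : c' ∈ {w ∈ C | K.graph.Adj b₁ w} := hs ▸ by simp
  obtain ⟨x, rfl⟩ := hφ.exists_eq hb
  obtain ⟨_, rfl⟩ := hφ.exists_eq h₁'.1
  obtain ⟨_, rfl⟩ := hφ.exists_eq h₂'.1
  obtain ⟨_, rfl⟩ := hφ.exists_eq h₃'.1
  obtain ⟨i, rfl⟩ := hφ.adj_iff.1 h₁'.2
  obtain ⟨j, rfl⟩ := hφ.adj_iff.1 h₂'.2
  obtain ⟨k, rfl⟩ := hφ.adj_iff.1 h₃'.2
  have hij : i ≠ j := by rintro rfl; exact h₁.ne' rfl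
  have hik : i ≠ k := by rintro rfl; exact h₂.ne' rfl
  have hjk : j ≠ k := by rintro rfl; exact h₃.ne rfl
  obtain rfl := (h₁.swap.rotate.swap).unique' hK ((hφ.isSquare x hij))
  obtain rfl := (h₂.rotate.swap).unique' hK ((hφ.isSquare x hik))
  obtain rfl := h₃.unique' hK ((hφ.isSquare x hjk))
  -- The new vertex is the one opposite to `b₁` in the 3-cube spanned by the three directions.
  refine ⟨φ (toggle (toggle (toggle x i) j) k), hφ.isSquare _ hjk, ?_, ?_⟩
  · have := hφ.isSquare (toggle (toggle x i) j) hik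
    rwa [toggle_comm x i j, toggle_toggle, toggle_comm x j i] at this
  · have := hφ.isSquare (toggle (toggle x i) k) hij
    rwa [toggle_comm x i k, toggle_toggle, toggle_comm x k i, toggle_comm x k j,
      toggle_comm (toggle x i) k j] at this

end CubeSystem

namespace CubeSystem

variable {V : Type*} {K : CubeSystem V}

/-! ### Square equivalence of edge paths

Edge paths are recorded by the lists of their vertices. -/

/-- Equivalence of edge paths generated by the replacement of half of the boundary of a square by
the other half. -/
inductive SquareEquiv (K : CubeSystem V) : List V → List V → Prop
  | single (b : V) : SquareEquiv K [b] [b]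
  | cons (u : V) {a : V} {l l' : List V} :
      SquareEquiv K (a :: l) (a :: l') → SquareEquiv K (u :: a :: l) (u :: a :: l')
  | square {u a c d : V} {l l' m : List V} : K.IsSquare u a c d →
      SquareEquiv K (a :: l) (a :: c :: m) → SquareEquiv K (d :: l') (d :: c :: m) →
      SquareEquiv K (u :: a :: l) (u :: d :: l')

namespace SquareEquiv

theorem refl (K : CubeSystem V) : ∀ (u : V) (l : List V), K.SquareEquiv (u :: l) (u :: l)
  | u, [] => .single u
  | u, a :: l => .cons u (refl K a l)

theorem symm {l m : List V} (h : K.SquareEquiv l m) : K.SquareEquiv m l := by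
  induction h with
  | single b => exact .single b
  | cons u _ ih => exact .cons u ih
  | square hs h1 h2 _ _ => exact .square hs.swap h2 h1

theorem length_eq {l m : List V} (h : K.SquareEquiv l m) : l.length = m.length := by
  induction h with
  | single b => rfl
  | cons u _ ih => simpa using ih
  | square hs h1 h2 ih1 ih2 => simp_all

/-- Transitivity is proved, not built in, so that an equivalence between paths with different first
edges can be inverted into a square. The proof is by induction on the length; the essential case is
that of two successive squares at the initial vertex. -/
theorem trans (hK : K.IsCubeComplex) (hN : K.IsNonpositivelyCurved) {l m r : List V}
    (h₁ : K.SquareEquiv l m) (h₂ : K.SquareEquiv m r) : K.SquareEquiv l r := by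
  induction hn : l.length using Nat.strong_induction_on generalizing l m r with
  | _ n ih =>
  have ih' : ∀ {l' m' r' : List V}, l'.length < l.length → K.SquareEquiv l' m' →
      K.SquareEquiv m' r' → K.SquareEquiv l' r' := fun hl h h' => ih _ (hn ▸ hl) h h' rfl
  clear ih
  have hlm := h₁.length_eq
  have hmr := h₂.length_eq
  cases h₁ with
  | single b => exact h₂
  | cons u h =>
    cases h₂ with
    | cons _ h' => exact .cons u (ih' (by simp) h h')
    | square hs h1 h2 => exact .square hs (ih' (by simp) h h1) h2
  | square hs h1 h2 =>
    cases h₂ with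
    | cons _ h' =>
      exact .square hs h1 (ih' (by simp at hlm hmr ⊢; omega) h'.symm h2)
    | square hs' h1' h2' =>
      have e1 := h1.length_eq
      have e2 := h2.length_eq
      have e1' := h1'.length_eq
      have e2' := h2'.length_eq
      simp only [List.length_cons] at hlm hmr e1 e2 e1' e2'
      have h3 := ih' (by simp; omega) h2.symm h1'
      cases h3 with
      | cons _ h4 =>
        obtain rfl := hs.swap.unique hK hs'
        exact .cons _ (ih' (by simp) h1 (ih' (by simp; omega) (.cons _ h4) h2'.symm))
      | square hs₃ h5 h6 =>
        -- The two squares at the initial vertex and a third one behind their common edge are three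
        -- faces of a 3-cube; the opposite three faces give a direct passage from the first path to
        -- the last.
        obtain ⟨x, hx1, hx2, hx3⟩ := exists_isSquare_of_three hK hN hs hs' hs₃
        refine .square hx1
          (ih' (by simp) h1 (ih' (by simp; omega) (.cons _ h5) (.square hx2 (refl _ _ _) (refl _ _ _))))
          (ih' (by simp; omega) h2' (ih' (by simp; omega) (.cons _ h6)
            (.square hx3 (refl _ _ _) (refl _ _ _))))

theorem of_cons_cons {u a : V} {l l' : List V} (h : K.SquareEquiv (u :: a :: l) (u :: a :: l')) :
    K.SquareEquiv (a :: l) (a :: l') := by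
  cases h with
  | cons _ h => exact h
  | square hs _ _ => exact absurd rfl hs.ne

/-- Two equivalent paths which start with different edges. -/
theorem exists_square {u a d : V} {l l' : List V} (h : K.SquareEquiv (u :: a :: l) (u :: d :: l'))
    (hne : a ≠ d) : ∃ c m, K.IsSquare u a c d ∧ K.SquareEquiv (a :: l) (a :: c :: m) ∧
      K.SquareEquiv (d :: l') (d :: c :: m) := by
  cases h with
  | cons _ h => exact absurd rfl hne
  | square hs h1 h2 => exact ⟨_, _, hs, h1, h2⟩

end SquareEquiv

/-! ### Reduced paths and normal forms of walks -/

/-- The edge path cannot be shortened by square moves and a cancellation. -/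
def Reduced (K : CubeSystem V) : List V → Prop
  | [] => True
  | [_] => True
  | u :: a :: l => Reduced K (a :: l) ∧ ∀ m, ¬ K.SquareEquiv (a :: l) (a :: u :: m)

theorem Reduced.of_cons {u : V} {l : List V} (h : K.Reduced (u :: l)) : K.Reduced l := by
  cases l with
  | nil => trivial
  | cons a l => exact h.1

/-- A cancellation on one side of a square can be carried across it. If it involves the edge from
`d` to `c`, the square moves it to the edge from `u` to `a`; if it involves the edge from `u` to
`d`, comparing squares turns it into a cancellation of `a`, `c`. -/
theorem SquareEquiv.reduced_iff (hK : K.IsCubeComplex) (hN : K.IsNonpositivelyCurved)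
    {l m : List V} (h : K.SquareEquiv l m) : K.Reduced l ↔ K.Reduced m := by
  have aux : ∀ {u a c d : V} {l l' m : List V}, K.IsSquare u a c d →
      K.SquareEquiv (a :: l) (a :: c :: m) → K.SquareEquiv (d :: l') (d :: c :: m) →
      (K.Reduced (a :: l) ↔ K.Reduced (a :: c :: m)) →
      (K.Reduced (d :: l') ↔ K.Reduced (d :: c :: m)) →
      K.Reduced (u :: a :: l) → K.Reduced (u :: d :: l') := by
    intro u a c d l l' m hs h1 h2 i1 i2 hl
    have hac := i1.1 hl.1
    refine ⟨i2.2 ⟨hac.1, fun r hr => ?_⟩, fun r hr => ?_⟩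
    · exact hl.2 (d :: r) (h1.trans hK hN ((SquareEquiv.cons a hr).trans hK hN
        (.square hs.rotate (.refl _ _ _) (.refl _ _ _))))
    · obtain ⟨t, m', ht, h3, -⟩ := (h2.symm.trans hK hN hr).exists_square hs.ne'.symm
      obtain rfl := ht.unique' hK hs.swap.rotate
      exact hac.2 _ h3
  induction h with
  | single b => rfl
  | cons u h ih =>
    exact ⟨fun hl => ⟨ih.1 hl.1, fun m hm => hl.2 m (h.trans hK hN hm)⟩,
      fun hl => ⟨ih.2 hl.1, fun m hm => hl.2 m (h.symm.trans hK hN hm)⟩⟩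
  | square hs h1 h2 ih1 ih2 => exact ⟨aux hs h1 h2 ih1 ih2, aux hs.swap h2 h1 ih2 ih1⟩

/-- The reduced path `l` represents the product of the edge from `u` to `v` and of the reduced path
`v :: m`. -/
def IsStep (K : CubeSystem V) (u v : V) (m l : List V) : Prop :=
  K.Reduced (u :: l) ∧
    (K.SquareEquiv (u :: l) (u :: v :: m) ∨ K.SquareEquiv (v :: m) (v :: u :: l))

theorem exists_isStep (hK : K.IsCubeComplex) (hN : K.IsNonpositivelyCurved) (u : V) {v : V}
    {m : List V} (hm : K.Reduced (v :: m)) : ∃ l, K.IsStep u v m l := by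
  by_cases h : ∃ l, K.SquareEquiv (v :: m) (v :: u :: l)
  · obtain ⟨l, hl⟩ := h
    exact ⟨l, ((hl.reduced_iff hK hN).1 hm).of_cons, Or.inr hl⟩
  · exact ⟨v :: m, ⟨hm, not_exists.1 h⟩, Or.inl (.refl _ _ _)⟩

/-- Lengthening and cancelling exclude each other: if the path after `v` can be made to start with
the edge back to `u`, then putting this edge in front does not give a reduced path. -/
theorem IsStep.unique (hK : K.IsCubeComplex) (hN : K.IsNonpositivelyCurved) {u v : V}
    {m m' l l' : List V} (h : K.IsStep u v m l) (h' : K.IsStep u v m' l')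
    (hm : K.SquareEquiv (v :: m) (v :: m')) : K.SquareEquiv (u :: l) (u :: l') := by
  obtain ⟨hl, h | h⟩ := h <;> obtain ⟨hl', h' | h'⟩ := h'
  · exact h.trans hK hN ((SquareEquiv.cons u hm).trans hK hN h'.symm)
  · exact absurd (hm.trans hK hN h') (((h.reduced_iff hK hN).1 hl).2 _)
  · exact absurd (hm.symm.trans hK hN h) (((h'.reduced_iff hK hN).1 hl').2 _)
  · exact (h.symm.trans hK hN (hm.trans hK hN h')).of_cons_cons

theorem IsStep.symm {u v : V} {m l : List V} (h : K.IsStep u v m l) (hm : K.Reduced (v :: m)) :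
    K.IsStep v u l m :=
  ⟨hm, h.2.symm⟩

/-- The two halves of a square act in the same way on reduced paths. -/
theorem exists_isStep_square (hK : K.IsCubeComplex) (hN : K.IsNonpositivelyCurved) {a b c d : V}
    (hs : K.IsSquare a b c d) {m : List V} (hm : K.Reduced (c :: m)) :
    ∃ p q l, K.IsStep b c m p ∧ K.IsStep a b p l ∧ K.IsStep d c m q ∧ K.IsStep a d q l := by
  -- The case where the path from `c` can start towards `b` but not towards `d`: prefixing `d` is a
  -- lengthening, and the square rewrites the result as a path through `a` and `b`, so that the next
  -- edge cancels.
  have aux : ∀ {b d : V}, K.IsSquare a b c d → ∀ l, K.SquareEquiv (c :: m) (c :: b :: l) →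
      (∀ q, ¬ K.SquareEquiv (c :: m) (c :: d :: q)) →
      ∃ p q l, K.IsStep b c m p ∧ K.IsStep a b p l ∧ K.IsStep d c m q ∧ K.IsStep a d q l := by
    intro b d hs p hp hd
    have hdc : K.Reduced (d :: c :: m) := ⟨hm, hd⟩
    have e : K.SquareEquiv (d :: c :: m) (d :: a :: b :: p) :=
      (SquareEquiv.cons d hp).trans hK hN
        (.square hs.rotate.rotate.rotate.swap (.refl _ _ _) (.refl _ _ _))
    have := ((e.reduced_iff hK hN).1 hdc).of_cons
    exact ⟨p, c :: m, b :: p, ⟨this.of_cons, Or.inr hp⟩, ⟨this, Or.inl (.refl _ _ _)⟩,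
      ⟨hdc, Or.inl (.refl _ _ _)⟩, ⟨this, Or.inr e⟩⟩
  by_cases hb : ∃ p, K.SquareEquiv (c :: m) (c :: b :: p)
  · obtain ⟨p, hp⟩ := hb
    by_cases hd : ∃ q, K.SquareEquiv (c :: m) (c :: d :: q)
    · obtain ⟨q, hq⟩ := hd
      -- If both edges at `c` cancel, the path can be made to traverse the square: the two initial
      -- edges span a square at `c`, which must be the given one.
      obtain ⟨t, l, ht, h1, h2⟩ := (hp.symm.trans hK hN hq).exists_square hs.ne
      obtain rfl := ht.unique' hK hs.rotate.rotate.swap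
      have hbp := ((hp.reduced_iff hK hN).1 hm).of_cons
      have hdq := ((hq.reduced_iff hK hN).1 hm).of_cons
      have hl := ((h1.reduced_iff hK hN).1 hbp).of_cons
      exact ⟨p, q, l, ⟨hbp, Or.inr hp⟩, ⟨hl, Or.inr h1⟩, ⟨hdq, Or.inr hq⟩, ⟨hl, Or.inr h2⟩⟩
    · exact aux hs p hp (not_exists.1 hd)
  · by_cases hd : ∃ q, K.SquareEquiv (c :: m) (c :: d :: q)
    · obtain ⟨q, hq⟩ := hd
      obtain ⟨p, q, l, h1, h2, h3, h4⟩ := aux hs.swap q hq (not_exists.1 hb)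
      exact ⟨q, p, l, h3, h4, h1, h2⟩
    · have hbc : K.Reduced (b :: c :: m) := ⟨hm, not_exists.1 hb⟩
      have hdc : K.Reduced (d :: c :: m) := ⟨hm, not_exists.1 hd⟩
      have habc : K.Reduced (a :: b :: c :: m) := by
        refine ⟨hbc, fun r hr => ?_⟩
        obtain ⟨t, l, ht, h1, h2⟩ := hr.exists_square hs.ne'.symm
        obtain rfl := ht.unique' hK hs.rotate.swap.swap
        exact hd ⟨_, h1⟩
      exact ⟨c :: m, c :: m, b :: c :: m, ⟨hbc, Or.inl (.refl _ _ _)⟩,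
        ⟨habc, Or.inl (.refl _ _ _)⟩, ⟨hdc, Or.inl (.refl _ _ _)⟩,
        ⟨habc, Or.inl (.square hs (.refl _ _ _) (.refl _ _ _))⟩⟩

/-- `u :: l` is a reduced path representing the given walk, which starts at `u`. -/
def IsNormalForm (K : CubeSystem V) : ∀ {u v : V}, K.graph.Walk u v → List V → Prop
  | _, _, .nil, l => l = []
  | u, _, .cons (v := v) _ p, l =>
    ∃ m, IsNormalForm K p m ∧ K.Reduced (v :: m) ∧ K.IsStep u v m l

theorem IsNormalForm.reduced {u v : V} {p : K.graph.Walk u v} {l : List V}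
    (h : K.IsNormalForm p l) : K.Reduced (u :: l) := by
  cases p with
  | nil => cases h; trivial
  | cons _ _ => exact h.choose_spec.2.2.1

theorem exists_isNormalForm (hK : K.IsCubeComplex) (hN : K.IsNonpositivelyCurved) {u v : V}
    (p : K.graph.Walk u v) : ∃ l, K.IsNormalForm p l := by
  induction p with
  | nil => exact ⟨[], rfl⟩
  | @cons u _ _ _ _ ih =>
    obtain ⟨m, hm⟩ := ih
    obtain ⟨l, hl⟩ := exists_isStep hK hN u hm.reduced
    exact ⟨l, m, hm, hm.reduced, hl⟩

theorem IsNormalForm.unique (hK : K.IsCubeComplex) (hN : K.IsNonpositivelyCurved) {u v : V}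
    {p : K.graph.Walk u v} {l l' : List V} (h : K.IsNormalForm p l) (h' : K.IsNormalForm p l') :
    K.SquareEquiv (u :: l) (u :: l') := by
  induction p generalizing l l' with
  | nil => cases h; cases h'; exact .refl _ _ _
  | cons _ _ ih =>
    obtain ⟨m, hm, -, h⟩ := h
    obtain ⟨m', hm', -, h'⟩ := h'
    exact h.unique hK hN h' (ih hm hm')

/-- Prefixing an edge acts on classes of reduced paths; the two orientations of an edge act as
inverse operations and the two halves of a square act equally. These are the generators of homotopy.
-/
theorem Homotopic.normalForm (hK : K.IsCubeComplex) (hN : K.IsNonpositivelyCurved) {u v : V}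
    {p q : K.graph.Walk u v} (hpq : K.Homotopic p q) {l l' : List V} (h : K.IsNormalForm p l)
    (h' : K.IsNormalForm q l') : K.SquareEquiv (u :: l) (u :: l') := by
  induction hpq generalizing l l' with
  | refl p => exact h.unique hK hN h'
  | symm _ ih => exact (ih h' h).symm
  | @trans _ _ _ q _ _ _ ih1 ih2 =>
    obtain ⟨m, hm⟩ := exists_isNormalForm hK hN q
    exact (ih1 h hm).trans hK hN (ih2 hm h')
  | cons _ _ ih =>
    obtain ⟨m, hm, -, h⟩ := h
    obtain ⟨m', hm', -, h'⟩ := h'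
    exact h.unique hK hN h' (ih hm hm')
  | backtrack _ p =>
    obtain ⟨m, ⟨m', h1, h2, h3⟩, h4, h5⟩ := h
    exact (h5.unique hK hN (h3.symm h2) (.refl _ _ _)).trans hK hN (h1.unique hK hN h')
  | @square a b c d _ hab hbc had hdc hsq p =>
    obtain ⟨m, ⟨n, h1, h2, h3⟩, h4, h5⟩ := h
    obtain ⟨m', ⟨n', h1', h2', h3'⟩, h4', h5'⟩ := h'
    have e := h1.unique hK hN h1'
    -- The homotopy move for squares does not require its four vertices to be distinct; the
    -- degenerate cases reduce to equality of paths or to backtracks.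
    by_cases hbd : b = d
    · subst hbd
      exact h5.unique hK hN h5' (h3.unique hK hN h3' e)
    by_cases hac : a = c
    · subst hac
      exact ((h5.unique hK hN (h3.symm h2) (.refl _ _ _)).trans hK hN e).trans hK hN
        ((h3'.symm h2').unique hK hN h5' (.refl _ _ _))
    obtain ⟨r, s, t, k1, k2, k3, k4⟩ :=
      exists_isStep_square hK hN ⟨hab, hbc, had, hdc, hbd, hac, hsq⟩ h2
    exact (h5.unique hK hN k2 (h3.unique hK hN k1 (.refl _ _ _))).trans hK hN
      (k4.unique hK hN h5' (k3.unique hK hN h3' e))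

/-! ### Simple connectivity -/

theorem Homotopic.append_right {u v w : V} {p q : K.graph.Walk u v} (h : K.Homotopic p q)
    (r : K.graph.Walk v w) : K.Homotopic (p.append r) (q.append r) := by
  induction h with
  | refl p => exact .refl _
  | symm _ ih => exact (ih r).symm
  | trans _ _ ih1 ih2 => exact (ih1 r).trans (ih2 r)
  | cons h _ ih => exact .cons h (ih r)
  | backtrack h p => exact .backtrack h _
  | square hab hbc had hdc hsq p => exact .square hab hbc had hdc hsq _

theorem Homotopic.append_left {u v w : V} (p : K.graph.Walk u v) {q r : K.graph.Walk v w}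
    (h : K.Homotopic q r) : K.Homotopic (p.append q) (p.append r) := by
  induction p with
  | nil => exact h
  | cons hp _ ih => exact .cons hp (ih h)

theorem homotopic_reverse_append {u v : V} (p : K.graph.Walk u v) :
    K.Homotopic (p.reverse.append p) .nil := by
  induction p with
  | nil => exact .refl _
  | cons h p ih =>
    rw [SimpleGraph.Walk.reverse_cons, ← SimpleGraph.Walk.append_assoc]
    exact .trans (.append_left _ (.backtrack h.symm _)) ih

theorem IsSimplyConnected.homotopic (hS : K.IsSimplyConnected) {u v : V}
    (p q : K.graph.Walk u v) : K.Homotopic p q := by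
  have h1 : K.Homotopic (p.append (q.reverse.append q)) p := by
    simpa using Homotopic.append_left p (homotopic_reverse_append q)
  rw [SimpleGraph.Walk.append_assoc] at h1
  exact h1.symm.trans ((hS.nullHomotopic _ _).append_right q)

theorem walk_support_eq {Γ : SimpleGraph V} {u v : V} (p : Γ.Walk u v) :
    p.support = u :: p.support.tail :=
  p.cons_tail_support.symm

theorem SquareEquiv.exists_walk_iff {l m : List V} (h : K.SquareEquiv l m) (b : V) :
    (∃ u, ∃ p : K.graph.Walk u b, p.support = l) ↔ ∃ u, ∃ p : K.graph.Walk u b, p.support = m := by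
  have hcons : ∀ {u a : V} {l : List V}, (∃ x, ∃ p : K.graph.Walk x b, p.support = u :: a :: l) ↔
      K.graph.Adj u a ∧ ∃ x, ∃ p : K.graph.Walk x b, p.support = a :: l := by
    intro u a l
    constructor
    · rintro ⟨x, p, hp⟩
      cases p with
      | nil => simp at hp
      | cons h p =>
        rw [SimpleGraph.Walk.support_cons, List.cons.injEq] at hp
        obtain ⟨rfl, hp⟩ := hp
        have := hp
        rw [walk_support_eq, List.cons.injEq] at this
        obtain ⟨rfl, -⟩ := this
        exact ⟨h, _, p, hp⟩
    · rintro ⟨h, x, p, hp⟩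
      have := hp
      rw [walk_support_eq, List.cons.injEq] at this
      obtain ⟨rfl, -⟩ := this
      exact ⟨_, .cons h p, by rw [SimpleGraph.Walk.support_cons, hp]⟩
  induction h with
  | single b => rfl
  | cons u h ih => exact hcons.trans ((and_congr_right fun _ => ih).trans hcons.symm)
  | square hs h1 h2 ih1 ih2 =>
    refine hcons.trans (Iff.trans ?_ hcons.symm)
    refine (and_congr_right fun _ => ih1.trans hcons).trans
      (Iff.trans ?_ (and_congr_right fun _ => hcons.symm.trans ih2.symm))
    simp [hs.adj₁, hs.adj₂, hs.adj₃, hs.adj₄]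

theorem IsStep.length {u v : V} {m l : List V} (h : K.IsStep u v m l) :
    (l.length = m.length + 1 ∧ K.SquareEquiv (u :: l) (u :: v :: m)) ∨ m.length = l.length + 1 := by
  obtain ⟨-, h | h⟩ := h
  · exact Or.inl ⟨by simpa using h.length_eq, h⟩
  · exact Or.inr (by simpa using h.length_eq)

/-- Each edge changes the length of the normal form by exactly one, up or down. -/
theorem IsNormalForm.length {u v : V} {p : K.graph.Walk u v} {l : List V}
    (h : K.IsNormalForm p l) : l.length ≤ p.length ∧ l.length % 2 = p.length % 2 := by
  induction p generalizing l with
  | nil => cases h; simp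
  | cons _ p ih =>
    obtain ⟨m, hm, -, h⟩ := h
    have := ih hm
    rw [SimpleGraph.Walk.length_cons]
    rcases h.length with ⟨h, -⟩ | h <;> omega

/-- Full length means that no cancellation ever happened, so the path was only rearranged by
squares. -/
theorem IsNormalForm.equiv_support (hK : K.IsCubeComplex) (hN : K.IsNonpositivelyCurved)
    {u v : V} {p : K.graph.Walk u v} {l : List V}
    (h : K.IsNormalForm p l) (hl : l.length = p.length) : K.SquareEquiv (u :: l) p.support := by
  induction p generalizing l with
  | nil => cases h; exact .refl _ _ _
  | cons _ p ih =>
    obtain ⟨m, hm, -, h⟩ := h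
    have := hm.length
    rw [SimpleGraph.Walk.length_cons] at hl
    rw [SimpleGraph.Walk.support_cons]
    rcases h.length with ⟨h1, h2⟩ | h
    · refine h2.trans hK hN ?_
      have := ih hm (by omega)
      rw [walk_support_eq] at this ⊢
      exact .cons _ this
    · omega

theorem IsNormalForm.exists_walk {u v : V} {p : K.graph.Walk u v} {l : List V}
    (h : K.IsNormalForm p l) : ∃ q : K.graph.Walk u v, q.support = u :: l := by
  suffices H : ∃ x, ∃ q : K.graph.Walk x v, q.support = u :: l by
    obtain ⟨x, q, hq⟩ := H
    have := hq
    rw [walk_support_eq, List.cons.injEq] at this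
    obtain ⟨rfl, -⟩ := this
    exact ⟨q, hq⟩
  induction p generalizing l with
  | nil => cases h; exact ⟨_, .nil, rfl⟩
  | cons hp p ih =>
    obtain ⟨m, hm, -, -, h | h⟩ := h
    · rw [h.exists_walk_iff]
      obtain ⟨x, q, hq⟩ := ih hm
      have := hq
      rw [walk_support_eq, List.cons.injEq] at this
      obtain ⟨rfl, -⟩ := this
      exact ⟨_, .cons hp q, by rw [SimpleGraph.Walk.support_cons, hq]⟩
    · obtain ⟨x, q, hq⟩ := (h.exists_walk_iff _).1 (ih hm)
      cases q with
      | nil => simp at hq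
      | cons h q =>
        rw [SimpleGraph.Walk.support_cons, List.cons.injEq] at hq
        exact ⟨_, q, hq.2⟩

/-! ### Bipartiteness and the quadrangle condition -/

/-- The one-skeleton of a CAT(0) cube complex is bipartite. -/
theorem IsCAT0.dist_ne (hK : K.IsCAT0) (b : V) {u v : V} (h : K.graph.Adj u v) :
    K.graph.dist u b ≠ K.graph.dist v b := by
  obtain ⟨p, hp⟩ := hK.simplyConnected.connected.exists_walk_length_eq_dist v b
  obtain ⟨q, hq⟩ := hK.simplyConnected.connected.exists_walk_length_eq_dist u b
  -- Both walks lead from `u` to `b`, hence are homotopic and have normal forms of the same length;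
  -- since normal forms preserve parity, the two geodesics cannot be equally long.
  obtain ⟨l, hl⟩ := exists_isNormalForm hK.1 hK.2 (.cons h p)
  obtain ⟨m, hm⟩ := exists_isNormalForm hK.1 hK.2 q
  have := ((hK.simplyConnected.homotopic _ _).normalForm hK.1 hK.2 hl hm).length_eq
  have h1 := hl.length.2
  have h2 := hm.length.2
  simp only [List.length_cons, SimpleGraph.Walk.length_cons] at *
  omega

/-- The quadrangle condition. -/
theorem IsCAT0.quadrangle (hK : K.IsCAT0) {b u a d : V} (ha : K.graph.Adj u a)
    (hd : K.graph.Adj u d) (hne : a ≠ d) (hab : K.graph.dist a b + 1 = K.graph.dist u b)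
    (hdb : K.graph.dist d b + 1 = K.graph.dist u b) :
    ∃ c, K.IsSquare u a c d ∧ K.graph.dist c b + 2 = K.graph.dist u b := by
  have hc := hK.simplyConnected.connected
  obtain ⟨p, hp⟩ := hc.exists_walk_length_eq_dist a b
  obtain ⟨q, hq⟩ := hc.exists_walk_length_eq_dist d b
  -- A geodesic is equivalent to its normal form: the latter is itself the vertex list of a walk
  -- with the same ends, so it cannot be shorter.
  have key : ∀ {x} (h : K.graph.Adj u x) (r : K.graph.Walk x b), r.length + 1 = K.graph.dist u b →
      ∃ l, K.IsNormalForm (.cons h r) l ∧ K.SquareEquiv (u :: l) (u :: r.support) := by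
    intro x h r hr
    obtain ⟨l, hl⟩ := exists_isNormalForm hK.1 hK.2 (.cons h r)
    refine ⟨l, hl, hl.equiv_support hK.1 hK.2 (le_antisymm hl.length.1 ?_)⟩
    obtain ⟨s, hs⟩ := hl.exists_walk
    have h1 := congrArg List.length hs
    have h2 := SimpleGraph.dist_le s
    simp only [SimpleGraph.Walk.length_support, List.length_cons, SimpleGraph.Walk.length_cons] at *
    omega
  obtain ⟨l, hl, el⟩ := key ha p (by omega)
  obtain ⟨m, hm, em⟩ := key hd q (by omega)
  have e := el.symm.trans hK.1 hK.2
    (((hK.simplyConnected.homotopic _ _).normalForm hK.1 hK.2 hl hm).trans hK.1 hK.2 em)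
  rw [walk_support_eq p, walk_support_eq q] at e
  obtain ⟨c, r, hs, h1, -⟩ := e.exists_square hne
  refine ⟨c, hs, ?_⟩
  rw [← walk_support_eq] at h1
  obtain ⟨x, s, hs'⟩ := (h1.exists_walk_iff b).1 ⟨a, p, rfl⟩
  cases s with
  | nil => simp at hs'
  | @cons _ y _ _ s =>
    rw [SimpleGraph.Walk.support_cons, List.cons.injEq, walk_support_eq s,
      List.cons.injEq] at hs'
    obtain ⟨rfl, rfl, hs'⟩ := hs'
    have h2 := SimpleGraph.dist_le s
    have h3 := h1.length_eq
    have h6 := congrArg List.length hs'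
    have h4 := hc.dist_triangle (u := x) (v := y) (w := b)
    rw [SimpleGraph.dist_eq_one_iff_adj.2 hs.adj₂] at h4
    have h5 : (y :: s.support.tail).length = s.length + 1 := by
      rw [← walk_support_eq, SimpleGraph.Walk.length_support]
    simp only [List.length_cons, SimpleGraph.Walk.length_support] at h3 h5
    omega

end CubeSystem

namespace CubeSystem

variable {V : Type*} {K : CubeSystem V}

/-! ### Convexity and halfspaces in the one-skeleton -/

/-- The vertex `z` lies on a geodesic between `x` and `y`. -/
def Between (K : CubeSystem V) (x z y : V) : Prop :=
  K.graph.dist x z + K.graph.dist z y = K.graph.dist x y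

theorem Between.symm {x y z : V} (h : K.Between x z y) : K.Between y z x := by
  unfold Between at *
  rw [SimpleGraph.dist_comm, add_comm, SimpleGraph.dist_comm, h, SimpleGraph.dist_comm]

theorem between_left (x y : V) : K.Between x x y := by simp [Between]

theorem between_right (x y : V) : K.Between x y y := by simp [Between]

/-- Convexity with respect to the graph metric. -/
def IsConvex (K : CubeSystem V) (A : Set V) : Prop :=
  ∀ x ∈ A, ∀ y ∈ A, ∀ z, K.Between x z y → z ∈ A

/-- Halfspaces: the proper nonempty convex sets whose complement is convex. -/
structure IsHalfspace (K : CubeSystem V) (A : Set V) : Prop where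
  nonempty : A.Nonempty
  nonempty_compl : Aᶜ.Nonempty
  convex : K.IsConvex A
  convex_compl : K.IsConvex Aᶜ

theorem IsHalfspace.compl {A : Set V} (h : K.IsHalfspace A) : K.IsHalfspace Aᶜ :=
  ⟨h.2, by rw [compl_compl]; exact h.1, h.4, by rw [compl_compl]; exact h.3⟩

namespace IsCAT0

variable (hK : K.IsCAT0)
include hK

theorem connected : K.graph.Connected := hK.simplyConnected.connected

theorem dist_triangle (x y z : V) : K.graph.dist x z ≤ K.graph.dist x y + K.graph.dist y z :=
  hK.connected.dist_triangle

theorem dist_eq_zero {x y : V} : K.graph.dist x y = 0 ↔ x = y := hK.connected.dist_eq_zero_iff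

theorem exists_adj_dist {x b : V} (h : x ≠ b) :
    ∃ y, K.graph.Adj x y ∧ K.graph.dist y b + 1 = K.graph.dist x b := by
  obtain ⟨p, hp⟩ := hK.connected.exists_walk_length_eq_dist x b
  cases p with
  | nil => exact absurd rfl h
  | @cons _ y _ hxy p =>
    refine ⟨y, hxy, ?_⟩
    have h1 := SimpleGraph.dist_le p
    have h2 := hK.dist_triangle x y b
    rw [SimpleGraph.dist_eq_one_iff_adj.2 hxy] at h2
    rw [SimpleGraph.Walk.length_cons] at hp
    omega

theorem dist_of_adj {u v : V} (h : K.graph.Adj u v) (b : V) :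
    K.graph.dist u b = K.graph.dist v b + 1 ∨ K.graph.dist v b = K.graph.dist u b + 1 := by
  have h1 := hK.dist_triangle u v b
  have h2 := hK.dist_triangle v u b
  rw [SimpleGraph.dist_eq_one_iff_adj.2 h] at h1
  rw [SimpleGraph.dist_eq_one_iff_adj.2 h.symm] at h2
  have := hK.dist_ne b h
  omega

theorem dist_of_adj' {u v : V} (h : K.graph.Adj u v) (b : V) :
    K.graph.dist b u = K.graph.dist b v + 1 ∨ K.graph.dist b v = K.graph.dist b u + 1 := by
  simpa only [SimpleGraph.dist_comm] using hK.dist_of_adj h b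

theorem dist_eq_two {u a c : V} (h : K.graph.Adj u a) (h' : K.graph.Adj a c) (hne : u ≠ c) :
    K.graph.dist u c = 2 := by
  have h1 := hK.dist_of_adj h c
  have h2 := mt hK.dist_eq_zero.1 hne
  rw [SimpleGraph.dist_eq_one_iff_adj.2 h'] at h1
  omega

theorem between_of_adj {u a c : V} (h : K.graph.Adj u a) (h' : K.graph.Adj a c) (hne : u ≠ c) :
    K.Between u a c := by
  rw [Between, hK.dist_eq_two h h' hne, SimpleGraph.dist_eq_one_iff_adj.2 h,
    SimpleGraph.dist_eq_one_iff_adj.2 h']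

theorem isSquare {u a c d : V} (h₁ : K.graph.Adj u a) (h₂ : K.graph.Adj a c)
    (h₃ : K.graph.Adj u d) (h₄ : K.graph.Adj d c) (hne : a ≠ d) (hne' : u ≠ c) :
    K.IsSquare u a c d := by
  obtain ⟨x, hx, h⟩ := hK.quadrangle (b := c) h₁ h₃ hne
    (by rw [hK.dist_eq_two h₁ h₂ hne', SimpleGraph.dist_eq_one_iff_adj.2 h₂])
    (by rw [hK.dist_eq_two h₁ h₂ hne', SimpleGraph.dist_eq_one_iff_adj.2 h₄])
  rw [hK.dist_eq_two h₁ h₂ hne'] at h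
  rwa [← hK.dist_eq_zero.1 (show K.graph.dist x c = 0 by omega)]

/-- The set of vertices which are nearer to `a` than to its neighbour `b` is locally convex. -/
theorem near_locally_convex {a b x y z : V} (hab : K.graph.Adj a b)
    (hx : K.graph.dist x a < K.graph.dist x b) (hy : K.graph.dist y a < K.graph.dist y b)
    (hxz : K.graph.Adj x z) (hzy : K.graph.Adj z y) (hxy : x ≠ y) :
    K.graph.dist z a < K.graph.dist z b := by
  by_contra hz
  have e1 := hK.dist_of_adj' hab x
  have e2 := hK.dist_of_adj' hab y
  have e3 := hK.dist_of_adj' hab z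
  have f1 := hK.dist_of_adj hxz a
  have f2 := hK.dist_of_adj hxz b
  have f3 := hK.dist_of_adj hzy a
  have f4 := hK.dist_of_adj hzy b
  obtain ⟨c, hc, hcd⟩ := hK.quadrangle (b := a) hxz.symm hzy hxy (by omega) (by omega)
  have g1 := hK.dist_of_adj' hab c
  have g2 := hK.dist_of_adj hc.adj₂ b
  have hcz : z ≠ c := hc.ne'
  -- Seen from `b`, both `z` and `c` are nearer than `x`. The resulting square shares `z`, `x`, `c`
  -- with the previous one, so `t = y`, although `t` is nearer to `b` than `z` and `y` is farther.
  obtain ⟨t, ht, htd⟩ := hK.quadrangle (b := b) hxz hc.adj₂ hcz (by omega) (by omega)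
  have k1 := hK.isSquare hxz.symm hc.adj₂ ht.adj₂ ht.adj₄.symm (by rintro rfl; omega) hcz
  have k2 := hc.swap.rotate.rotate.rotate
  have k3 := k1.rotate.rotate.rotate
  have := hc.unique hK.1 (k1)
  subst this
  omega

/-- Local convexity becomes convexity because the set is connected: geodesics to `a` stay inside it,
and any path inside it can be deformed by squares onto any geodesic with the same ends. -/
theorem near_convex {a b : V} (hab : K.graph.Adj a b) :
    K.IsConvex {x | K.graph.dist x a < K.graph.dist x b} := by
  set S : Set V := {x | K.graph.dist x a < K.graph.dist x b} with hS
  have hloc : ∀ {x y z}, x ∈ S → y ∈ S → K.graph.Adj x z → K.graph.Adj z y → x ≠ y → z ∈ S :=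
    fun hx hy => hK.near_locally_convex hab hx hy
  have key : ∀ n : ℕ, ∀ x y (p : K.graph.Walk x y), p.length ≤ n → (∀ z ∈ p.support, z ∈ S) →
      ∀ z, K.Between x z y → z ∈ S := by
    intro n
    induction n with
    | zero =>
      intro x y p hp hpS z hz
      cases p with
      | nil =>
        have : x = z := hK.dist_eq_zero.1 (by simp only [Between, SimpleGraph.dist_self] at hz; omega)
        exact this ▸ hpS x (by simp)
      | cons _ _ => simp at hp
    | succ n ih =>
      intro x y p hp hpS z hz
      cases p with
      | nil =>
        have : x = z := hK.dist_eq_zero.1 (by simp only [Between, SimpleGraph.dist_self] at hz; omega)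
        exact this ▸ hpS x (by simp)
      | @cons _ x₁ _ hx p =>
        rw [SimpleGraph.Walk.length_cons] at hp
        simp only [SimpleGraph.Walk.support_cons, List.mem_cons] at hpS
        have hxS : x ∈ S := hpS x (Or.inl rfl)
        have h1 := ih x₁ y p (by omega) fun z hz => hpS z (Or.inr hz)
        have hp' := SimpleGraph.dist_le p
        unfold Between at hz h1
        rcases eq_or_ne x z with rfl | hxz
        · exact hxS
        rcases hK.dist_of_adj hx y with hd | hd
        · obtain ⟨w, hw, hwd⟩ := hK.exists_adj_dist hxz
          have t1 := hK.dist_triangle w z y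
          have t2 := hK.dist_triangle x w y
          rw [SimpleGraph.dist_eq_one_iff_adj.2 hw] at t2
          rcases eq_or_ne x₁ w with rfl | hne
          · exact h1 z (by omega)
          -- The given path leaves `x` through `x₁`, the geodesic towards `z` through `w`. The
          -- vertex `c` lies between `x₁` and `y`, hence in `S` by induction, and local convexity
          -- then puts `w` in `S`; the path from `w` through `c` is short enough to repeat the
          -- argument.
          obtain ⟨c, hc, hcd⟩ := hK.quadrangle (b := y) hx hw hne (by omega) (by omega)
          have hcS : c ∈ S := h1 c (by rw [SimpleGraph.dist_eq_one_iff_adj.2 hc.adj₂]; omega)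
          have hwS : w ∈ S := hloc hxS hcS hw hc.adj₄ hc.ne'
          obtain ⟨q, hq⟩ := hK.connected.exists_walk_length_eq_dist c y
          refine ih w y (.cons hc.adj₄ q) (by rw [SimpleGraph.Walk.length_cons]; omega) ?_ z
            (by unfold Between; omega)
          intro t ht
          rw [SimpleGraph.Walk.support_cons, List.mem_cons] at ht
          rcases ht with rfl | ht
          · exact hwS
          · refine h1 t ?_
            obtain ⟨q₁, q₂, rfl⟩ := SimpleGraph.Walk.mem_support_iff_exists_append.1 ht
            have t3 := SimpleGraph.dist_le q₁
            have t4 := SimpleGraph.dist_le q₂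
            have t5 := hK.dist_triangle x₁ t y
            have t6 := hK.dist_triangle x₁ c t
            rw [SimpleGraph.dist_eq_one_iff_adj.2 hc.adj₂] at t6
            rw [SimpleGraph.Walk.length_append] at hq
            omega
        · refine h1 z ?_
          have t1 := hK.dist_triangle x₁ x z
          have t2 := hK.dist_triangle x₁ z y
          rw [SimpleGraph.dist_eq_one_iff_adj.2 hx.symm] at t1
          omega
  have hwalk : ∀ n : ℕ, ∀ x ∈ S, K.graph.dist x a = n →
      ∃ p : K.graph.Walk x a, ∀ z ∈ p.support, z ∈ S := by
    intro n
    induction n with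
    | zero =>
      intro x hx h
      obtain rfl := hK.dist_eq_zero.1 h
      exact ⟨.nil, by simpa using hx⟩
    | succ n ih =>
      intro x hx h
      obtain ⟨y, hy, hyd⟩ := hK.exists_adj_dist (x := x) (b := a) (by rintro rfl; simp at h)
      have hyS : y ∈ S := by
        have := hK.dist_of_adj hy b
        change K.graph.dist x a < K.graph.dist x b at hx
        have h3 := hK.dist_of_adj' hab x
        have h4 := hK.dist_of_adj' hab y
        change K.graph.dist y a < K.graph.dist y b
        omega
      obtain ⟨p, hp⟩ := ih y hyS (by omega)
      refine ⟨.cons hy p, fun z hz => ?_⟩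
      rw [SimpleGraph.Walk.support_cons, List.mem_cons] at hz
      rcases hz with rfl | hz
      exacts [hx, hp z hz]
  intro x hx y hy z hz
  obtain ⟨p, hp⟩ := hwalk _ x hx rfl
  obtain ⟨q, hq⟩ := hwalk _ y hy rfl
  refine key _ x y (p.append q.reverse) le_rfl (fun w hw => ?_) z hz
  rw [SimpleGraph.Walk.mem_support_append_iff, SimpleGraph.Walk.support_reverse, List.mem_reverse]
    at hw
  exact hw.elim (hp w) (hq w)

theorem isHalfspace_near {a b : V} (hab : K.graph.Adj a b) :
    K.IsHalfspace {x | K.graph.dist x a < K.graph.dist x b} := by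
  have : {x | K.graph.dist x a < K.graph.dist x b}ᶜ = {x | K.graph.dist x b < K.graph.dist x a} := by
    ext x
    have := hK.dist_of_adj' hab x
    simp only [Set.mem_compl_iff, Set.mem_ofPred_eq]
    omega
  refine ⟨⟨a, ?_⟩, this ▸ ⟨b, ?_⟩, hK.near_convex hab, this ▸ hK.near_convex hab.symm⟩
  · simp [SimpleGraph.dist_eq_one_iff_adj.2 hab]
  · simp [SimpleGraph.dist_eq_one_iff_adj.2 hab.symm]

/-- The halfspace delimited by the hyperplane dual to an edge is unique. -/
theorem halfspace_eq_near {a b : V} (hab : K.graph.Adj a b) {A : Set V} (hA : K.IsHalfspace A)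
    (ha : a ∈ A) (hb : b ∉ A) : A = {x | K.graph.dist x a < K.graph.dist x b} := by
  ext x
  rw [Set.mem_ofPred_eq]
  constructor
  · intro hx
    by_contra hlt
    have := hK.dist_of_adj' hab x
    refine hb (hA.convex x hx a ha b ?_)
    rw [Between, SimpleGraph.dist_eq_one_iff_adj.2 hab.symm]
    omega
  · intro hlt
    by_contra hx
    have := hK.dist_of_adj' hab x
    refine hA.convex_compl x hx b hb a ?_ ha
    rw [Between, SimpleGraph.dist_eq_one_iff_adj.2 hab]
    omega

theorem halfspace_unique {a b : V} (hab : K.graph.Adj a b) {A B : Set V} (hA : K.IsHalfspace A)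
    (hB : K.IsHalfspace B) (haA : a ∈ A) (hbA : b ∉ A) (haB : a ∈ B) (hbB : b ∉ B) : A = B := by
  rw [hK.halfspace_eq_near hab hA haA hbA, hK.halfspace_eq_near hab hB haB hbB]

theorem exists_halfspace_adj {a b : V} (hab : K.graph.Adj a b) :
    ∃ A, K.IsHalfspace A ∧ a ∈ A ∧ b ∉ A :=
  ⟨_, hK.isHalfspace_near hab, by simp [SimpleGraph.dist_eq_one_iff_adj.2 hab], by simp⟩

/-- The halfspaces which contain `x` and not `y`. -/
theorem finite_separating (x y : V) : {A | K.IsHalfspace A ∧ x ∈ A ∧ y ∉ A}.Finite ∧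
    {A | K.IsHalfspace A ∧ x ∈ A ∧ y ∉ A}.ncard = K.graph.dist x y := by
  induction hn : K.graph.dist x y generalizing x with
  | zero =>
    obtain rfl := hK.dist_eq_zero.1 hn
    have : {A | K.IsHalfspace A ∧ x ∈ A ∧ x ∉ A} = ∅ := by ext; simp
    rw [this]; simp
  | succ n ih =>
    obtain ⟨x₁, hx, hd⟩ := hK.exists_adj_dist (x := x) (b := y) (by rintro rfl; simp at hn)
    obtain ⟨A, hA, hxA, hx₁A⟩ := hK.exists_halfspace_adj hx
    have hyA : y ∉ A := by
      intro hy
      refine hx₁A (hA.convex x hxA y hy x₁ ?_)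
      rw [Between, SimpleGraph.dist_eq_one_iff_adj.2 hx]
      omega
    obtain ⟨h1, h2⟩ := ih x₁ (by omega)
    -- One step along a geodesic removes exactly one separating halfspace. A new one containing `x₁`
    -- and not `x` would be the complement of `A`, but `y` lies in that complement.
    have : {A | K.IsHalfspace A ∧ x ∈ A ∧ y ∉ A} =
        insert A {A | K.IsHalfspace A ∧ x₁ ∈ A ∧ y ∉ A} := by
      ext B
      simp only [Set.mem_insert_iff, Set.mem_ofPred_eq]
      constructor
      · rintro ⟨hB, hxB, hyB⟩
        by_cases h : x₁ ∈ B
        · exact Or.inr ⟨hB, h, hyB⟩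
        · exact Or.inl (hK.halfspace_unique hx hB hA hxB h hxA hx₁A)
      · rintro (rfl | ⟨hB, hxB, hyB⟩)
        · exact ⟨hA, hxA, hyA⟩
        · refine ⟨hB, ?_, hyB⟩
          by_contra h
          have h5 : Bᶜ = A := hK.halfspace_unique hx hB.compl hA h (by simpa using hxB) hxA hx₁A
          exact hyA (h5 ▸ hyB)
    rw [this]
    refine ⟨h1.insert A, ?_⟩
    rw [Set.ncard_insert_of_notMem (fun h => hx₁A h.2.1) h1, h2]

end IsCAT0

end CubeSystem

/-! ### Separation by halfspaces, medians, gates and dual edges -/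

namespace CubeSystem

variable {V : Type*} {K : CubeSystem V}

namespace IsCAT0

variable (hK : K.IsCAT0)
include hK

theorem exists_halfspace {x y : V} (h : x ≠ y) : ∃ A, K.IsHalfspace A ∧ x ∈ A ∧ y ∉ A := by
  have h1 := (hK.finite_separating x y).2
  have h2 := mt hK.dist_eq_zero.1 h
  obtain ⟨A, hA⟩ := Set.nonempty_of_ncard_ne_zero (h1 ▸ h2)
  exact ⟨A, hA⟩

/-- If every halfspace containing `x` and `y` contains `z`, the halfspaces separating `x` from `z`
and those separating `z` from `y` form disjoint families, all separating `x` from `y`; counting them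
gives the missing inequality. -/
theorem between_iff {x z y : V} :
    K.Between x z y ↔ ∀ A, K.IsHalfspace A → x ∈ A → y ∈ A → z ∈ A := by
  refine ⟨fun h A hA hx hy => hA.convex x hx y hy z h, fun h => ?_⟩
  refine le_antisymm ?_ (hK.dist_triangle x z y)
  rw [← (hK.finite_separating x z).2, ← (hK.finite_separating z y).2,
    ← (hK.finite_separating x y).2,
    ← Set.ncard_union_eq _ (hK.finite_separating x z).1 (hK.finite_separating z y).1]
  · refine Set.ncard_le_ncard ?_ (hK.finite_separating x y).1
    rintro A (⟨hA, h1, h2⟩ | ⟨hA, h1, h2⟩)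
    · exact ⟨hA, h1, fun hy => h2 (h A hA h1 hy)⟩
    · refine ⟨hA, ?_, h2⟩
      by_contra hx
      exact h _ hA.compl hx h2 h1
  · rw [Set.disjoint_left]
    exact fun A h1 h2 => h1.2.2 h2.2.1

/-- Starting from `x`, one moves as long as possible towards `y` and `z` simultaneously. By the
quadrangle condition, a vertex with no neighbour nearer to both lies between them. -/
theorem exists_median (x y z : V) :
    ∃ m, K.Between x m y ∧ K.Between x m z ∧ K.Between y m z := by
  have step : ∀ n m, K.graph.dist m z = n → K.graph.dist m y + n = K.graph.dist y z ∨
      ∃ w, K.graph.Adj m w ∧ K.graph.dist w y + 1 = K.graph.dist m y ∧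
        K.graph.dist w z + 1 = n := by
    intro n
    induction n with
    | zero =>
      intro m hm
      obtain rfl := hK.dist_eq_zero.1 hm
      left; rw [SimpleGraph.dist_comm]; rfl
    | succ n ih =>
      intro m hm
      obtain ⟨w, hw, hwd⟩ := hK.exists_adj_dist (x := m) (b := z) (by rintro rfl; simp at hm)
      rcases hK.dist_of_adj hw y with hd | hd
      · exact Or.inr ⟨w, hw, hd.symm, by omega⟩
      rcases ih w (by omega) with h | ⟨w₁, hw₁, h1, h2⟩
      · left; omega
      obtain ⟨c, hc, hcd⟩ := hK.quadrangle (b := y) hw.symm hw₁ (by rintro rfl; omega) (by omega) h1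
      refine Or.inr ⟨c, hc.adj₂, by omega, ?_⟩
      have := hK.dist_of_adj hc.adj₄ z
      have := hK.dist_of_adj hc.adj₂ z
      omega
  have main : ∀ k m, K.graph.dist m y ≤ k → K.Between x m y → K.Between x m z →
      ∃ m, K.Between x m y ∧ K.Between x m z ∧ K.Between y m z := by
    intro k
    induction k with
    | zero =>
      intro m hk h1 h2
      obtain rfl := hK.dist_eq_zero.1 (Nat.le_zero.1 hk)
      exact ⟨m, h1, h2, between_left _ _⟩
    | succ k ih =>
      intro m hk h1 h2
      rcases step _ m rfl with h | ⟨w, hw, h3, h4⟩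
      · exact ⟨m, h1, h2, by rw [Between, SimpleGraph.dist_comm, h]⟩
      · have t1 := hK.dist_of_adj' hw x
        have t2 := hK.dist_triangle x w y
        have t3 := hK.dist_triangle x w z
        unfold Between at h1 h2
        refine ih w (by omega) ?_ ?_ <;> unfold Between <;> omega
  exact main _ x le_rfl (between_left _ _) (between_left _ _)

/-- A nearest point is a gate: its median with `y` and `a` lies in `A` by convexity and is no
farther from `y`, so it coincides with that point. -/
theorem convex_exists_gate {A : Set V} (hA : K.IsConvex A) (hne : A.Nonempty) (y : V) :
    ∃ z ∈ A, ∀ a ∈ A, K.Between y z a := by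
  obtain ⟨z, hz, hmin⟩ := exists_minimalFor_of_wellFoundedLT (· ∈ A) (fun z => K.graph.dist y z) hne
  refine ⟨z, hz, fun a ha => ?_⟩
  obtain ⟨m, h1, h2, h3⟩ := hK.exists_median y z a
  have hm : m ∈ A := hA z hz a ha m h3
  have h4 : K.graph.dist y m + K.graph.dist m z = K.graph.dist y z := h1
  have h5 := hmin hm (by simp only; omega)
  simp only at h5
  obtain rfl := hK.dist_eq_zero.1 (show K.graph.dist m z = 0 by omega)
  exact h2

/-- Any two edges dual to the same hyperplane are linked by a sequence of squares. -/
theorem dual_edge_induction {A : Set V} (hA : K.IsHalfspace A) {P : V → V → Prop}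
    (hP : ∀ a b c d, K.IsSquare a b c d → a ∈ A → d ∉ A → b ∈ A → c ∉ A → P a d → P b c)
    {a b a' b' : V} (hab : K.graph.Adj a b) (ha : a ∈ A) (hb : b ∉ A)
    (hab' : K.graph.Adj a' b') (ha' : a' ∈ A) (hb' : b' ∉ A) (h : P a b) : P a' b' := by
  induction hn : K.graph.dist a a' generalizing a b with
  | zero =>
    obtain rfl := hK.dist_eq_zero.1 hn
    suffices b = b' by rwa [← this]
    by_contra hne
    exact hA.convex_compl b hb b' hb' a (hK.between_of_adj hab.symm hab' hne) ha
  | succ n ih =>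
    obtain ⟨x, hx, hxd⟩ := hK.exists_adj_dist (x := a) (b := a') (by rintro rfl; simp at hn)
    have hxA : x ∈ A := by
      refine hA.convex a ha a' ha' x ?_
      rw [Between, SimpleGraph.dist_eq_one_iff_adj.2 hx]; omega
    have e : ∀ y ∈ A, K.graph.dist y b' = K.graph.dist y a' + 1 := by
      intro y hy
      rw [hK.halfspace_eq_near hab' hA ha' hb'] at hy
      have := hK.dist_of_adj' hab' y
      have hy : K.graph.dist y a' < K.graph.dist y b' := hy
      omega
    have e' : K.graph.dist b' a = K.graph.dist b' b + 1 := by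
      have hy : b' ∈ Aᶜ := hb'
      rw [hK.halfspace_eq_near hab.symm hA.compl hb (by simpa using ha)] at hy
      have := hK.dist_of_adj' hab b'
      have hy : K.graph.dist b' b < K.graph.dist b' a := hy
      omega
    rw [SimpleGraph.dist_comm, SimpleGraph.dist_comm (u := b')] at e'
    have e1 := e a ha
    have e2 := e x hxA
    -- Seen from `b'`, the vertex `x` towards `a'` and the other end `b` of the edge are both nearer
    -- than `a`, so they span the next square of the ladder of dual edges.
    obtain ⟨c, hc, -⟩ := hK.quadrangle (b := b') hx hab (by rintro rfl; exact hb hxA) (by omega)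
      (by omega)
    have hcA : c ∉ A := by
      intro hcA
      exact hb (hA.convex a ha c hcA b (hK.between_of_adj hc.adj₃ hc.adj₄ hc.ne'))
    exact ih hc.adj₂ hxA hcA (hP a x c b hc ha hb hxA hcA h) (by omega)

end IsCAT0

/-! ### Automorphisms -/

theorem dist_le_map (f : K.Aut) (hc : K.graph.Connected) (x y : V) :
    K.graph.dist ((f : Equiv.Perm V) x) ((f : Equiv.Perm V) y) ≤ K.graph.dist x y := by
  obtain ⟨p, hp⟩ := hc.exists_walk_length_eq_dist x y
  let F : K.graph →g K.graph := ⟨(f : Equiv.Perm V), fun h => (K.aut_adj_iff f _ _).2 h⟩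
  rw [← hp, ← SimpleGraph.Walk.length_map F p]
  exact SimpleGraph.dist_le _

theorem dist_map (f : K.Aut) (hc : K.graph.Connected) (x y : V) :
    K.graph.dist ((f : Equiv.Perm V) x) ((f : Equiv.Perm V) y) = K.graph.dist x y := by
  refine le_antisymm (dist_le_map f hc x y) ?_
  simpa using dist_le_map f⁻¹ hc ((f : Equiv.Perm V) x) ((f : Equiv.Perm V) y)

theorem between_map (f : K.Aut) (hc : K.graph.Connected) {x y z : V} :
    K.Between ((f : Equiv.Perm V) x) ((f : Equiv.Perm V) y) ((f : Equiv.Perm V) z) ↔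
      K.Between x y z := by
  simp only [Between, dist_map f hc]

theorem IsHalfspace.image {A : Set V} (hA : K.IsHalfspace A) (hc : K.graph.Connected) (f : K.Aut) :
    K.IsHalfspace ((f : Equiv.Perm V) '' A) := by
  have hconv : ∀ {A}, K.IsConvex A → K.IsConvex ((f : Equiv.Perm V) '' A) := by
    rintro A hA _ ⟨x, hx, rfl⟩ _ ⟨y, hy, rfl⟩ z hz
    obtain ⟨z, rfl⟩ := (f : Equiv.Perm V).surjective z
    exact ⟨z, hA x hx y hy z ((between_map f hc).1 hz), rfl⟩
  have h := Set.image_compl_eq (f : Equiv.Perm V).bijective (s := A)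
  exact ⟨hA.1.image _, h ▸ hA.2.image _, hconv hA.3, h ▸ hconv hA.4⟩

end CubeSystem

namespace CubeSystem

variable {V : Type*} {K : CubeSystem V}

/-! ### Vertices of minimal displacement -/

theorem dist_smul (f : K.Aut) (hc : K.graph.Connected) (x y : V) :
    K.graph.dist (f • x) (f • y) = K.graph.dist x y :=
  dist_map f hc x y

theorem between_smul (f : K.Aut) (hc : K.graph.Connected) {x y z : V} :
    K.Between (f • x) (f • y) (f • z) ↔ K.Between x y z :=
  between_map f hc

theorem adj_smul (f : K.Aut) {x y : V} : K.graph.Adj (f • x) (f • y) ↔ K.graph.Adj x y :=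
  K.aut_adj_iff f x y

theorem IsHalfspace.smul {A : Set V} (hA : K.IsHalfspace A) (hc : K.graph.Connected) (f : K.Aut) :
    K.IsHalfspace ((f • ·) '' A) :=
  hA.image hc f

theorem smul_mem_image_smul {A : Set V} (f : K.Aut) {x : V} : f • x ∈ (f • ·) '' A ↔ x ∈ A :=
  (MulAction.injective f).mem_set_image

theorem inv_smul_mem_iff {A : Set V} (f : K.Aut) {x : V} : x ∈ (f⁻¹ • ·) '' A ↔ f • x ∈ A := by
  rw [← smul_mem_image_smul f⁻¹ (A := A), inv_smul_smul]

/-- The displacement of `f` is minimal at `x`. -/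
def IsMinDisplacement (K : CubeSystem V) (f : K.Aut) (x : V) : Prop :=
  ∀ y, K.graph.dist x (f • x) ≤ K.graph.dist y (f • y)

/-- No hyperplane is crossed twice by the orbit of `x`. -/
def OrbitMonotone (K : CubeSystem V) (f : K.Aut) (x : V) : Prop :=
  ∀ A, K.IsHalfspace A → ∀ i : ℕ, f ^ i • x ∉ A → f ^ (i + 1) • x ∈ A →
    ∀ k, i + 1 ≤ k → f ^ k • x ∈ A

variable {f : K.Aut} {x : V}

theorem IsMinDisplacement.of_commute {h : K.Aut} (hc : K.graph.Connected) (hfh : Commute h f)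
    (hx : K.IsMinDisplacement f x) : K.IsMinDisplacement f (h • x) := fun y => by
  rw [← mul_smul, ← hfh.eq, mul_smul, dist_smul h hc]
  exact hx y

theorem IsMinDisplacement.dist_eq {y : V} (hx : K.IsMinDisplacement f x)
    (hy : K.IsMinDisplacement f y) : K.graph.dist x (f • x) = K.graph.dist y (f • y) :=
  le_antisymm (hx y) (hy x)

theorem exists_isMinDisplacement (f : K.Aut) [Nonempty V] : ∃ x, K.IsMinDisplacement f x := by
  obtain ⟨x, -, hx⟩ := exists_minimalFor_of_wellFoundedLT (fun _ : V => True)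
    (fun x => K.graph.dist x (f • x)) ⟨Classical.arbitrary V, trivial⟩
  refine ⟨x, fun y => ?_⟩
  by_contra h
  exact h (hx (j := y) trivial (by simp only; omega))

/-- A hyperplane which separates a point `x` of minimal displacement from its image does not
separate this image from any of the next iterates. -/
theorem IsMinDisplacement.pow_mem (hK : K.IsCAT0)
    (hf : ∀ n : ℕ, ∀ A, K.IsHalfspace A → (f ^ n • ·) '' A ≠ Aᶜ) (n : ℕ)
    (hx : K.IsMinDisplacement f x) {A : Set V} (hA : K.IsHalfspace A) (h0 : x ∉ A)
    (h1 : f • x ∈ A) : f ^ (n + 1) • x ∈ A := by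
  induction n using Nat.strong_induction_on generalizing x A with
  | _ n ih =>
  rcases n.eq_zero_or_pos with rfl | hn
  · simpa using h1
  by_contra hlast
  let T : Set (Set V) := {A | K.IsHalfspace A ∧ x ∉ A ∧ f • x ∈ A ∧ f ^ (n + 1) • x ∉ A}
  have hT : T.Finite := (hK.finite_separating (f • x) x).1.subset fun B hB => ⟨hB.1, hB.2.2.1, hB.2.1⟩
  -- The counterexample is taken minimal for inclusion, so that its hyperplane is crossed by an edge
  -- at `f • x`.
  obtain ⟨A, hAT, hAmin⟩ := hT.exists_minimal ⟨A, hA, h0, h1, hlast⟩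
  obtain ⟨hA, h0, h1, hlast⟩ := hAT
  obtain ⟨y, hyA, hgate⟩ := hK.convex_exists_gate hA.convex_compl ⟨x, h0⟩ (f • x)
  -- A halfspace separating `f • x` from its gate `y` lies inside `A` and is again a counterexample,
  -- so minimality leaves only `A`.
  have hsep : {B | K.IsHalfspace B ∧ f • x ∈ B ∧ y ∉ B} = {A} := by
    ext B
    refine ⟨fun ⟨hB, h1B, hyB⟩ => ?_, ?_⟩
    · have hBA : B ⊆ A := by
        intro b hb
        by_contra hbA
        exact hyB (hB.convex _ h1B b hb y (hgate b hbA))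
      exact hBA.antisymm (hAmin ⟨hB, fun h => h0 (hBA h), h1B, fun h => hlast (hBA h)⟩ hBA)
    · rintro rfl
      exact ⟨hA, h1, hyA⟩
  have hadj : K.graph.Adj (f • x) y := by
    rw [← SimpleGraph.dist_eq_one_iff_adj, ← (hK.finite_separating _ _).2, hsep, Set.ncard_singleton]
  have hc := hK.connected
  have hb : K.Between (f • x) y x := hgate x h0
  have hd : K.graph.dist y (f • x) + K.graph.dist (f • x) (f • y) = K.graph.dist x (f • x) := by
    rw [dist_smul f hc, SimpleGraph.dist_comm (u := y), SimpleGraph.dist_comm (u := x) (v := y), hb,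
      SimpleGraph.dist_comm]
  -- As `y` lies on a geodesic from `x` to `f • x`, passing through `f • x` bounds its displacement
  -- by that of `x`.
  have hy : K.IsMinDisplacement f y := fun z =>
    ((hK.dist_triangle _ (f • x) _).trans hd.le).trans (hx z)
  have hny : f ^ n • y ∉ A := by
    intro h
    have hadj' := (adj_smul (f ^ n)).2 hadj
    rw [← mul_smul, ← pow_succ] at hadj'
    -- Otherwise the edge from `f ^ (n + 1) • x` to `f ^ n • y` would be cut by the translate of `A`
    -- and by `A` with opposite orientations: this is an inversion.
    refine hf n A hA (hK.halfspace_unique hadj' (hA.smul hc (f ^ n)) hA.compl ?_ ?_ hlast (by simpa))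
    · rw [pow_succ, mul_smul]; exact smul_mem_image_smul _ |>.2 h1
    · exact fun h => hyA (smul_mem_image_smul _ |>.1 h)
  rcases (show n = 1 ∨ 2 ≤ n by omega) with rfl | hn
  · rw [pow_one] at hny
    refine hA.convex_compl y hyA _ hny (f • x) ?_ h1
    exact le_antisymm (hd.trans_le (hx y)) (hK.dist_triangle _ _ _)
  · have hfy : f • y ∈ A := by
      have h2 := ih 1 (by omega) hx hA h0 h1
      refine hA.convex _ h1 _ h2 _ ?_
      rw [pow_succ, pow_one, mul_smul, between_smul f hc]
      exact hb.symm
    have := ih (n - 1) (by omega) hy hA hyA hfy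
    rw [Nat.sub_add_cancel (by omega)] at this
    exact hny this

theorem IsMinDisplacement.orbitMonotone (hK : K.IsCAT0)
    (hf : ∀ n : ℕ, ∀ A, K.IsHalfspace A → (f ^ n • ·) '' A ≠ Aᶜ)
    (hx : K.IsMinDisplacement f x) : K.OrbitMonotone f x := by
  intro A hA i h0 h1 k hk
  obtain ⟨k, rfl⟩ := Nat.exists_eq_add_of_le hk
  have := (hx.of_commute hK.connected (Commute.pow_self f i)).pow_mem hK hf k hA h0
    (by rwa [← mul_smul, ← pow_succ'])
  rwa [← mul_smul, ← pow_add, show k + 1 + i = i + 1 + k by ring] at this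

theorem OrbitMonotone.mem_of_le (h : K.OrbitMonotone f x) {A : Set V} (hA : K.IsHalfspace A)
    {i j : ℕ} (hij : i ≤ j) (hi : f ^ i • x ∉ A) (hj : f ^ j • x ∈ A) {k : ℕ} (hk : j ≤ k) :
    f ^ k • x ∈ A := by
  obtain ⟨n, rfl⟩ := Nat.exists_eq_add_of_le hij
  induction n generalizing i with
  | zero => exact absurd hj hi
  | succ n ih =>
    by_cases h1 : f ^ (i + 1) • x ∈ A
    · exact h A hA i hi h1 k (by omega)
    · rw [show i + (n + 1) = i + 1 + n by ring] at hj hk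
      exact ih h1 (by omega) hj hk

/-- No halfspace contains `x` and `f ^ (n + 1) • x` without `f ^ n • x`, so the distances between
successive points of the orbit add up. -/
theorem OrbitMonotone.dist_pow (hK : K.IsCAT0) (h : K.OrbitMonotone f x) (n : ℕ) :
    K.graph.dist x (f ^ n • x) = n * K.graph.dist x (f • x) := by
  induction n with
  | zero => simp
  | succ n ih =>
    have hb : K.Between x (f ^ n • x) (f ^ (n + 1) • x) := by
      rw [hK.between_iff]
      intro A hA hx hx'
      by_contra hn
      exact h.mem_of_le hA.compl (Nat.zero_le n) (by simpa using hx) hn (Nat.le_succ n) hx'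
    rw [← hb, ih, pow_succ, mul_smul, dist_smul _ hK.connected]
    ring

/-- If the orbit of `x` enters a halfspace, then the orbit of another point does not stay out of
it. -/
theorem exists_pow_mem (hK : K.IsCAT0) {A : Set V} (hA : K.IsHalfspace A) {y : V} {i : ℕ}
    (hi : f ^ i • x ∉ A) (hx : ∀ k, i + 1 ≤ k → f ^ k • x ∈ A) (j : ℕ) :
    ∃ k, j ≤ k ∧ f ^ k • y ∈ A := by
  by_contra! hy
  have hfin := (hK.finite_separating x y).1
  -- Infinitely many pullbacks of `A` would contain `x` and not `y`. Two of them coincide, so `A` is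
  -- stable under a positive power of `f`, which sends `f ^ i • x` into `A`.
  have hmem : ∀ n : ℕ, ((f ^ (i + 1 + j + n))⁻¹ • ·) '' A ∈
      {A | K.IsHalfspace A ∧ x ∈ A ∧ y ∉ A} := fun n =>
    ⟨hA.smul hK.connected _, (inv_smul_mem_iff _).2 (hx _ (by omega)),
      fun h => hy _ (by omega) ((inv_smul_mem_iff _).1 h)⟩
  obtain ⟨n, -, m, -, hnm, he⟩ := Set.infinite_univ.exists_lt_map_eq_of_mapsTo
    (f := fun n : ℕ => ((f ^ (i + 1 + j + n))⁻¹ • ·) '' A) (fun n _ => hmem n) hfin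
  have he : ((f ^ (i + 1 + j + n))⁻¹ • ·) '' A = ((f ^ (i + 1 + j + m))⁻¹ • ·) '' A := he
  obtain ⟨r, rfl⟩ := Nat.exists_eq_add_of_lt hnm
  apply hi
  have h1 : f ^ (r + 1 + i) • x ∈ A := hx _ (by omega)
  have h2 : (f ^ (i + 1 + j + (n + r + 1)))⁻¹ • (f ^ (r + 1 + i) • x) ∈
      ((f ^ (i + 1 + j + n))⁻¹ • ·) '' A := by
    rw [he]; exact (smul_mem_image_smul _).2 h1
  rw [inv_smul_mem_iff, ← mul_smul, ← mul_smul] at h2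
  convert h2 using 2
  rw [show i + 1 + j + (n + r + 1) = i + 1 + j + n + (r + 1) by ring, pow_add f _ (r + 1),
    pow_add f (r + 1) i]
  group

/-- If the orbit of `m` enters `A` and later leaves it, majorities among `x`, `y`, `z` do the same
at these times. Two majorities share a point, which gives `s` entering `A` and `t` leaving it; `s`
shows that the orbit of `t` must come back, against monotonicity. -/
theorem OrbitMonotone.median (hK : K.IsCAT0) {x y z m : V} (hx : K.OrbitMonotone f x)
    (hy : K.OrbitMonotone f y) (hz : K.OrbitMonotone f z) (hxy : K.Between x m y)
    (hxz : K.Between x m z) (hyz : K.Between y m z) : K.OrbitMonotone f m := by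
  have hc := hK.connected
  intro A hA i h0 h1 k hk
  by_contra hk'
  have maj : ∀ n {B}, K.IsHalfspace B → f ^ n • m ∉ B → (f ^ n • x ∉ B ∧ f ^ n • y ∉ B) ∨
      (f ^ n • x ∉ B ∧ f ^ n • z ∉ B) ∨ (f ^ n • y ∉ B ∧ f ^ n • z ∉ B) := by
    intro n B hB hm
    have e1 := mt (fun h : f ^ n • x ∈ B ∧ f ^ n • y ∈ B => hB.convex _ h.1 _ h.2 _ ((between_smul (f ^ n) hc).2 hxy)) hm
    have e2 := mt (fun h : f ^ n • x ∈ B ∧ f ^ n • z ∈ B => hB.convex _ h.1 _ h.2 _ ((between_smul (f ^ n) hc).2 hxz)) hm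
    have e3 := mt (fun h : f ^ n • y ∈ B ∧ f ^ n • z ∈ B => hB.convex _ h.1 _ h.2 _ ((between_smul (f ^ n) hc).2 hyz)) hm
    tauto
  have a0 := maj i hA h0
  have a1 := maj (i + 1) hA.compl (by simpa using h1)
  have a2 := maj k hA hk'
  simp only [Set.mem_compl_iff, not_not] at a1
  have hs : ∃ s, K.OrbitMonotone f s ∧ f ^ i • s ∉ A ∧ f ^ (i + 1) • s ∈ A := by
    rcases a0 with ⟨p, q⟩ | ⟨p, q⟩ | ⟨p, q⟩ <;> rcases a1 with ⟨r, s⟩ | ⟨r, s⟩ | ⟨r, s⟩ <;>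
    first
    | exact ⟨x, hx, by assumption, by assumption⟩
    | exact ⟨y, hy, by assumption, by assumption⟩
    | exact ⟨z, hz, by assumption, by assumption⟩
  have ht : ∃ t, K.OrbitMonotone f t ∧ f ^ (i + 1) • t ∈ A ∧ f ^ k • t ∉ A := by
    rcases a1 with ⟨p, q⟩ | ⟨p, q⟩ | ⟨p, q⟩ <;> rcases a2 with ⟨r, s⟩ | ⟨r, s⟩ | ⟨r, s⟩ <;>
    first
    | exact ⟨x, hx, by assumption, by assumption⟩
    | exact ⟨y, hy, by assumption, by assumption⟩
    | exact ⟨z, hz, by assumption, by assumption⟩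
  obtain ⟨s, hs, s0, s1⟩ := hs
  obtain ⟨t, ht, t0, t1⟩ := ht
  obtain ⟨n, hn, hn'⟩ := exists_pow_mem hK hA (y := t) s0 (hs A hA i s0 s1) k
  exact ht.mem_of_le hA.compl hk (by simpa using t0) t1 hn hn'

/-- Distances along both orbits grow linearly, with slopes the displacements, and after any number
of iterations they differ by at most twice the distance from `m` to `x`; so the slopes agree. -/
theorem OrbitMonotone.isMinDisplacement (hK : K.IsCAT0) {x m : V} (hx : K.IsMinDisplacement f x)
    (hx' : K.OrbitMonotone f x) (hm : K.OrbitMonotone f m) : K.IsMinDisplacement f m := by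
  suffices h : K.graph.dist m (f • m) ≤ K.graph.dist x (f • x) from fun y => h.trans (hx y)
  by_contra! hlt
  -- One iteration more than the largest possible gap between the two distances suffices for a
  -- contradiction.
  set n := 2 * K.graph.dist m x + 1
  have h1 := hm.dist_pow hK n
  have h2 := hx'.dist_pow hK n
  have h3 := hK.dist_triangle m x (f ^ n • m)
  have h4 := hK.dist_triangle x (f ^ n • x) (f ^ n • m)
  rw [dist_smul _ hK.connected, SimpleGraph.dist_comm (u := x) (v := m)] at h4
  have h5 : n * (K.graph.dist x (f • x) + 1) ≤ n * K.graph.dist m (f • m) :=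
    Nat.mul_le_mul_left _ hlt
  rw [mul_add] at h5
  omega

/-! ### Axes -/

theorem IsMinDisplacement.translationLength_eq (hx : K.IsMinDisplacement f x) :
    translationLength K.graph (f : Equiv.Perm V) = K.graph.dist x (f • x) := by
  refine le_antisymm (Nat.sInf_le ⟨x, rfl⟩) ?_
  refine le_csInf ⟨_, x, rfl⟩ ?_
  rintro _ ⟨y, rfl⟩
  exact hx y

theorem isMinDisplacement_of_isAxis {γ : ℤ → V} (h : IsAxis K.graph (f : Equiv.Perm V) γ) (i : ℤ) :
    K.IsMinDisplacement f (γ i) := fun y => by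
  have h1 : f • γ i = γ (i + translationLength K.graph (f : Equiv.Perm V)) := h.translates i
  rw [h1, h.geodesic]
  have h2 : translationLength K.graph (f : Equiv.Perm V) ≤ K.graph.dist y (f • y) :=
    Nat.sInf_le ⟨y, rfl⟩
  omega

/-- The axis is the concatenation of the translates of a geodesic from `x` to its image. It is
1-Lipschitz, and the distances between points of the orbit are exact. -/
theorem IsMinDisplacement.exists_isAxis (hK : K.IsCAT0) (hx : K.IsMinDisplacement f x)
    (hm : K.OrbitMonotone f x) (hpos : 0 < K.graph.dist x (f • x)) :
    ∃ γ, IsAxis K.graph (f : Equiv.Perm V) γ ∧ γ 0 = x := by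
  have hc := hK.connected
  obtain ⟨p, hp⟩ := hc.exists_walk_length_eq_dist x (f • x)
  set ℓ : ℕ := K.graph.dist x (f • x) with hℓ
  have hℓ0 : (0 : ℤ) < ℓ := by exact_mod_cast hpos
  let γ : ℤ → V := fun i => f ^ (i / ℓ) • p.getVert (i % ℓ).toNat
  -- The value `r = ℓ` is included: it says that consecutive translates fit together.
  have hγ : ∀ (q : ℤ) (r : ℕ), r ≤ ℓ → γ (q * ℓ + r) = f ^ q • p.getVert r := by
    intro q r hr
    rcases hr.lt_or_eq with hr | rfl
    · have e1 : (q * ℓ + r) / ℓ = q := by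
        rw [add_comm, Int.add_mul_ediv_right _ _ hℓ0.ne', Int.ediv_eq_zero_of_lt (by omega) (by omega),
          zero_add]
      have e2 : (q * ℓ + r) % ℓ = r := by
        rw [add_comm, Int.add_mul_emod_self_right, Int.emod_eq_of_lt (by omega) (by omega)]
      simp only [γ, e1, e2, Int.toNat_natCast]
    · have e1 : (q * ℓ + ℓ) / (ℓ : ℤ) = q + 1 := by
        rw [← add_one_mul, Int.mul_ediv_cancel _ hℓ0.ne']
      have e2 : (q * ℓ + ℓ) % (ℓ : ℤ) = 0 := by
        rw [← add_one_mul, Int.mul_emod_left]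
      simp only [γ, e1, e2]
      rw [← hp, p.getVert_length, Int.toNat_zero, p.getVert_zero, zpow_add, mul_smul, zpow_one]
  have hstep : ∀ i, K.graph.dist (γ i) (γ (i + 1)) ≤ 1 := by
    intro i
    have h1 := Int.emod_nonneg i hℓ0.ne'
    have h2 := Int.emod_lt_of_pos i hℓ0
    have h3 : i = i / ℓ * ℓ + (i % ℓ).toNat := by
      rw [Int.toNat_of_nonneg h1, mul_comm, Int.mul_ediv_add_emod]
    have h4 : i + 1 = i / ℓ * ℓ + ((i % ℓ).toNat + 1 : ℕ) := by push_cast; linarith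
    have e1 := hγ (i / ℓ) (i % ℓ).toNat (by omega)
    have e2 := hγ (i / ℓ) ((i % ℓ).toNat + 1) (by omega)
    rw [← h3] at e1
    rw [← h4] at e2
    rw [e1, e2, dist_smul _ hc]
    exact (SimpleGraph.dist_eq_one_iff_adj.2 (p.adj_getVert_succ (by omega))).le
  have hlip : ∀ (i : ℤ) (n : ℕ), K.graph.dist (γ i) (γ (i + n)) ≤ n := by
    intro i n
    induction n with
    | zero => simp
    | succ n ih =>
      have := hK.dist_triangle (γ i) (γ (i + n)) (γ (i + n + 1))
      have := hstep (i + n)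
      push_cast
      rw [← add_assoc]
      omega
  have horb : ∀ (q : ℤ) (n : ℕ), K.graph.dist (γ (q * ℓ)) (γ (q * ℓ + n * ℓ)) = n * ℓ := by
    intro q n
    have e1 := hγ q 0 (Nat.zero_le _)
    have e2 := hγ (q + n) 0 (Nat.zero_le _)
    simp only [Nat.cast_zero, add_zero, SimpleGraph.Walk.getVert_zero] at e1 e2
    rw [← add_mul, e1, e2, zpow_add, mul_smul, dist_smul _ hc, zpow_natCast, hm.dist_pow hK]
  have hgeo : ∀ (i : ℤ) (n : ℕ), K.graph.dist (γ i) (γ (i + n)) = n := by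
    intro i n
    refine le_antisymm (hlip i n) ?_
    have h1 := Int.emod_nonneg i hℓ0.ne'
    have h2 := Int.emod_lt_of_pos i hℓ0
    have h3 : i = i / ℓ * ℓ + (i % ℓ).toNat := by
      rw [Int.toNat_of_nonneg h1, mul_comm, Int.mul_ediv_add_emod]
    set q := i / ℓ
    set r := (i % ℓ).toNat
    -- The segment is extended at both ends to one joining points of the orbit, whose length is
    -- known; the Lipschitz bound on the added pieces then forces equality in the middle.
    obtain ⟨s, hs⟩ : ∃ s : ℕ, r + n + s = (n + 1) * ℓ := by
      refine Nat.exists_eq_add_of_le (?_ : r + n ≤ (n + 1) * ℓ) |>.imp fun _ h => h.symm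
      have : n * 1 ≤ n * ℓ := Nat.mul_le_mul_left _ hpos
      have : r < ℓ := by omega
      rw [add_mul]
      omega
    have t1 := hlip (q * ℓ) r
    have t2 := hlip (i + n) s
    have t3 := horb q (n + 1)
    rw [← h3] at t1
    have h5 : i + n + s = q * ℓ + ((n + 1 : ℕ) : ℤ) * ℓ := by
      have : ((r + n + s : ℕ) : ℤ) = (((n + 1) * ℓ : ℕ) : ℤ) := congrArg _ hs
      push_cast at this ⊢
      linarith
    rw [h5] at t2
    have t4 := hK.dist_triangle (γ (q * ℓ)) (γ i) (γ (q * ℓ + ((n + 1 : ℕ) : ℤ) * ℓ))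
    have t5 := hK.dist_triangle (γ i) (γ (i + n)) (γ (q * ℓ + ((n + 1 : ℕ) : ℤ) * ℓ))
    omega
  have hT := hx.translationLength_eq
  refine ⟨γ, ⟨fun i j => ?_, by rw [hT]; exact hpos, fun i => ?_⟩, ?_⟩
  · rcases le_total i j with h | h
    · obtain ⟨n, rfl⟩ := Int.le.dest h
      rw [hgeo]; omega
    · obtain ⟨n, rfl⟩ := Int.le.dest h
      rw [SimpleGraph.dist_comm, hgeo]; omega
  · rw [hT, ← hℓ]
    change f • (f ^ (i / (ℓ : ℤ)) • p.getVert (i % ℓ).toNat) =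
      f ^ ((i + ℓ) / (ℓ : ℤ)) • p.getVert ((i + ℓ) % ℓ).toNat
    rw [Int.add_emod_right, Int.add_ediv_of_dvd_right (dvd_refl _), Int.ediv_self hℓ0.ne', add_comm,
      zpow_add, zpow_one, mul_smul]
  · have := hγ 0 0 (Nat.zero_le _)
    simpa using this

end CubeSystem

open scoped symmDiff

namespace CubeSystem

/-! ### A criterion for simple connectivity -/

theorem IsSquare.homotopic {V : Type*} {K : CubeSystem V} {a b c d w : V} (h : K.IsSquare a b c d)
    (p : K.graph.Walk c w) :
    K.Homotopic (.cons h.adj₁ (.cons h.adj₂ p)) (.cons h.adj₃ (.cons h.adj₄ p)) :=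
  .square _ _ _ _ h.mem p

/-- A connected complex is simply connected if, for every vertex `v`, there is a height function
for which `v` is minimal, adjacent vertices have distinct heights, and the peaks of edge paths can
be removed by squares. -/
theorem isSimplyConnected_of_height {V : Type*} {K : CubeSystem V} (hc : K.graph.Connected)
    (f : V → V → ℕ) (h0 : ∀ v, f v v = 0) (hadj : ∀ v a b, K.graph.Adj a b → f v a ≠ f v b)
    (hq : ∀ v w a b, K.graph.Adj w a → K.graph.Adj w b → a ≠ b → f v a < f v w → f v b < f v w →
      ∃ c, K.IsSquare w a c b ∧ f v c < f v w) : K.IsSimplyConnected := by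
  refine ⟨hc, fun v => ?_⟩
  -- The induction measure for null-homotopies: removing a backtrack or pushing a peak across a
  -- square lowers it.
  let wt : ∀ {u w : V}, K.graph.Walk u w → ℕ := fun p => (p.support.map fun x => f v x + 1).sum
  have wt_cons : ∀ {u w x : V} (h : K.graph.Adj u w) (p : K.graph.Walk w x),
      wt (.cons h p) = f v u + 1 + wt p := fun h p => by
    simp only [wt, SimpleGraph.Walk.support_cons, List.map_cons, List.sum_cons]
  -- A walk that starts upwards either has a removable peak or climbs up to its end; the latter is
  -- impossible for a loop at `v`.
  have key : ∀ {u w : V} (p : K.graph.Walk u w) (x : V) (h : K.graph.Adj x u), f v x < f v u →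
      (∃ q : K.graph.Walk x w, K.Homotopic (.cons h p) q ∧ wt q < wt (.cons h p)) ∨
        f v x < f v w := by
    intro u w p
    induction p with
    | nil => exact fun x h hlt => Or.inr hlt
    | @cons u u' w h' p ih =>
      intro x h hlt
      rcases (hadj v _ _ h').lt_or_gt with h1 | h1
      · rcases ih u h' h1 with ⟨q, hq, hwt⟩ | h2
        · exact Or.inl ⟨.cons h q, .cons h hq, by simp only [wt_cons] at hwt ⊢; omega⟩
        · exact Or.inr (hlt.trans h2)
      · left
        by_cases hx : x = u'
        · subst hx
          exact ⟨p, .backtrack h p, by simp only [wt_cons]; omega⟩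
        · obtain ⟨c, hs, hcu⟩ := hq v u x u' h.symm h' hx hlt h1
          exact ⟨_, (hs.rotate.swap).homotopic p, by simp only [wt_cons]; omega⟩
  intro p
  induction hn : wt p using Nat.strong_induction_on generalizing p with
  | _ n ih =>
  cases p with
  | nil => exact .refl _
  | cons h p =>
    rcases key p v h (by have := hadj v _ _ h; rw [h0] at *; omega) with ⟨q, hq, hwt⟩ | h1
    · exact hq.trans (ih _ (hn ▸ hwt) q rfl)
    · exact absurd h1 (lt_irrefl _)

/-! ### Graphs which embed in the cube of all subsets of a set -/

theorem ncard_symmDiff_singleton {N : Type*} {A : Set N} (hA : A.Finite) (i : N) :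
    (i ∈ A ∧ (A ∆ {i}).ncard + 1 = A.ncard) ∨ (i ∉ A ∧ (A ∆ {i}).ncard = A.ncard + 1) := by
  by_cases h : i ∈ A
  · left
    have : A ∆ {i} = A \ {i} := by
      ext x; simp only [Set.mem_symmDiff, Set.mem_singleton_iff, Set.mem_sdiff]
      constructor
      · rintro (h' | ⟨rfl, h'⟩)
        exacts [h', absurd h h']
      · exact Or.inl
    exact ⟨h, by rw [this, Set.ncard_sdiff_singleton_add_one h hA]⟩
  · right
    have : A ∆ {i} = insert i A := by
      ext x; simp only [Set.mem_symmDiff, Set.mem_singleton_iff, Set.mem_insert_iff]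
      constructor
      · rintro (h' | h')
        exacts [Or.inr h'.1, Or.inl h'.1]
      · rintro (rfl | h')
        exacts [Or.inr ⟨rfl, h⟩, Or.inl ⟨h', by rintro rfl; exact h h'⟩]
    exact ⟨h, by rw [this, Set.ncard_insert_of_notMem h hA]⟩

theorem symmDiff_eq_iff {N : Type*} {A B T : Set N} : A ∆ B = T ↔ B = A ∆ T := by
  constructor
  · rintro rfl; rw [symmDiff_symmDiff_cancel_left]
  · rintro rfl; rw [symmDiff_symmDiff_cancel_left]

theorem singleton_symmDiff_singleton {N : Type*} {i j : N} (h : i ≠ j) :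
    ({i} : Set N) ∆ {j} = {i, j} := by
  ext x
  simp only [Set.mem_symmDiff, Set.mem_singleton_iff, Set.mem_insert_iff]
  constructor
  · tauto
  · rintro (rfl | rfl)
    exacts [Or.inl ⟨rfl, h⟩, Or.inr ⟨rfl, h.symm⟩]

/-- The vertices of `Γ` are encoded by subsets of `N`, two of them being adjacent if their codes
differ by one element, and the set of codes is defined by conditions on pairs of elements. -/
structure IsCode {O N : Type*} (Γ : SimpleGraph O) (c : O → Set N) : Prop where
  inj : Function.Injective c
  adj_iff : ∀ σ τ, Γ.Adj σ τ ↔ ∃ i, c σ ∆ c τ = {i}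
  finite : ∀ σ τ, (c σ ∆ c τ).Finite
  descent : ∀ σ τ, σ ≠ τ → ∃ i ∈ c σ ∆ c τ, ∃ ρ, c ρ = c σ ∆ {i}
  flag : ∀ σ (T : Set N), T.Finite → (∀ i ∈ T, ∀ j ∈ T, ∃ ρ, c ρ = c σ ∆ {i, j}) →
    ∃ ρ, c ρ = c σ ∆ T
  quad : ∀ σ τ, ∀ i ∈ c σ ∆ c τ, ∀ j ∈ c σ ∆ c τ, (∃ ρ, c ρ = c σ ∆ {i}) →
    (∃ ρ, c ρ = c σ ∆ {j}) → ∃ ρ, c ρ = c σ ∆ {i, j}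

namespace IsCode

variable {O N : Type*} {Γ : SimpleGraph O} {c : O → Set N} (h : IsCode Γ c)
include h

/-- Opposite edges of an embedded square toggle the same element, so an embedded cube is coded by
independent toggles of the elements labelling the edges at one corner. The induction is on the
number of coordinates equal to `true`. -/
theorem hypercube {n : ℕ} {φ : (Fin n → Bool) → O} (hφ : Function.Injective φ)
    (hadj : ∀ x y, HypercubeAdj x y → Γ.Adj (φ x) (φ y)) :
    ∃ ι : Fin n → N, Function.Injective ι ∧ ∀ x y, c (φ x) ∆ c (φ y) = ι '' {i | x i ≠ y i} := by
  classical
  set o : Fin n → Bool := fun _ => false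
  have hadj' : ∀ x i, ∃ k, c (φ x) ∆ c (φ (toggle x i)) = {k} := fun x i =>
    (h.adj_iff _ _).1 (hadj _ _ (hypercubeAdj_iff.2 ⟨i, rfl⟩))
  choose ι hι using hadj' o
  have hinj : Function.Injective ι := by
    intro i j hij
    have h1 := symmDiff_eq_iff.1 (hι i)
    have h2 := symmDiff_eq_iff.1 (hι j)
    rw [← hij, ← h1] at h2
    exact toggle_injective o (hφ (h.inj h2.symm))
  have key : ∀ m : ℕ, ∀ s : Finset (Fin n), s.card = m → ∀ x : Fin n → Bool,
      (∀ i, i ∈ s ↔ x i = true) → c (φ x) = c (φ o) ∆ (ι '' s) := by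
    intro m
    induction m using Nat.strong_induction_on with
    | _ m ih =>
    intro s hs x hx
    have ih' : ∀ i, i ∈ s → c (φ (toggle x i)) = c (φ o) ∆ (ι '' (s.erase i : Finset _)) := by
      intro i hi
      refine ih _ (by rw [← hs]; exact Finset.card_erase_lt_of_mem hi) _ rfl _ fun j => ?_
      by_cases hj : j = i
      · subst hj; simp [(hx j).1 hi]
      · simp [hj, hx]
    rcases s.eq_empty_or_nonempty with rfl | ⟨i, hi⟩
    · have : x = o := funext fun i => by simpa using (hx i).not.1 (by simp)
      rw [this, Finset.coe_empty, Set.image_empty]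
      exact (symmDiff_bot _).symm
    by_cases hs1 : s = {i}
    · subst hs1
      have : x = toggle o i := by
        ext j
        by_cases hj : j = i
        · subst hj; simp [o, (hx j).1 hi]
        · have := (hx j).not.1 (by simp [hj])
          simp [hj, o, this]
      rw [this, symmDiff_eq_iff.1 (hι i)]
      simp
    obtain ⟨j, hj, hji⟩ : ∃ j ∈ s, j ≠ i := by
      by_contra! hall
      exact hs1 (Finset.eq_singleton_iff_unique_mem.2 ⟨hi, hall⟩)
    have hw : c (φ (toggle (toggle x i) j)) = c (φ o) ∆ (ι '' ((s.erase i).erase j : Finset _)) := by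
      refine ih _ (by rw [← hs]; exact (Finset.card_erase_le).trans_lt (Finset.card_erase_lt_of_mem hi))
        _ rfl _ fun k => ?_
      by_cases hk : k = j
      · subst hk; simp [hji, (hx k).1 hj]
      · by_cases hk' : k = i
        · subst hk'; simp [hk, (hx k).1 hi]
        · simp [hk, hk', hx]
    have himg : ∀ {t : Finset (Fin n)} {a : Fin n}, a ∈ t →
        (ι '' (t : Set (Fin n))) = (ι '' ((t.erase a : Finset _) : Set (Fin n))) ∆ {ι a} := by
      intro t a ha
      rw [← Set.image_singleton, ← Set.image_symmDiff hinj]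
      congr 1
      ext b
      by_cases hb : b = a <;> simp [hb, ha]
    have hy := ih' i hi
    have hz := ih' j hj
    rw [himg (Finset.mem_erase.2 ⟨hji, hj⟩), ← symmDiff_assoc, ← hw] at hy
    rw [himg (Finset.mem_erase.2 ⟨hji.symm, hi⟩), Finset.erase_right_comm, ← symmDiff_assoc, ← hw]
      at hz
    rw [himg hi, himg (Finset.mem_erase.2 ⟨hji, hj⟩), ← symmDiff_assoc, ← symmDiff_assoc, ← hw]
    obtain ⟨k, hk⟩ := hadj' (toggle x i) i
    obtain ⟨l, hl⟩ := hadj' (toggle x j) j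
    rw [toggle_toggle, symmDiff_eq_iff, hy, symmDiff_assoc] at hk
    rw [toggle_toggle, symmDiff_eq_iff, hz, symmDiff_assoc] at hl
    -- Going around the square in both ways; since `φ` is injective, `k` does not undo `ι j`, which
    -- leaves only `l = ι j`.
    have hkl : ({ι j} : Set N) ∆ {k} = {ι i} ∆ {l} := symmDiff_right_injective _ (hk.symm.trans hl)
    have hkj : k ≠ ι j := by
      rintro rfl
      rw [symmDiff_self] at hk
      have h1 := congrFun (hφ (h.inj (hk.trans (symmDiff_bot _)))) j
      have h2 := (hx j).1 hj
      simp [hji, h2] at h1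
    have hlj : l = ι j := by
      have h1 : ι j ∈ ({ι j} : Set N) ∆ {k} := Or.inl ⟨rfl, hkj.symm⟩
      rw [hkl] at h1
      rcases h1 with h1 | h1
      · exact absurd (hinj h1.1) hji
      · exact h1.1.symm
    rw [hl, hlj, symmDiff_assoc]
    congr 1
    exact symmDiff_comm _ _
  have key' : ∀ x, c (φ x) = c (φ o) ∆ (ι '' {i | x i = true}) := fun x => by
    have := key _ (Finset.univ.filter fun i => x i = true) rfl x (by simp)
    simpa using this
  refine ⟨ι, hinj, fun x y => ?_⟩
  rw [key' x, key' y, symmDiff_symmDiff_symmDiff_comm, symmDiff_self, bot_symmDiff,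
    ← Set.image_symmDiff hinj]
  congr 1
  ext i
  simp only [Set.mem_symmDiff, Set.mem_ofPred_eq]
  cases x i <;> cases y i <;> simp

/-- The vertices whose codes differ from that of `σ` on a subset of `T`. -/
theorem mem_cubes_of {σ : O} {T : Set N} (hT : T.Finite) (hv : ∀ S ⊆ T, ∃ ρ, c ρ = c σ ∆ S) :
    {τ | c σ ∆ c τ ⊆ T} ∈ Γ.fillCubes.cubes := by
  classical
  obtain ⟨n, ⟨e⟩⟩ : ∃ n, Nonempty (Fin n ≃ T) := by
    have := hT.fintype
    exact ⟨_, ⟨(Fintype.equivFin T).symm⟩⟩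
  have hinj : Function.Injective fun i => (e i : N) := Subtype.val_injective.comp e.injective
  choose φ hφ using fun x : Fin n → Bool =>
    hv ((fun i => (e i : N)) '' {i | x i = true}) (by rintro _ ⟨i, -, rfl⟩; exact (e i).2)
  refine ⟨n, φ, ?_, ?_, ?_⟩
  · intro x y hxy
    have := congrArg c hxy
    rw [hφ, hφ] at this
    have := hinj.image_injective (symmDiff_right_injective _ this)
    ext i
    have := Set.ext_iff.1 this i
    simp only [Set.mem_ofPred_eq] at this
    rw [Bool.eq_iff_iff, this]
  · intro x y hxy
    obtain ⟨i, rfl⟩ := hypercubeAdj_iff.1 hxy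
    refine (h.adj_iff _ _).2 ⟨e i, ?_⟩
    rw [hφ, hφ, symmDiff_symmDiff_symmDiff_comm, symmDiff_self, bot_symmDiff,
      ← Set.image_symmDiff hinj, ← Set.image_singleton (f := fun i => (e i : N))]
    congr 1
    ext j
    by_cases hj : j = i
    · subst hj; cases hx : x j <;> simp [Set.mem_symmDiff, hx]
    · simp [Set.mem_symmDiff, hj]
  · ext τ
    constructor
    · rintro ⟨x, rfl⟩
      rw [Set.mem_ofPred_eq, hφ, symmDiff_symmDiff_cancel_left]
      rintro _ ⟨i, -, rfl⟩
      exact (e i).2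
    · intro hτ
      refine ⟨fun i => decide ((e i : N) ∈ c σ ∆ c τ), h.inj ?_⟩
      rw [hφ, eq_comm, ← symmDiff_eq_iff]
      ext i
      simp only [Set.mem_image, Set.mem_ofPred_eq, decide_eq_true_eq]
      constructor
      · intro hi
        exact ⟨e.symm ⟨i, hτ hi⟩, by simpa using hi, by simp⟩
      · rintro ⟨i, hi, rfl⟩
        exact hi

theorem exists_of_mem_cubes {C : Set O} (hC : C ∈ Γ.fillCubes.cubes) {σ : O} (hσ : σ ∈ C) :
    ∃ T : Set N, T.Finite ∧ (∀ S ⊆ T, ∃ ρ, c ρ = c σ ∆ S) ∧ C = {τ | c σ ∆ c τ ⊆ T} := by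
  classical
  obtain ⟨n, φ, hφ, hadj, rfl⟩ := hC
  obtain ⟨a, rfl⟩ := hσ
  obtain ⟨ι, hι, hd⟩ := h.hypercube hφ hadj
  have hval : ∀ S ⊆ Set.range ι, ∃ x, c (φ x) = c (φ a) ∆ S := by
    intro S hS
    refine ⟨fun i => if ι i ∈ S then !a i else a i, ?_⟩
    rw [← symmDiff_eq_iff, hd]
    ext k
    constructor
    · rintro ⟨i, hi, rfl⟩
      by_contra hk
      simp [hk] at hi
    · intro hk
      obtain ⟨i, rfl⟩ := hS hk
      exact ⟨i, by simp [hk], rfl⟩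
  refine ⟨Set.range ι, Set.finite_range ι, fun S hS => ?_, ?_⟩
  · obtain ⟨x, hx⟩ := hval S hS
    exact ⟨_, hx⟩
  · ext τ
    constructor
    · rintro ⟨x, rfl⟩
      rw [Set.mem_ofPred_eq, hd]
      exact Set.image_subset_range _ _
    · intro hτ
      obtain ⟨x, hx⟩ := hval _ hτ
      exact ⟨x, h.inj (by rw [hx, symmDiff_symmDiff_cancel_left])⟩

theorem graph_adj (σ τ : O) : Γ.fillCubes.graph.Adj σ τ ↔ Γ.Adj σ τ := by
  rw [h.adj_iff]
  constructor
  · rintro ⟨hne, hm⟩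
    obtain ⟨T, -, hT, he⟩ := h.exists_of_mem_cubes hm (σ := σ) (by simp)
    have hτ : c σ ∆ c τ ⊆ T := by
      have : τ ∈ ({σ, τ} : Set O) := by simp
      rwa [he] at this
    obtain ⟨i, hi⟩ : (c σ ∆ c τ).Nonempty := by
      rw [Set.nonempty_iff_ne_empty]
      exact fun h' => hne (h.inj (symmDiff_eq_bot.1 h'))
    obtain ⟨ρ, hρ⟩ := hT {i} (by simpa using hτ hi)
    have hρ' : c σ ∆ c ρ = {i} := symmDiff_eq_iff.2 hρ
    have : ρ ∈ ({σ, τ} : Set O) := by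
      rw [he, Set.mem_ofPred_eq, hρ']
      simpa using hτ hi
    rcases this with rfl | rfl
    · rw [symmDiff_self] at hρ'
      exact absurd hρ'.symm (Set.singleton_ne_empty i)
    · exact ⟨i, hρ'⟩
  · rintro ⟨i, hi⟩
    refine ⟨?_, ?_⟩
    · rintro rfl
      rw [symmDiff_self] at hi
      exact (Set.singleton_ne_empty i) hi.symm
    · convert h.mem_cubes_of (σ := σ) (T := {i}) (Set.finite_singleton i) ?_
      · ext ρ
        rw [Set.mem_ofPred_eq, Set.subset_singleton_iff_eq]
        refine or_congr ⟨?_, fun h' => ?_⟩ ⟨?_, fun h' => ?_⟩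
        · rintro rfl; exact symmDiff_self _
        · exact (h.inj (symmDiff_eq_bot.1 h')).symm
        · rintro rfl; exact hi
        · rw [← hi] at h'; exact h.inj (symmDiff_right_injective _ h')
      · intro S hS
        rcases Set.subset_singleton_iff_eq.1 hS with rfl | rfl
        · exact ⟨σ, (symmDiff_bot _).symm⟩
        · exact ⟨τ, symmDiff_eq_iff.1 hi⟩

/-- A cube through `σ` is determined by the finite set of elements that can be freely toggled from
`σ`; faces correspond to subsets of it and intersections of cubes to intersections of such sets. -/
theorem isCubeComplex : Γ.fillCubes.IsCubeComplex := by
  classical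
  refine ⟨fun σ => ?_, fun C hC => ?_, ?_⟩
  · convert h.mem_cubes_of (σ := σ) Set.finite_empty ?_
    · ext τ
      rw [Set.mem_ofPred_eq, Set.subset_empty_iff]
      exact ⟨fun h' => by cases h'; exact symmDiff_self _,
        fun h' => (h.inj (symmDiff_eq_bot.1 h')).symm⟩
    · intro S hS
      rw [Set.subset_empty_iff.1 hS]
      exact ⟨σ, (symmDiff_bot _).symm⟩
  · obtain ⟨n, φ, hφ, hadj, rfl⟩ := hC
    obtain ⟨ι, hι, hd⟩ := h.hypercube hφ hadj
    refine ⟨n, φ, hφ, rfl, fun D hD => ⟨fun hDc => ?_, ?_⟩⟩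
    · obtain ⟨m, ψ, -, -, hψ⟩ := id hDc
      have hne : D.Nonempty := hψ ▸ ⟨_, fun _ => true, rfl⟩
      obtain ⟨σ, hσ⟩ := hne
      obtain ⟨a, rfl⟩ := hD hσ
      obtain ⟨T, -, hT, he⟩ := h.exists_of_mem_cubes hDc hσ
      refine ⟨a, {i | ι i ∉ T}, ?_⟩
      ext τ
      constructor
      · intro hτ
        obtain ⟨y, rfl⟩ := hD hτ
        refine ⟨y, fun i hi => ?_, rfl⟩
        by_contra hne
        rw [he, Set.mem_ofPred_eq, hd] at hτ
        exact hi (hτ ⟨i, Ne.symm hne, rfl⟩)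
      · rintro ⟨y, hy, rfl⟩
        rw [he, Set.mem_ofPred_eq, hd]
        rintro _ ⟨i, hi, rfl⟩
        by_contra hT'
        exact hi (hy i hT').symm
    · rintro ⟨a, S, rfl⟩
      convert h.mem_cubes_of (σ := φ a) (T := ι '' Sᶜ) (Set.toFinite _) ?_
      · ext τ
        constructor
        · rintro ⟨y, hy, rfl⟩
          rw [Set.mem_ofPred_eq, hd]
          refine Set.image_mono fun i hi hS => hi (hy i hS).symm
        · intro hτ
          obtain ⟨T, -, -, he⟩ := h.exists_of_mem_cubes ⟨n, φ, hφ, hadj, rfl⟩ (σ := φ a) ⟨a, rfl⟩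
          have hτ' : τ ∈ Set.range φ := by
            obtain ⟨ρ, hρ⟩ : ∃ y, c (φ y) = c τ := by
              refine ⟨fun i => if ι i ∈ c (φ a) ∆ c τ then !a i else a i, ?_⟩
              rw [← symmDiff_symmDiff_cancel_left (c (φ a)) (c τ), ← symmDiff_eq_iff, hd]
              ext k
              constructor
              · rintro ⟨i, hi, rfl⟩
                by_contra hk
                simp [hk] at hi
              · intro hk
                obtain ⟨i, -, rfl⟩ := hτ hk
                exact ⟨i, by simp [hk], rfl⟩
            exact ⟨ρ, h.inj hρ⟩
          obtain ⟨y, rfl⟩ := hτ'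
          refine ⟨y, fun i hi => ?_, rfl⟩
          rw [Set.mem_ofPred_eq, hd, Set.image_subset_image_iff hι] at hτ
          by_contra hne
          exact hτ (Ne.symm hne : a i ≠ y i) hi
      · intro S' hS'
        refine ⟨φ fun i => if ι i ∈ S' then !a i else a i, ?_⟩
        rw [← symmDiff_eq_iff, hd]
        ext k
        constructor
        · rintro ⟨i, hi, rfl⟩
          by_contra hk
          simp [hk] at hi
        · intro hk
          obtain ⟨i, -, rfl⟩ := hS' hk
          exact ⟨i, by simp [hk], rfl⟩
  · rintro C hC D hD ⟨σ, hσC, hσD⟩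
    obtain ⟨T, hT, hT', rfl⟩ := h.exists_of_mem_cubes hC hσC
    obtain ⟨U, hU, hU', rfl⟩ := h.exists_of_mem_cubes hD hσD
    convert h.mem_cubes_of (σ := σ) (T := T ∩ U) (hT.inter_of_left U)
      (fun S hS => hT' S (hS.trans Set.inter_subset_left)) using 1
    ext τ
    simp [Set.subset_inter_iff]

/-- Neighbours of `v` are single toggles and edges of the link are pairs that can be toggled
together, so the condition on links is the `flag` axiom. -/
theorem isNonpositivelyCurved : Γ.fillCubes.IsNonpositivelyCurved := by
  intro v s hs hadj hlink
  have hadj' : ∀ w ∈ s, ∃ i, c v ∆ c w = {i} := fun w hw =>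
    (h.adj_iff _ _).1 ((h.graph_adj _ _).1 (hadj w hw))
  set T : Set N := ⋃ w ∈ s, c v ∆ c w with hTdef
  have hT : T.Finite := hs.biUnion fun w _ => h.finite v w
  have hmem : ∀ i ∈ T, ∃ w ∈ s, c v ∆ c w = {i} := by
    intro i hi
    obtain ⟨w, hw, hi⟩ := Set.mem_iUnion₂.1 hi
    obtain ⟨j, hj⟩ := hadj' w hw
    rw [hj, Set.mem_singleton_iff] at hi
    exact ⟨w, hw, hi ▸ hj⟩
  have hpair : ∀ i ∈ T, ∀ j ∈ T, ∃ ρ, c ρ = c v ∆ {i, j} := by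
    intro i hi j hj
    obtain ⟨a, ha, hi⟩ := hmem i hi
    obtain ⟨b, hb, hj⟩ := hmem j hj
    by_cases hab : a = b
    · subst hab
      obtain rfl := Set.singleton_injective (hi.symm.trans hj)
      exact ⟨a, by rw [← symmDiff_eq_iff, hi]; simp⟩
    obtain ⟨C, hC, hv, he⟩ := hlink a ha b hb hab
    obtain ⟨U, -, hU, rfl⟩ := h.exists_of_mem_cubes hC hv
    have h1 : a ∈ {w | c v ∆ c w ⊆ U} := (he ▸ (by simp : a ∈ ({a, b} : Set O)) : a ∈ _ ∧ _).1
    have h2 : b ∈ {w | c v ∆ c w ⊆ U} := (he ▸ (by simp : b ∈ ({a, b} : Set O)) : b ∈ _ ∧ _).1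
    rw [Set.mem_ofPred_eq, hi, Set.singleton_subset_iff] at h1
    rw [Set.mem_ofPred_eq, hj, Set.singleton_subset_iff] at h2
    exact hU _ (by rintro _ (rfl | rfl) <;> assumption)
  refine ⟨_, h.mem_cubes_of hT fun S hS => h.flag v S (hT.subset hS)
    fun i hi j hj => hpair i (hS hi) j (hS hj), ?_, ?_⟩
  · simp [symmDiff_self]
  · ext w
    constructor
    · intro hw
      exact ⟨Set.subset_biUnion_of_mem (u := fun w => c v ∆ c w) hw, hadj w hw⟩
    · rintro ⟨hw, ha⟩
      obtain ⟨i, hi⟩ := (h.adj_iff _ _).1 ((h.graph_adj _ _).1 ha)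
      rw [Set.mem_ofPred_eq, hi, Set.singleton_subset_iff] at hw
      obtain ⟨w', hw', he⟩ := hmem i hw
      rw [← he] at hi
      rwa [h.inj (symmDiff_right_injective _ hi)]

/-- The height is the number of elements in which two codes differ. The `descent` axiom lowers it,
whence connectedness, and the `quad` axiom removes peaks. -/
theorem isSimplyConnected [Nonempty O] : Γ.fillCubes.IsSimplyConnected := by
  have hconn : Γ.fillCubes.graph.Connected := by
    refine ⟨fun σ τ => ?_⟩
    induction hn : (c σ ∆ c τ).ncard using Nat.strong_induction_on generalizing σ with
    | _ n ih =>
    by_cases hστ : σ = τ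
    · rw [hστ]
    obtain ⟨i, hi, ρ, hρ⟩ := h.descent σ τ hστ
    have hadj : Γ.fillCubes.graph.Adj σ ρ :=
      (h.graph_adj _ _).2 ((h.adj_iff _ _).2 ⟨i, symmDiff_eq_iff.2 hρ⟩)
    refine hadj.reachable.trans (ih _ ?_ ρ rfl)
    have := ncard_symmDiff_singleton (h.finite σ τ) i
    rw [hρ, symmDiff_right_comm]
    rcases this with h' | h'
    · omega
    · exact absurd hi h'.1
  refine isSimplyConnected_of_height hconn (fun v w => (c v ∆ c w).ncard) (by simp) ?_ ?_
  · intro v a b hab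
    obtain ⟨i, hi⟩ := (h.adj_iff _ _).1 ((h.graph_adj _ _).1 hab)
    rw [symmDiff_eq_iff] at hi
    have := ncard_symmDiff_singleton (h.finite v a) i
    simp only [hi, ← symmDiff_assoc]
    omega
  · intro v w a b ha hb hab hav hbv
    obtain ⟨i, hi⟩ := (h.adj_iff _ _).1 ((h.graph_adj _ _).1 ha)
    obtain ⟨j, hj⟩ := (h.adj_iff _ _).1 ((h.graph_adj _ _).1 hb)
    rw [symmDiff_eq_iff] at hi hj
    have hij : i ≠ j := by rintro rfl; exact hab (h.inj (hi.trans hj.symm))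
    have h1 := ncard_symmDiff_singleton (h.finite v w) i
    have h2 := ncard_symmDiff_singleton (h.finite v w) j
    simp only [hi, hj, ← symmDiff_assoc] at hav hbv
    have hi' : i ∈ c v ∆ c w := by rcases h1 with h1 | h1; exacts [h1.1, by omega]
    have hj' : j ∈ c v ∆ c w := by rcases h2 with h2 | h2; exacts [h2.1, by omega]
    obtain ⟨ρ, hρ⟩ := h.quad w v i (symmDiff_comm (c v) _ ▸ hi') j (symmDiff_comm (c v) _ ▸ hj')
      ⟨a, hi⟩ ⟨b, hj⟩
    rw [← singleton_symmDiff_singleton hij, ← symmDiff_assoc] at hρ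
    have hρ' : c ρ = c w ∆ {j} ∆ {i} := by rw [hρ, symmDiff_right_comm]
    have hadj : ∀ {σ τ : O} {k : N}, c τ = c σ ∆ {k} → Γ.fillCubes.graph.Adj σ τ := fun hk =>
      (h.graph_adj _ _).2 ((h.adj_iff _ _).2 ⟨_, symmDiff_eq_iff.2 hk⟩)
    refine ⟨ρ, ⟨ha, hadj (k := j) (by rw [hi, hρ]), hb, hadj (k := i) (by rw [hj, hρ']), hab, ?_, ?_⟩,
      ?_⟩
    · rintro rfl
      rw [symmDiff_assoc, singleton_symmDiff_singleton hij, eq_comm, symmDiff_eq_left] at hρ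
      exact (Set.insert_nonempty i {j}).ne_empty hρ
    · have hsub : ∀ S : Set N, S ⊆ {i, j} → S = ∅ ∨ S = {i} ∨ S = {i} ∆ {j} ∨ S = {j} := by
        intro S hS
        rw [singleton_symmDiff_singleton hij]
        have := Set.subset_pair_iff_eq.1 hS
        tauto
      convert h.mem_cubes_of (σ := w) (T := {i, j}) (by simp) ?_ using 1
      · ext τ
        have e : ∀ {S : Set N} {τ'}, c τ' = c w ∆ S → (c w ∆ c τ = S ↔ τ = τ') := by
          intro S τ' h'
          rw [symmDiff_eq_iff, ← h']
          exact ⟨fun h'' => h.inj h'', fun h'' => h'' ▸ rfl⟩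
        simp only [Set.mem_insert_iff, Set.mem_singleton_iff, Set.mem_ofPred_eq]
        rw [← e hi, ← e hj, ← e (hρ.trans (symmDiff_assoc _ _ _)), ← e (symmDiff_bot (c w)).symm]
        refine ⟨?_, hsub _⟩
        rw [singleton_symmDiff_singleton hij]
        rintro (h' | h' | h' | h') <;> rw [h'] <;> simp
      · intro S hS
        rcases hsub S hS with rfl | rfl | rfl | rfl
        · exact ⟨w, (symmDiff_bot _).symm⟩
        · exact ⟨a, hi⟩
        · exact ⟨ρ, hρ.trans (symmDiff_assoc _ _ _)⟩
        · exact ⟨b, hj⟩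
    · have hf := (h.finite v a)
      have h3 := ncard_symmDiff_singleton (h.finite v a) j
      simp only [hi, ← symmDiff_assoc] at h3
      simp only [hρ, ← symmDiff_assoc]
      have hj2 : j ∈ c v ∆ c w ∆ {i} := Or.inl ⟨hj', Ne.symm hij⟩
      rcases h3 with h3 | h3
      · omega
      · exact absurd hj2 h3.1

theorem isCAT0 [Nonempty O] : Γ.fillCubes.IsCAT0 :=
  ⟨h.isCubeComplex, h.isNonpositivelyCurved, h.isSimplyConnected⟩

end IsCode

end CubeSystem

namespace CubeSystem

/-! ### The cubulation of a wallspace is CAT(0) -/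

section Wallspace

variable {α : Type*} {H : Set (Set α)}

theorem _root_.IsOrientation.compl_mem_iff {σ : Set (Set α)} (hσ : IsOrientation H σ) {A : Set α}
    (hA : A ∈ H) : Aᶜ ∈ σ ↔ A ∉ σ := by
  have := hσ.exactly_one A hA
  rw [xor_iff_not_iff] at this
  tauto

theorem isOrientation_principal (hH : ∀ A ∈ H, Aᶜ ∈ H) (x : α) :
    IsOrientation H (principalOrientation H x) := by
  refine ⟨fun A hA => hA.1, fun A hA => ?_, fun A _ B hB hAB h => ⟨hB, hAB h.2⟩⟩
  simp only [principalOrientation, Set.mem_ofPred_eq, hA, hH A hA, true_and, Set.mem_compl_iff,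
    xor_iff_not_iff]
  tauto

/-- The vertex of the cubulation defined by a point. -/
def principalVertex (hH : ∀ A ∈ H, Aᶜ ∈ H) (x : α) : CubulationVertex H :=
  ⟨principalOrientation H x, isOrientation_principal hH x, x, by simp⟩

/-- The code of an orientation relative to the base point `x₀`. -/
def orientationCode (x₀ : α) (σ : CubulationVertex H) : Set (Set α) :=
  σ.1 \ principalOrientation H x₀

theorem mem_orientationCode {x₀ : α} {σ : CubulationVertex H} {A : Set α} :
    A ∈ orientationCode x₀ σ ↔ A ∈ σ.1 ∧ x₀ ∉ A := by
  simp only [orientationCode, principalOrientation, Set.mem_sdiff, Set.mem_ofPred_eq, not_and]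
  exact and_congr_right fun h => ⟨fun h' => h' (σ.2.1.subset h), fun h' _ => h'⟩

theorem mem_iff_of_orientationCode {x₀ : α} {σ τ : CubulationVertex H} {A : Set α}
    (hA : A ∈ H) (h : A ∈ orientationCode x₀ σ ↔ A ∈ orientationCode x₀ τ)
    (h' : Aᶜ ∈ orientationCode x₀ σ ↔ Aᶜ ∈ orientationCode x₀ τ) : A ∈ σ.1 ↔ A ∈ τ.1 := by
  simp only [mem_orientationCode, Set.mem_compl_iff, not_not, σ.2.1.compl_mem_iff hA,
    τ.2.1.compl_mem_iff hA] at h h'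
  tauto

theorem orientationCode_injective (x₀ : α) :
    Function.Injective (orientationCode (H := H) x₀) := by
  intro σ τ h
  refine Subtype.ext (Set.ext fun A => ?_)
  constructor
  · exact fun hA => (mem_iff_of_orientationCode (σ.2.1.subset hA) (by rw [h]) (by rw [h])).1 hA
  · exact fun hA => (mem_iff_of_orientationCode (τ.2.1.subset hA) (by rw [h]) (by rw [h])).2 hA

theorem orientationCode_symmDiff (x₀ : α) (σ τ : CubulationVertex H) :
    orientationCode x₀ σ ∆ orientationCode x₀ τ = {A ∈ σ.1 ∆ τ.1 | x₀ ∉ A} := by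
  ext A
  simp only [Set.mem_symmDiff, mem_orientationCode, Set.mem_ofPred_eq]
  tauto

theorem compl_mem_symmDiff {σ τ : CubulationVertex H} {A : Set α} (h : A ∈ σ.1 ∆ τ.1) :
    Aᶜ ∈ σ.1 ∆ τ.1 := by
  have hA : A ∈ H := h.elim (fun h => σ.2.1.subset h.1) (fun h => τ.2.1.subset h.1)
  simp only [Set.mem_symmDiff, σ.2.1.compl_mem_iff hA, τ.2.1.compl_mem_iff hA] at h ⊢
  tauto

theorem symmDiff_finite
    (hfin : ∀ x y, (principalOrientation H x ∆ principalOrientation H y).Finite) (σ τ : CubulationVertex H) : (σ.1 ∆ τ.1).Finite := by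
  obtain ⟨x, hx⟩ := σ.2.2
  obtain ⟨y, hy⟩ := τ.2.2
  rw [symmDiff_comm] at hy
  refine ((hx.union (hfin x y)).union hy).subset ?_
  refine (symmDiff_triangle _ (principalOrientation H y) _).trans ?_
  exact sup_le_sup_right (symmDiff_triangle _ _ _) _

variable (hH : ∀ A ∈ H, Aᶜ ∈ H)
include hH

/-- A set of halfspaces is the code of an orientation if any two of its elements can be completed to
the code of an orientation. -/
theorem exists_orientationCode (x₀ : α) {δ : Set (Set α)} (hδ : δ.Finite)
    (hδH : ∀ A ∈ δ, A ∈ H ∧ x₀ ∉ A)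
    (h : ∀ a b, ∃ ρ : CubulationVertex H, (a ∈ orientationCode x₀ ρ ↔ a ∈ δ) ∧
      (b ∈ orientationCode x₀ ρ ↔ b ∈ δ)) :
    ∃ ρ : CubulationVertex H, orientationCode x₀ ρ = δ := by
  classical
  set ω : Set (Set α) := {A ∈ H | if x₀ ∈ A then Aᶜ ∉ δ else A ∈ δ} with hω
  -- The representative of a wall that avoids `x₀`; its membership in the code decides which side
  -- `ω` chooses. Each axiom of orientations involves only two walls, so it can be checked on a `ρ`
  -- agreeing with `δ` there.
  let r : Set α → Set α := fun A => if x₀ ∈ A then Aᶜ else A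
  have hmem : ∀ {A}, A ∈ H → ∀ {ρ : CubulationVertex H},
      (r A ∈ orientationCode x₀ ρ ↔ r A ∈ δ) →
      (A ∈ ω ↔ A ∈ ρ.1) := by
    intro A hA ρ hρ
    by_cases hx : x₀ ∈ A
    · rw [show r A = Aᶜ from if_pos hx, mem_orientationCode, ρ.2.1.compl_mem_iff hA] at hρ
      simp only [hω, Set.mem_ofPred_eq, hA, hx, if_true, true_and, ← hρ, Set.mem_compl_iff]
      tauto
    · rw [show r A = A from if_neg hx, mem_orientationCode] at hρ
      simp only [hω, Set.mem_ofPred_eq, hA, hx, if_false, true_and, ← hρ]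
      tauto
  have hor : IsOrientation H ω := by
    refine ⟨fun A hA => hA.1, fun A hA => ?_, fun A hA B hB hAB hAω => ?_⟩
    · obtain ⟨ρ, hρ, hρ'⟩ := h (r A) (r Aᶜ)
      rw [hmem hA hρ, hmem (hH A hA) hρ']
      exact ρ.2.1.exactly_one A hA
    · obtain ⟨ρ, hρ, hρ'⟩ := h (r A) (r B)
      rw [hmem hA hρ] at hAω
      rw [hmem hB hρ']
      exact ρ.2.1.upward A hA B hB hAB hAω
  have hωfin : (ω ∆ principalOrientation H x₀).Finite := by
    refine (hδ.union (hδ.image compl)).subset ?_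
    rintro A (⟨⟨hA, h1⟩, h2⟩ | ⟨⟨hA, h1⟩, h2⟩)
    · have hx : x₀ ∉ A := fun hx => h2 ⟨hA, hx⟩
      rw [if_neg hx] at h1
      exact Or.inl h1
    · have hx : Aᶜ ∈ δ := by
        by_contra hn
        exact h2 ⟨hA, by rw [if_pos h1]; exact hn⟩
      exact Or.inr ⟨_, hx, compl_compl A⟩
  let ρ : CubulationVertex H := ⟨ω, hor, x₀, hωfin⟩
  refine ⟨ρ, ?_⟩
  ext A
  rw [mem_orientationCode]
  constructor
  · rintro ⟨⟨_, h1⟩, h2⟩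
    rwa [if_neg h2] at h1
  · intro hA
    obtain ⟨h1, h2⟩ := hδH A hA
    exact ⟨⟨h1, by rwa [if_neg h2]⟩, h2⟩

variable (hfin : ∀ x y, (principalOrientation H x ∆ principalOrientation H y).Finite)
include hfin

/-- Keeping only the halfspaces that avoid `x₀` records each wall once, so flipping a wall toggles
one element. Orientations are defined by conditions on pairs, which gives `flag` and `quad`; for
`descent`, a minimal halfspace of `σ.1 \ τ.1` is flipped. -/
theorem isCode_cubulation (x₀ : α) : IsCode (cubulationGraph H) (orientationCode x₀) := by
  classical
  have hsub : ∀ {σ : CubulationVertex H} {A}, A ∈ orientationCode x₀ σ → A ∈ H ∧ x₀ ∉ A :=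
    fun {σ} {A} h => ⟨σ.2.1.subset (mem_orientationCode.1 h).1, (mem_orientationCode.1 h).2⟩
  have hfin' : ∀ σ τ : CubulationVertex H,
      (orientationCode x₀ σ ∆ orientationCode x₀ τ).Finite := fun σ τ => by
    rw [orientationCode_symmDiff]
    exact (symmDiff_finite hfin σ τ).subset fun A hA => hA.1
  have hcode : ∀ σ : CubulationVertex H, (orientationCode x₀ σ).Finite := fun σ =>
    (symmDiff_finite hfin σ (principalVertex hH x₀)).subset fun A hA => Or.inl hA
  refine ⟨orientationCode_injective x₀, fun σ τ => ?_, hfin', fun σ τ hne => ?_,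
    fun σ T hT hpair => ?_, fun σ τ i hi j hj hρi hρj => ?_⟩
  · have hD : σ.1 ∆ τ.1 = (orientationCode x₀ σ ∆ orientationCode x₀ τ) ∪
        compl '' (orientationCode x₀ σ ∆ orientationCode x₀ τ) := by
      rw [orientationCode_symmDiff]
      ext A
      constructor
      · intro hA
        by_cases hx : x₀ ∈ A
        · exact Or.inr ⟨Aᶜ, ⟨compl_mem_symmDiff hA, not_not.2 hx⟩, compl_compl A⟩
        · exact Or.inl ⟨hA, hx⟩
      · rintro (hA | ⟨B, hB, rfl⟩)
        · exact hA.1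
        · exact compl_mem_symmDiff hB.1
    change (σ.1 ∆ τ.1).ncard = 2 ↔ _
    rw [hD, Set.ncard_union_eq _ (hfin' σ τ) ((hfin' σ τ).image _),
      Set.ncard_image_of_injective _ compl_injective, ← Set.ncard_eq_one]
    · omega
    · rw [Set.disjoint_left, orientationCode_symmDiff]
      rintro _ hA ⟨A, hA', rfl⟩
      exact hA.2 hA'.2
  · have hne' : (σ.1 \ τ.1).Nonempty := by
      by_contra hemp
      rw [Set.not_nonempty_iff_eq_empty, Set.sdiff_eq_empty] at hemp
      refine hne (Subtype.ext (hemp.antisymm fun A hA => ?_))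
      by_contra hAσ
      have hAH := τ.2.1.subset hA
      exact (τ.2.1.compl_mem_iff hAH).1 (hemp ((σ.2.1.compl_mem_iff hAH).2 hAσ)) hA
    obtain ⟨A, hA, hmin⟩ := ((symmDiff_finite hfin σ τ).subset
      (fun A hA => Or.inl hA : σ.1 \ τ.1 ⊆ _)).exists_minimal hne'
    have hAH := σ.2.1.subset hA.1
    -- Minimality in `σ.1 \ τ.1` is minimality in `σ.1`: a smaller halfspace chosen by `τ` would
    -- make `τ` choose `A`. This allows `A` to be flipped.
    have hAmin : ∀ B ∈ σ.1, B ⊆ A → B = A := by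
      intro B hB hBA
      refine hBA.antisymm (hmin ⟨hB, fun hBτ => hA.2 ?_⟩ hBA)
      exact τ.2.1.upward B (σ.2.1.subset hB) A hAH hBA hBτ
    have hAc : Aᶜ ∉ σ.1 := fun h => (σ.2.1.compl_mem_iff hAH).1 h hA.1
    have hor : IsOrientation H (insert Aᶜ (σ.1 \ {A})) := by
      have hne : Aᶜ ≠ A := fun h => hAc (h.symm ▸ hA.1)
      refine ⟨?_, fun B hB => ?_, fun B hB C hC hBC hBm => ?_⟩
      · rintro B (rfl | hB)
        exacts [hH A hAH, σ.2.1.subset hB.1]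
      · have := σ.2.1.compl_mem_iff hB
        rw [xor_iff_not_iff]
        simp only [Set.mem_insert_iff, Set.mem_sdiff, Set.mem_singleton_iff, this, compl_inj_iff]
        by_cases h1 : B = A
        · subst h1; simp [hne.symm]
        by_cases h2 : B = Aᶜ
        · subst h2; simp [hAc, h1]
        have h3 : Bᶜ ≠ A := fun h => h2 (by rw [← h, compl_compl])
        simp [h1, h2, h3]
      · rcases hBm with rfl | ⟨hBσ, hBA⟩
        · by_cases hCA : C = Aᶜ
          · exact Or.inl hCA
          right
          have hCσ : C ∈ σ.1 := by
            by_contra hn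
            have := hAmin Cᶜ ((σ.2.1.compl_mem_iff hC).2 hn) (Set.compl_subset_comm.1 hBC)
            exact hCA (by rw [← this, compl_compl])
          refine ⟨hCσ, ?_⟩
          rintro rfl
          -- Members of `H` are not assumed proper. If `C` contains its complement, every
          -- orientation chooses `C`, against `C ∉ τ.1`.
          obtain ⟨x, hx⟩ | hemp := (Cᶜ).eq_empty_or_nonempty.symm
          · exact hx (hBC hx)
          · exact hA.2 (by
              rcases τ.2.1.exactly_one C hC with ⟨h, -⟩ | ⟨h, -⟩
              · exact h
              · exact τ.2.1.upward _ (hH C hC) C hC hBC h)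
        · right
          refine ⟨σ.2.1.upward B hB C hC hBC hBσ, ?_⟩
          rintro rfl
          exact hBA (hAmin B hBσ hBC)
    have hins : insert Aᶜ (σ.1 \ {A}) = σ.1 ∆ {A, Aᶜ} := by
      ext B
      simp only [Set.mem_insert_iff, Set.mem_sdiff, Set.mem_singleton_iff, Set.mem_symmDiff]
      constructor
      · rintro (rfl | ⟨h1, h2⟩)
        · exact Or.inr ⟨Or.inr rfl, hAc⟩
        · exact Or.inl ⟨h1, by rintro (h | rfl); exacts [h2 h, hAc h1]⟩
      · rintro (⟨h1, h2⟩ | ⟨rfl | rfl, h2⟩)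
        · exact Or.inr ⟨h1, fun h => h2 (Or.inl h)⟩
        · exact absurd hA.1 h2
        · exact Or.inl rfl
    obtain ⟨x, hx⟩ := σ.2.2
    let ρ : CubulationVertex H := ⟨insert Aᶜ (σ.1 \ {A}), hor, x, by
      refine ((Set.toFinite {A, Aᶜ}).union hx).subset ?_
      refine (symmDiff_triangle _ σ.1 _).trans (sup_le_sup_right ?_ _)
      rw [hins, symmDiff_comm, symmDiff_symmDiff_cancel_left]⟩
    have hρ : orientationCode x₀ σ ∆ orientationCode x₀ ρ = {B ∈ ({A, Aᶜ} : Set (Set α)) | x₀ ∉ B} := by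
      rw [orientationCode_symmDiff]
      change {B ∈ σ.1 ∆ insert Aᶜ (σ.1 \ {A}) | x₀ ∉ B} = _
      rw [hins, symmDiff_symmDiff_cancel_left]
    have hmem : A ∈ σ.1 ∆ τ.1 := Or.inl hA
    by_cases hx : x₀ ∈ A
    · refine ⟨Aᶜ, ?_, ρ, ?_⟩
      · rw [orientationCode_symmDiff]; exact ⟨compl_mem_symmDiff hmem, by simpa using hx⟩
      · rw [← symmDiff_eq_iff, hρ]
        ext B
        simp only [Set.mem_ofPred_eq, Set.mem_insert_iff, Set.mem_singleton_iff]
        constructor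
        · rintro ⟨rfl | rfl, h2⟩
          exacts [absurd hx h2, rfl]
        · rintro rfl; exact ⟨Or.inr rfl, not_not.2 hx⟩
    · refine ⟨A, ?_, ρ, ?_⟩
      · rw [orientationCode_symmDiff]; exact ⟨hmem, hx⟩
      · rw [← symmDiff_eq_iff, hρ]
        ext B
        simp only [Set.mem_ofPred_eq, Set.mem_insert_iff, Set.mem_singleton_iff]
        constructor
        · rintro ⟨rfl | rfl, h2⟩
          exacts [rfl, absurd hx h2]
        · rintro rfl; exact ⟨Or.inl rfl, hx⟩
  · have hTH : ∀ A ∈ T, A ∈ H ∧ x₀ ∉ A := by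
      intro A hA
      obtain ⟨ρ, hρ⟩ := hpair A hA A hA
      rw [Set.pair_eq_singleton] at hρ
      by_cases h : A ∈ orientationCode x₀ σ
      · exact hsub h
      · exact hsub (σ := ρ) (by rw [hρ]; exact Or.inr ⟨rfl, h⟩)
    refine exists_orientationCode hH x₀ (((hcode σ).union hT).subset symmDiff_le_sup) ?_ ?_
    · rintro A (hA | hA)
      exacts [hsub hA.1, hTH A hA.1]
    · intro a b
      have key : ∀ {U : Set (Set α)} {ρ : CubulationVertex H},
          orientationCode x₀ ρ = orientationCode x₀ σ ∆ U → (a ∈ U ↔ a ∈ T) → (b ∈ U ↔ b ∈ T) →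
          ∃ ρ : CubulationVertex H, (a ∈ orientationCode x₀ ρ ↔ a ∈ orientationCode x₀ σ ∆ T) ∧
            (b ∈ orientationCode x₀ ρ ↔ b ∈ orientationCode x₀ σ ∆ T) := by
        intro U ρ hρ ha hb
        refine ⟨ρ, ?_, ?_⟩ <;> rw [hρ] <;> simp only [Set.mem_symmDiff, ha, hb]
      by_cases ha : a ∈ T <;> by_cases hb : b ∈ T
      · obtain ⟨ρ, hρ⟩ := hpair a ha b hb
        exact key hρ (by simp [ha]) (by simp [hb])
      · obtain ⟨ρ, hρ⟩ := hpair a ha a ha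
        have : b ≠ a := fun h => hb (h ▸ ha)
        exact key hρ (by simp [ha]) (by simp [hb, this])
      · obtain ⟨ρ, hρ⟩ := hpair b hb b hb
        have : a ≠ b := fun h => ha (h ▸ hb)
        exact key hρ (by simp [ha, this]) (by simp [hb])
      · exact key (symmDiff_bot _).symm (by simpa using ha) (by simpa using hb)
  · obtain ⟨ρi, hρi⟩ := hρi
    obtain ⟨ρj, hρj⟩ := hρj
    by_cases hij : i = j
    · subst hij
      exact ⟨ρi, by rw [hρi, Set.pair_eq_singleton]⟩
    have hd : ∀ k ∈ orientationCode x₀ σ ∆ orientationCode x₀ τ, k ∈ H ∧ x₀ ∉ k := by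
      rintro k (hk | hk) <;> exact hsub hk.1
    refine exists_orientationCode hH x₀
      (((hcode σ).union (Set.toFinite {i, j})).subset symmDiff_le_sup) ?_ ?_
    · rintro A (hA | ⟨rfl | rfl, -⟩)
      exacts [hsub hA.1, hd _ hi, hd _ hj]
    · intro a b
      have key : ∀ {U : Set (Set α)} {ρ : CubulationVertex H},
          orientationCode x₀ ρ = orientationCode x₀ σ ∆ U → (a ∈ U ↔ a = i ∨ a = j) →
          (b ∈ U ↔ b = i ∨ b = j) →
          ∃ ρ : CubulationVertex H,
            (a ∈ orientationCode x₀ ρ ↔ a ∈ orientationCode x₀ σ ∆ {i, j}) ∧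
            (b ∈ orientationCode x₀ ρ ↔ b ∈ orientationCode x₀ σ ∆ {i, j}) := by
        intro U ρ hρ ha hb
        refine ⟨ρ, ?_, ?_⟩ <;> rw [hρ] <;>
          simp only [Set.mem_symmDiff, ha, hb, Set.mem_insert_iff, Set.mem_singleton_iff]
      by_cases hi' : a = i ∨ b = i <;> by_cases hj' : a = j ∨ b = j
      · refine key (U := orientationCode x₀ σ ∆ orientationCode x₀ τ) (ρ := τ)
          (symmDiff_symmDiff_cancel_left _ _).symm ?_ ?_
        · have : a = i ∨ a = j := by
            rcases hi' with rfl | rfl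
            · exact Or.inl rfl
            · exact Or.inr (hj'.resolve_right hij)
          refine iff_of_true ?_ this
          rcases this with rfl | rfl <;> assumption
        · have : b = i ∨ b = j := by
            rcases hi' with rfl | rfl
            · exact Or.inr (hj'.resolve_left hij)
            · exact Or.inl rfl
          refine iff_of_true ?_ this
          rcases this with rfl | rfl <;> assumption
      · rw [not_or] at hj'
        exact key hρi (by simp [hj'.1]) (by simp [hj'.2])
      · rw [not_or] at hi'
        exact key hρj (by simp [hi'.1]) (by simp [hi'.2])
      · rw [not_or] at hi' hj'
        exact key (U := ∅) (symmDiff_bot _).symm (by simp [hi'.1, hj'.1]) (by simp [hi'.2, hj'.2])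

theorem isCAT0_cubulation [Nonempty α] : (cubulation H).IsCAT0 := by
  have x₀ := Classical.arbitrary α
  have : Nonempty (CubulationVertex H) := ⟨principalVertex hH x₀⟩
  exact (isCode_cubulation hH hfin x₀).isCAT0

end Wallspace

end CubeSystem

namespace CubeSystem

variable {V : Type*} {K : CubeSystem V}

/-! ### The cubulation of a median subalgebra -/

theorem isMedianPoint_iff {x y z m : V} :
    K.IsMedianPoint x y z m ↔ K.Between x m y ∧ K.Between x m z ∧ K.Between y m z := by
  simp only [IsMedianPoint, Between, eq_comm]

theorem isMedianPoint_self_iff {x y z : V} : K.IsMedianPoint x y z z ↔ K.Between x z y := by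
  rw [isMedianPoint_iff]
  exact ⟨fun h => h.1, fun h => ⟨h, between_right _ _, between_right _ _⟩⟩

theorem compl_mem_medianHalfspaces {M : Set V} {A : Set M} (hA : A ∈ K.medianHalfspaces M) :
    Aᶜ ∈ K.medianHalfspaces M :=
  ⟨hA.2.1, by rw [compl_compl]; exact hA.1, hA.2.2.2, by rw [compl_compl]; exact hA.2.2.1⟩

theorem mem_of_mem_medianHalfspaces {M : Set V} {A : Set M} (hA : A ∈ K.medianHalfspaces M)
    {x y z : M} (hx : x ∈ A) (hy : y ∈ A) (h : K.Between x z y) : z ∈ A :=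
  hA.2.2.1 x hx y hy z (isMedianPoint_self_iff.2 h)

theorem IsHalfspace.preimage_mem_medianHalfspaces {M A : Set V} (hA : K.IsHalfspace A) {x y : M}
    (hx : (x : V) ∈ A) (hy : (y : V) ∉ A) : Subtype.val ⁻¹' A ∈ K.medianHalfspaces M :=
  ⟨⟨x, hx⟩, ⟨y, hy⟩, fun a ha b hb c hc => hA.convex a ha b hb c (isMedianPoint_self_iff.1 hc),
    fun a ha b hb c hc => hA.convex_compl a ha b hb c (isMedianPoint_self_iff.1 hc)⟩

/-- A point of the interval is determined by which of the finitely many halfspaces separating `x`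
from `y` contain it. -/
theorem IsCAT0.finite_interval (hK : K.IsCAT0) (x y : V) : {z | K.Between x z y}.Finite := by
  have hfin := (hK.finite_separating x y).1
  refine Set.Finite.of_finite_image
    (f := fun z => {A | (K.IsHalfspace A ∧ x ∈ A ∧ y ∉ A) ∧ z ∈ A})
    (hfin.finite_subsets.subset ?_) ?_
  · rintro _ ⟨z, -, rfl⟩ A hA
    exact hA.1
  · intro z hz z' hz' he
    by_contra hne
    obtain ⟨A, hA, hzA, hzA'⟩ := hK.exists_halfspace hne
    simp only [Set.ext_iff, Set.mem_ofPred_eq] at he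
    have h1 := he A
    have h2 := he Aᶜ
    simp only [hA, hA.compl, Set.mem_compl_iff, hzA, hzA'] at h1 h2
    have h3 := fun hx hy => hzA' (hA.convex x hx y hy z' hz')
    have h4 := fun hx hy => hA.convex_compl x hx y hy z hz hzA
    simp only [Set.mem_compl_iff] at h4
    tauto

section

variable {M : Set V}

theorem IsMedianSubalgebra.exists_median (hM : K.IsMedianSubalgebra M) (hK : K.IsCAT0) (x y z : M) :
    ∃ m : M, K.Between (x : V) m y ∧ K.Between (x : V) m z ∧ K.Between (y : V) m z := by
  obtain ⟨m, h⟩ := hK.exists_median x y z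
  exact ⟨⟨m, hM x x.2 y y.2 z z.2 m (isMedianPoint_iff.2 h)⟩, h⟩

variable (hM : K.IsMedianSubalgebra M) (hK : K.IsCAT0)
include hM hK

/-- A halfspace of `M` separating `x` from `y` is determined by its trace on the finite interval
between them: it contains `z` exactly when it contains the median of `x`, `y`, `z`. -/
theorem finite_medianHalfspaces_separating (x y : M) :
    {A ∈ K.medianHalfspaces M | x ∈ A ∧ y ∉ A}.Finite := by
  refine Set.Finite.of_finite_image (f := fun A => {z : M | z ∈ A ∧ K.Between (x : V) z y})
    (((hK.finite_interval x y).preimage Subtype.val_injective.injOn).finite_subsets.subset ?_) ?_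
  · rintro _ ⟨A, -, rfl⟩ z hz
    exact hz.2
  · have key : ∀ A ∈ {A ∈ K.medianHalfspaces M | x ∈ A ∧ y ∉ A}, ∀ z m : M, K.Between (x : V) m z →
        K.Between (y : V) m z → (z ∈ A ↔ m ∈ A) := by
      rintro A ⟨hA, hx, hy⟩ z m h1 h2
      refine ⟨fun hz => mem_of_mem_medianHalfspaces hA hx hz h1, fun hm => ?_⟩
      by_contra hz
      exact mem_of_mem_medianHalfspaces (compl_mem_medianHalfspaces hA) hy hz h2 hm
    intro A hA B hB he
    ext z
    obtain ⟨m, h1, h2, h3⟩ := hM.exists_median hK x y z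
    rw [key A hA z m h2 h3, key B hB z m h2 h3]
    simpa [h1] using Set.ext_iff.1 he m

theorem finite_symmDiff_principal (x y : M) :
    (principalOrientation (K.medianHalfspaces M) x ∆
      principalOrientation (K.medianHalfspaces M) y).Finite := by
  refine ((finite_medianHalfspaces_separating hM hK x y).union
    (finite_medianHalfspaces_separating hM hK y x)).subset ?_
  rintro A (⟨⟨hA, h1⟩, h2⟩ | ⟨⟨hA, h1⟩, h2⟩)
  · exact Or.inl ⟨hA, h1, fun h => h2 ⟨hA, h⟩⟩
  · exact Or.inr ⟨hA, h1, fun h => h2 ⟨hA, h⟩⟩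

theorem isCAT0_medianCubulation (hne : M.Nonempty) : (K.medianCubulation M).IsCAT0 := by
  have := hne.to_subtype
  exact isCAT0_cubulation (fun _ => compl_mem_medianHalfspaces) (finite_symmDiff_principal hM hK)

/-- The cubulation of a median subalgebra has no other vertices than those defined by the points. -/
theorem exists_principal (σ : CubulationVertex (K.medianHalfspaces M)) :
    ∃ x : M, σ.1 = principalOrientation (K.medianHalfspaces M) x := by
  have hfin := finite_symmDiff_principal hM hK
  have hne : Nonempty M := ⟨σ.2.2.choose⟩
  -- The point `x` is taken as near to `σ` as possible. If some chosen `A` misses it, the gate of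
  -- `x` in `A` is strictly nearer.
  obtain ⟨x, -, hx⟩ := exists_minimalFor_of_wellFoundedLT (fun _ : M => True)
    (fun x => (σ.1 ∆ principalOrientation (K.medianHalfspaces M) x).ncard)
    ⟨Classical.arbitrary M, trivial⟩
  refine ⟨x, ?_⟩
  by_contra hσ
  obtain ⟨A, hA, hxA⟩ : ∃ A ∈ σ.1, x ∉ A := by
    by_contra! hall
    refine hσ (Set.Subset.antisymm (fun A hA => ⟨σ.2.1.subset hA, hall A hA⟩) fun A hA => ?_)
    by_contra hA'
    exact hall _ ((σ.2.1.compl_mem_iff hA.1).2 hA') hA.2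
  have hAH := σ.2.1.subset hA
  obtain ⟨z, hz, hmin⟩ := exists_minimalFor_of_wellFoundedLT (· ∈ A)
    (fun z : M => K.graph.dist (x : V) z) hAH.1
  have hgate : ∀ a ∈ A, K.Between (x : V) z a := by
    intro a ha
    obtain ⟨m, h1, h2, h3⟩ := hM.exists_median hK x z a
    have hm : m ∈ A := mem_of_mem_medianHalfspaces hAH hz ha h3
    have h4 : K.graph.dist (x : V) m + K.graph.dist (m : V) z = K.graph.dist (x : V) z := h1
    have h5 := hmin hm (by simp only; omega)
    simp only at h5
    obtain rfl := Subtype.ext (hK.dist_eq_zero.1 (show K.graph.dist (m : V) z = 0 by omega))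
    exact h2
  -- Every halfspace gained in passing from `x` to the gate `z` contains the whole of `A`, so `σ`
  -- chooses it.
  have hsub : ∀ B ∈ K.medianHalfspaces M, z ∈ B → x ∉ B → B ∈ σ.1 := by
    intro B hB hzB hxB
    refine σ.2.1.upward A hAH B hB (fun a ha => ?_) hA
    by_contra haB
    exact mem_of_mem_medianHalfspaces (compl_mem_medianHalfspaces hB) hxB haB (hgate a ha) hzB
  have hlt : (σ.1 ∆ principalOrientation (K.medianHalfspaces M) z).ncard <
      (σ.1 ∆ principalOrientation (K.medianHalfspaces M) x).ncard := by
    refine Set.ncard_lt_ncard ⟨?_, fun h => ?_⟩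
      (symmDiff_finite hfin σ (principalVertex (fun _ => compl_mem_medianHalfspaces) x))
    · rintro B (⟨hB, hzB⟩ | ⟨hzB, hB⟩)
      · have hBH := σ.2.1.subset hB
        refine Or.inl ⟨hB, fun hxB => ?_⟩
        exact (σ.2.1.compl_mem_iff hBH).1
          (hsub Bᶜ (compl_mem_medianHalfspaces hBH) (fun h => hzB ⟨hBH, h⟩) (not_not.2 hxB.2)) hB
      · refine Or.inr ⟨⟨hzB.1, ?_⟩, hB⟩
        by_contra hxB
        exact hB (hsub B hzB.1 hzB.2 hxB)
    · rcases h (Or.inl ⟨hA, fun h => hxA h.2⟩ :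
        A ∈ σ.1 ∆ principalOrientation (K.medianHalfspaces M) x) with h | h
      · exact h.2 ⟨hAH, hz⟩
      · exact h.2 hA
  have := hx (j := z) trivial hlt.le
  simp only at this
  omega

/-- Sending `y` to the first vertex of a geodesic from `x` to `y` is injective. If `y` and `y'` have
the same image, one hyperplane separates `x` from both, so the median `m` of the three differs from
`x`; as only one wall of `M` separates `x` from `y`, `m = y`, and likewise `m = y'`. -/
theorem finite_adj_principal (x : M) (hfin : {w | K.graph.Adj (x : V) w}.Finite) :
    {y : M | (principalOrientation (K.medianHalfspaces M) x ∆
      principalOrientation (K.medianHalfspaces M) y).ncard = 2}.Finite := by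
  have hne : ∀ y ∈ {y : M | (principalOrientation (K.medianHalfspaces M) x ∆
      principalOrientation (K.medianHalfspaces M) y).ncard = 2}, (x : V) ≠ y := by
    intro y hy h
    rw [Set.mem_ofPred_eq, Subtype.ext h] at hy
    simp at hy
  have : Nonempty V := ⟨x⟩
  choose! w hw hwd using fun y hy => hK.exists_adj_dist (hne y hy)
  have hHsub : ∀ {p q : M}, p ≠ q → ∃ B ∈ K.medianHalfspaces M, p ∈ B ∧ q ∉ B := by
    intro p q hpq
    obtain ⟨B, hB, hp, hq⟩ := hK.exists_halfspace (fun h => hpq (Subtype.ext h) : (p : V) ≠ q)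
    exact ⟨_, hB.preimage_mem_medianHalfspaces hp hq, hp, hq⟩
  refine Set.Finite.of_finite_image (f := w) (hfin.subset ?_) ?_
  · rintro _ ⟨y, hy, rfl⟩
    exact hw y hy
  · intro y hy y' hy' he
    obtain ⟨A, hA, hxA, hwA⟩ := hK.exists_halfspace_adj (hw y hy)
    have hout : ∀ y ∈ {y : M | (principalOrientation (K.medianHalfspaces M) x ∆
        principalOrientation (K.medianHalfspaces M) y).ncard = 2}, w y ∉ A → (y : V) ∉ A := by
      intro y hy hwA hyA
      refine hwA (hA.convex _ hxA _ hyA _ ?_)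
      rw [Between, SimpleGraph.dist_eq_one_iff_adj.2 (hw y hy), add_comm]
      exact hwd y hy
    obtain ⟨m, h1, h2, h3⟩ := hM.exists_median hK x y y'
    have hmA : (m : V) ∉ A := fun h =>
      hA.convex_compl _ (hout y hy hwA) _ (hout y' hy' (he ▸ hwA)) _ h3 h
    have hmx : x ≠ m := by rintro rfl; exact hmA hxA
    have key : ∀ y ∈ {y : M | (principalOrientation (K.medianHalfspaces M) x ∆
        principalOrientation (K.medianHalfspaces M) y).ncard = 2}, K.Between (x : V) m y → m = y := by
      intro y hy hb
      by_contra hmy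
      obtain ⟨B, hB, hxB, hmB⟩ := hHsub hmx
      obtain ⟨C, hC, hmC, hyC⟩ := hHsub hmy
      have hyB : y ∉ B := fun h => hmB (mem_of_mem_medianHalfspaces hB hxB h hb)
      have hxC : x ∈ C := by
        by_contra h
        exact mem_of_mem_medianHalfspaces (compl_mem_medianHalfspaces hC) h hyC hb hmC
      have hpm : ∀ {D}, D ∈ K.medianHalfspaces M → x ∈ D → y ∉ D →
          D ∈ principalOrientation (K.medianHalfspaces M) x ∆
            principalOrientation (K.medianHalfspaces M) y ∧
          Dᶜ ∈ principalOrientation (K.medianHalfspaces M) x ∆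
            principalOrientation (K.medianHalfspaces M) y := fun hD hx hy =>
        ⟨Or.inl ⟨⟨hD, hx⟩, fun h => hy h.2⟩,
          Or.inr ⟨⟨compl_mem_medianHalfspaces hD, hy⟩, fun h => h.2 hx⟩⟩
      obtain ⟨p, q, hpq, heq⟩ := Set.ncard_eq_two.1 hy
      obtain ⟨b1, b2⟩ := hpm hB hxB hyB
      obtain ⟨c1, c2⟩ := hpm hC hxC hyC
      have hBC : B ≠ C := by rintro rfl; exact hmB hmC
      have hBB : B ≠ Bᶜ := fun h => (h ▸ hxB : x ∈ Bᶜ) hxB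
      have hBC' : Bᶜ ≠ C := by rintro rfl; exact hxC hxB
      rw [heq] at b1 b2 c1
      rcases b1 with b1 | b1 <;> rcases b2 with b2 | b2 <;> rcases c1 with c1 | c1
      · exact hBC (b1.trans c1.symm)
      · exact hBB (b1.trans b2.symm)
      · exact hBC (b1.trans c1.symm)
      · exact hBC' (b2.trans c1.symm)
      · exact hBC' (b2.trans c1.symm)
      · exact hBC (b1.trans c1.symm)
      · exact hBB (b1.trans b2.symm)
      · exact hBB (b1.trans b2.symm)
    rw [← key y hy h1, ← key y' hy' h2]

end

end CubeSystem

namespace CubeSystem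

/-! ### Geometric actions -/

section

variable {V : Type*} {K : CubeSystem V}

theorem IsCAT0.finite_ball (hK : K.IsCAT0) (hlf : ∀ v, {w | K.graph.Adj v w}.Finite) (v : V) (r : ℕ) :
    {w | K.graph.dist w v ≤ r}.Finite := by
  induction r with
  | zero =>
    refine (Set.finite_singleton v).subset fun w hw => hK.dist_eq_zero.1 (Nat.le_zero.1 hw)
  | succ r ih =>
    refine (ih.union (ih.biUnion fun u _ => hlf u)).subset fun w hw => ?_
    by_cases h : w = v
    · exact Or.inl (by simp [h])
    · obtain ⟨u, hu, hud⟩ := hK.exists_adj_dist h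
      have hw : K.graph.dist w v ≤ r + 1 := hw
      exact Or.inr (Set.mem_biUnion (show K.graph.dist u v ≤ r by omega) hu.symm)

/-- A cube containing `v` is determined by its edges at `v`. -/
theorem IsCubeComplex.finite_cubes (hK : K.IsCubeComplex) {v : V}
    (hlf : {w | K.graph.Adj v w}.Finite) : {C ∈ K.cubes | v ∈ C}.Finite := by
  refine Set.Finite.of_finite_image (f := fun C => {w | w ∈ C ∧ K.graph.Adj v w})
    (hlf.finite_subsets.subset ?_) ?_
  · rintro _ ⟨C, -, rfl⟩ w hw
    exact hw.2
  · rintro C ⟨hC, hvC⟩ D ⟨hD, hvD⟩ he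
    simp only [Set.ext_iff, Set.mem_ofPred_eq] at he
    exact (hK.subset_of_neighbors hC hD hvC hvD fun w hw ha => ((he w).1 ⟨hw, ha⟩).1).antisymm
      (hK.subset_of_neighbors hD hC hvD hvC fun w hw ha => ((he w).2 ⟨hw, ha⟩).1)

/-- A sufficient condition for an action on a locally finite complex to be geometric. -/
theorem actsGeometrically_of_finite {D : Type*} [Group D] (hK : K.IsCAT0)
    (hlf : ∀ v, {w | K.graph.Adj v w}.Finite) (κ : D →* K.Aut)
    (hst : ∀ v w : V, {h | κ h • v = w}.Finite) {F : Set V} (hF : F.Finite)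
    (horb : ∀ v, ∃ h, ∃ w ∈ F, κ h • w = v) : ActsGeometrically κ := by
  refine ⟨fun v r => ?_, {C ∈ K.cubes | ∃ v ∈ F, v ∈ C}, fun C hC => hC.1, ?_, fun C hC => ?_⟩
  · refine ((hK.finite_ball hlf v r).biUnion fun w _ => hst v w).subset fun h hh => ?_
    exact Set.mem_biUnion (show K.graph.dist (κ h • v) v ≤ r by rw [SimpleGraph.dist_comm]; exact hh)
      rfl
  · refine (hF.biUnion fun v _ => hK.1.finite_cubes (hlf v)).subset ?_
    rintro C ⟨hC, v, hv, hvC⟩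
    exact Set.mem_biUnion hv ⟨hC, hvC⟩
  · obtain ⟨v, hv⟩ := hK.1.nonempty hC
    obtain ⟨h, w, hw, rfl⟩ := horb v
    refine ⟨h, ((κ h)⁻¹ • ·) '' C, ⟨((κ h)⁻¹.2 C).2 hC, w, hw, ?_⟩, ?_⟩
    · rw [inv_smul_mem_iff]; exact hv
    · change (κ h • ·) '' (((κ h)⁻¹ • ·) '' C) = C
      simp [Set.image_image]

/-- The centraliser of `g` acts with finitely many orbits on a level set of the displacement. -/
theorem exists_finite_centralizer_orbits {G : Type*} [Group G] (hK : K.IsCAT0)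
    (hlf : ∀ v, {w | K.graph.Adj v w}.Finite) (κ : G →* K.Aut)
    (hst : ∀ v w : V, {h | κ h • v = w}.Finite) {F : Set V} (hF : F.Finite)
    (horb : ∀ v, ∃ h, ∃ w ∈ F, κ h • w = v) (g : G) (l : ℕ) :
    ∃ E : Set V, E.Finite ∧ E ⊆ {x | K.graph.dist x (κ g • x) = l} ∧
      ∀ x, K.graph.dist x (κ g • x) = l → ∃ h ∈ Subgroup.centralizer {g}, ∃ w ∈ E, κ h • w = x := by
  choose h w hw hhw using horb
  -- Translating `x` to its representative replaces `g` by a conjugate with the same displacement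
  -- there. Properness makes the image of the level set finite, and the points of a fibre are
  -- related by elements of the centraliser.
  let Φ : V → V × G := fun x => (w x, (h x)⁻¹ * g * h x)
  set M : Set V := {x | K.graph.dist x (κ g • x) = l}
  have hfin : (Φ '' M).Finite := by
    refine (hF.biUnion (t := fun v => {v} ×ˢ {k : G | K.graph.dist (κ k • v) v ≤ l}) fun v _ =>
      (Set.finite_singleton v).prod ?_).subset ?_
    · refine ((hK.finite_ball hlf v l).biUnion fun u _ => hst v u).subset fun k hk => ?_
      exact Set.mem_biUnion (by exact hk : K.graph.dist (κ k • v) v ≤ l) rfl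
    · rintro _ ⟨x, hx, rfl⟩
      refine Set.mem_biUnion (hw x) ⟨rfl, ?_⟩
      have hx : K.graph.dist x (κ g • x) = l := hx
      change K.graph.dist (κ ((h x)⁻¹ * g * h x) • w x) (w x) ≤ l
      rw [← dist_smul (κ (h x)) hK.connected, map_mul, map_mul, map_inv, ← mul_smul, ← mul_assoc,
        ← mul_assoc, mul_inv_cancel, one_mul, mul_smul, hhw, SimpleGraph.dist_comm, hx]
  obtain ⟨E, hEM, hE⟩ := Set.exists_subset_bijOn M Φ
  refine ⟨E, hE.finite_iff_finite.2 hfin, hEM, fun x hx => ?_⟩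
  obtain ⟨y, hy, he⟩ := hE.surjOn ⟨x, hx, rfl⟩
  obtain ⟨h1, h2⟩ := Prod.mk.inj he
  refine ⟨h x * (h y)⁻¹, ?_, y, hy, ?_⟩
  · rw [Subgroup.mem_centralizer_singleton_iff]
    have : h x * ((h y)⁻¹ * g * h y) * (h y)⁻¹ = h x * ((h x)⁻¹ * g * h x) * (h y)⁻¹ := by rw [h2]
    simpa [mul_assoc] using this
  · have h3 : (κ (h y))⁻¹ • y = w y := by rw [inv_smul_eq_iff, hhw]
    rw [map_mul, map_inv, mul_smul, h3, h1, hhw]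

end

/-! ### The action induced on a cubulation -/

section

variable {α : Type*} {H : Set (Set α)}

theorem symmDiff_cubulationMap (f : Equiv.Perm α) (hf : ∀ A, f '' A ∈ H ↔ A ∈ H)
    (σ τ : CubulationVertex H) : (cubulationMap H f hf σ).1 ∆ (cubulationMap H f hf τ).1 =
      (fun A => f '' A) '' (σ.1 ∆ τ.1) :=
  (Set.image_symmDiff f.injective.image_injective _ _).symm

theorem cubulationMap_adj (f : Equiv.Perm α) (hf : ∀ A, f '' A ∈ H ↔ A ∈ H)
    (σ τ : CubulationVertex H) :
    (cubulationGraph H).Adj (cubulationMap H f hf σ) (cubulationMap H f hf τ) ↔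
      (cubulationGraph H).Adj σ τ := by
  change Set.ncard _ = 2 ↔ Set.ncard _ = 2
  rw [symmDiff_cubulationMap, Set.ncard_image_of_injective _ f.injective.image_injective]

theorem cubulationMap_principal (f : Equiv.Perm α) (hf : ∀ A, f '' A ∈ H ↔ A ∈ H)
    (σ : CubulationVertex H) (x : α) (hσ : σ.1 = principalOrientation H x) :
    (cubulationMap H f hf σ).1 = principalOrientation H (f x) := by
  change (fun A => f '' A) '' σ.1 = _
  rw [hσ]
  ext A
  obtain ⟨B, rfl⟩ := f.surjective.image_surjective A
  rw [f.injective.image_injective.mem_set_image]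
  simp [principalOrientation, hf]

theorem image_fillCubes {O : Type*} {Γ : SimpleGraph O} (f : O → O) (hinj : Function.Injective f)
    (hf : ∀ σ τ, Γ.Adj (f σ) (f τ) ↔ Γ.Adj σ τ) {C : Set O} (hC : C ∈ Γ.fillCubes.cubes) :
    f '' C ∈ Γ.fillCubes.cubes := by
  obtain ⟨n, φ, h1, h2, rfl⟩ := hC
  exact ⟨n, f ∘ φ, hinj.comp h1, fun x y h => (hf _ _).2 (h2 x y h), Set.range_comp f φ⟩

variable {D : Type*} [Group D] (τ : D →* Equiv.Perm α) (hτ : ∀ h A, τ h '' A ∈ H ↔ A ∈ H)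

theorem cubulationMap_mul (h k : D) (σ : CubulationVertex H) :
    cubulationMap H (τ (h * k)) (hτ _) σ =
      cubulationMap H (τ h) (hτ _) (cubulationMap H (τ k) (hτ _) σ) := by
  refine Subtype.ext ?_
  change (fun A => τ (h * k) '' A) '' σ.1 = (fun A => τ h '' A) '' ((fun A => τ k '' A) '' σ.1)
  simp [Set.image_image]

theorem cubulationMap_one (σ : CubulationVertex H) :
    cubulationMap H (τ 1) (hτ _) σ = σ := by
  refine Subtype.ext ?_
  change (fun A => τ 1 '' A) '' σ.1 = σ.1
  simp

/-- The permutation of the cubulation induced by an element of the group. -/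
def cubulationPerm (h : D) : Equiv.Perm (CubulationVertex H) where
  toFun := cubulationMap H (τ h) (hτ h)
  invFun := cubulationMap H (τ h⁻¹) (hτ h⁻¹)
  left_inv σ := by rw [← cubulationMap_mul τ hτ]; simp only [inv_mul_cancel]; exact cubulationMap_one τ hτ σ
  right_inv σ := by rw [← cubulationMap_mul τ hτ]; simp only [mul_inv_cancel]; exact cubulationMap_one τ hτ σ

/-- The action on the cubulation induced by an action preserving the walls. -/
def cubulationHom : D →* (cubulation H).Aut where
  toFun h := ⟨cubulationPerm τ hτ h, fun C => by
    refine ⟨fun hC => ?_, image_fillCubes _ (cubulationPerm τ hτ h).injective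
      (cubulationMap_adj (τ h) (hτ h))⟩
    have := image_fillCubes _ (cubulationPerm τ hτ h⁻¹).injective
      (cubulationMap_adj (τ h⁻¹) (hτ h⁻¹)) hC
    rw [Set.image_image] at this
    have e : (fun σ => cubulationPerm τ hτ h⁻¹ (cubulationPerm τ hτ h σ)) '' C = C :=
      (Set.image_congr' (cubulationPerm τ hτ h).left_inv).trans (Set.image_id' C)
    exact e ▸ this⟩
  map_one' := Subtype.ext (Equiv.ext fun σ => cubulationMap_one τ hτ σ)
  map_mul' h k := Subtype.ext (Equiv.ext fun σ => cubulationMap_mul τ hτ h k σ)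

end

/-! ### The action of the centraliser on the median set -/

section

variable {V : Type*} {K : CubeSystem V} {f : K.Aut}

theorem isMedianSubalgebra_isMinDisplacement (hK : K.IsCAT0)
    (hf : ∀ n : ℕ, ∀ A, K.IsHalfspace A → (f ^ n • ·) '' A ≠ Aᶜ) :
    K.IsMedianSubalgebra {x | K.IsMinDisplacement f x} := by
  intro x hx y hy z hz m hm
  obtain ⟨h1, h2, h3⟩ := isMedianPoint_iff.1 hm
  have hx' := IsMinDisplacement.orbitMonotone hK hf hx
  exact OrbitMonotone.isMinDisplacement hK hx hx' (hx'.median hK (hy.orbitMonotone hK hf)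
    (hz.orbitMonotone hK hf) h1 h2 h3)

/-- The median set of a loxodromic automorphism. -/
theorem medianSet_eq (hK : K.IsCAT0)
    (hf : ∀ n : ℕ, ∀ A, K.IsHalfspace A → (f ^ n • ·) '' A ≠ Aᶜ)
    (hfix : ∀ x : V, f • x ≠ x) (hinv : ¬ K.IsInverting f) :
    K.medianSet f = {x | K.IsMinDisplacement f x} := by
  have hpos : ∀ x : V, 0 < K.graph.dist x (f • x) := fun x =>
    Nat.pos_of_ne_zero fun h => hfix x (hK.dist_eq_zero.1 h).symm
  have := hK.connected.nonempty
  obtain ⟨o, ho⟩ := exists_isMinDisplacement f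
  have ho' := ho.orbitMonotone hK hf
  obtain ⟨γ, hγ, -⟩ := ho.exists_isAxis hK ho' (hpos o)
  have hell : ¬ K.IsElliptic f := by
    intro h
    -- Distances along the orbit of `o` grow at least linearly, so no bound survives the power `N +
    -- 1`.
    obtain ⟨N, hN⟩ := h o
    have h1 : K.graph.dist o (f ^ (N + 1) • o) ≤ N := by
      rw [← zpow_natCast]; exact hN (N + 1 : ℕ)
    rw [ho'.dist_pow hK] at h1
    have := Nat.mul_le_mul_left (N + 1) (hpos o)
    omega
  ext x
  constructor
  · rintro (⟨h, -⟩ | ⟨-, δ, hδ, i, rfl⟩ | ⟨h, -⟩)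
    · exact absurd h hell
    · exact isMinDisplacement_of_isAxis hδ i
    · exact absurd h hinv
  · intro hx
    obtain ⟨δ, hδ, rfl⟩ := IsMinDisplacement.exists_isAxis hK hx
      (IsMinDisplacement.orbitMonotone hK hf hx) (hpos x)
    exact Or.inr (Or.inl ⟨⟨γ, hγ⟩, δ, hδ, 0, rfl⟩)

theorem medianHalfspaces_image {M : Set V} (hc : K.graph.Connected) (h : K.Aut)
    (t : Equiv.Perm M) (ht : ∀ x, (t x : V) = h • (x : V)) {A : Set M}
    (hA : A ∈ K.medianHalfspaces M) : t '' A ∈ K.medianHalfspaces M := by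
  have hconv : ∀ {A : Set M}, K.IsMedianConvex M A → K.IsMedianConvex M (t '' A) := by
    rintro A hA _ ⟨x, hx, rfl⟩ _ ⟨y, hy, rfl⟩ z hz
    obtain ⟨z, rfl⟩ := t.surjective z
    refine ⟨z, hA x hx y hy z ?_, rfl⟩
    rwa [isMedianPoint_self_iff, ht, ht, ht, between_smul h hc, ← isMedianPoint_self_iff] at hz
  have h := Set.image_compl_eq t.bijective (s := A)
  exact ⟨hA.1.image _, h ▸ hA.2.1.image _, hconv hA.2.2.1, h ▸ hconv hA.2.2.2⟩

/-- Vertices of the cubulation are identified equivariantly with the points of `M`. Local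
finiteness, finite stabilisers and finitely many orbits are then checked on `M`, which is a level
set of the displacement. -/
theorem exists_actsGeometrically {G : Type*} [Group G] (hK : K.IsCAT0)
    (hlf : ∀ v, {w | K.graph.Adj v w}.Finite) (κ : G →* K.Aut)
    (hst : ∀ v w : V, {h | κ h • v = w}.Finite) {F : Set V} (hF : F.Finite)
    (horb : ∀ v, ∃ h, ∃ w ∈ F, κ h • w = v) (g : G)
    (hg : ∀ n : ℕ, ∀ A, K.IsHalfspace A → (κ g ^ n • ·) '' A ≠ Aᶜ) {M : Set V}
    (hM : M = {x | K.IsMinDisplacement (κ g) x}) :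
    K.IsMedianSubalgebra M ∧ (K.medianCubulation M).IsCAT0 ∧
    ∃ τ : Subgroup.centralizer {g} →* Equiv.Perm M, (∀ h x, (τ h x : V) = (κ h).1 x) ∧
      ∃ μ : Subgroup.centralizer {g} →* (K.medianCubulation M).Aut,
        (∀ h σ, ((μ h).1 σ).1 = (fun A => τ h '' A) '' σ.1) ∧ ActsGeometrically μ := by
  have hc := hK.connected
  have := hc.nonempty
  have hsub : K.IsMedianSubalgebra M := hM ▸ isMedianSubalgebra_isMinDisplacement hK hg
  obtain ⟨o, ho⟩ := exists_isMinDisplacement (κ g)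
  have hne : M.Nonempty := ⟨o, hM ▸ ho⟩
  have hL := isCAT0_medianCubulation hsub hK hne
  have hmem : ∀ (h : Subgroup.centralizer {g}) (x : V), x ∈ M → κ h • x ∈ M := by
    intro h x hx
    rw [hM] at hx ⊢
    exact IsMinDisplacement.of_commute hc
      (Commute.map (show Commute (h : G) g from Subgroup.mem_centralizer_singleton_iff.1 h.2) κ) hx
  have hmem' : ∀ (h : Subgroup.centralizer {g}) (x : V), κ h • x ∈ M ↔ x ∈ M := by
    refine fun h x => ⟨fun hx => ?_, hmem h x⟩
    simpa using hmem h⁻¹ _ hx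
  let τ : Subgroup.centralizer {g} →* Equiv.Perm M :=
    { toFun := fun h => (κ h : Equiv.Perm V).subtypePerm (hmem' h)
      map_one' := by ext x; simp
      map_mul' := fun h k => by ext x; simp; rfl }
  have hτ : ∀ h x, (τ h x : V) = κ h • (x : V) := fun h x => rfl
  have hτH : ∀ h A, τ h '' A ∈ K.medianHalfspaces M ↔ A ∈ K.medianHalfspaces M := by
    refine fun h A => ⟨fun hA => ?_, medianHalfspaces_image hc _ _ (hτ h)⟩
    have := medianHalfspaces_image hc _ _ (hτ h⁻¹) hA
    rw [Set.image_image] at this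
    simpa using this
  refine ⟨hsub, hL, τ, hτ, cubulationHom τ hτH, fun h σ => rfl, ?_⟩
  have hfin := finite_symmDiff_principal hsub hK
  have hcompl : ∀ A ∈ K.medianHalfspaces M, Aᶜ ∈ K.medianHalfspaces M :=
    fun _ => compl_mem_medianHalfspaces
  have hpv : ∀ σ, ∃ x, σ = principalVertex hcompl x := fun σ =>
    (exists_principal hsub hK σ).imp fun x hx => Subtype.ext hx
  have hmap : ∀ h x, cubulationHom τ hτH h • principalVertex hcompl x =
      principalVertex hcompl (τ h x) := fun h x =>
    Subtype.ext (cubulationMap_principal (τ h) (hτH h) _ x rfl)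
  have hpinj : Function.Injective (principalVertex hcompl) := by
    intro x y hxy
    by_contra hne
    obtain ⟨B, hB, hx, hy⟩ := hK.exists_halfspace (fun h => hne (Subtype.ext h) : (x : V) ≠ y)
    have hB' := hB.preimage_mem_medianHalfspaces hx hy
    have : Subtype.val ⁻¹' B ∈ (principalVertex hcompl y).1 := hxy ▸ ⟨hB', hx⟩
    exact hy this.2
  obtain ⟨E, hE, hEM, hEorb⟩ := exists_finite_centralizer_orbits hK hlf κ hst hF horb g
    (K.graph.dist o (κ g • o))
  have hMd : ∀ x, x ∈ M ↔ K.graph.dist x (κ g • x) = K.graph.dist o (κ g • o) := by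
    intro x
    rw [hM]
    exact ⟨fun hx => IsMinDisplacement.dist_eq hx ho, fun hx y => hx.trans_le (ho y)⟩
  refine actsGeometrically_of_finite hL (fun σ => ?_) _ (fun σ τ' => ?_)
    (F := principalVertex hcompl '' (Subtype.val ⁻¹' E)) ?_ (fun σ => ?_)
  · obtain ⟨x, rfl⟩ := hpv σ
    refine ((finite_adj_principal hsub hK x (hlf x)).image (principalVertex hcompl)).subset ?_
    intro ρ hρ
    obtain ⟨y, rfl⟩ := hpv ρ
    exact ⟨y, ((isCode_cubulation hcompl hfin ⟨o, hM ▸ ho⟩).graph_adj _ _).1 hρ, rfl⟩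
  · obtain ⟨x, rfl⟩ := hpv σ
    obtain ⟨y, rfl⟩ := hpv τ'
    refine ((hst x y).preimage Subtype.val_injective.injOn).subset fun h hh => ?_
    exact congrArg Subtype.val (hpinj ((hmap h x).symm.trans hh))
  · exact (hE.preimage Subtype.val_injective.injOn).image _
  · obtain ⟨x, rfl⟩ := hpv σ
    obtain ⟨h, hh, w, hw, hx⟩ := hEorb x ((hMd x).1 x.2)
    refine ⟨⟨h, hh⟩, _, ⟨⟨w, (hMd w).2 (hEM hw)⟩, hw, rfl⟩, ?_⟩
    exact (hmap _ _).trans (congrArg _ (Subtype.ext hx))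

end

end CubeSystem

namespace CubeSystem

/-! ### Cubes and halfspaces -/

variable {V : Type*} {K : CubeSystem V}

/-- The halfspaces which contain a given cube. -/
def halfspacesAbove (K : CubeSystem V) (C : K.cubes) : Set (Set V) :=
  {A | K.IsHalfspace A ∧ (C : Set V) ⊆ A}

theorem IsCubeComplex.pair_mem_link (hK : K.IsCubeComplex) {C : Set V} (hC : C ∈ K.cubes)
    {z a b : V} (hz : z ∈ C) (ha : a ∈ C) (hb : b ∈ C) (hza : K.graph.Adj z a)
    (hzb : K.graph.Adj z b) (hab : a ≠ b) : {a, b} ∈ K.link z := by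
  obtain ⟨n, φ, hφ⟩ := hK.chart hC
  obtain ⟨x, rfl⟩ := hφ.exists_eq hz
  obtain ⟨_, rfl⟩ := hφ.exists_eq ha
  obtain ⟨_, rfl⟩ := hφ.exists_eq hb
  obtain ⟨i, rfl⟩ := hφ.adj_iff.1 hza
  obtain ⟨j, rfl⟩ := hφ.adj_iff.1 hzb
  exact (hφ.isSquare x fun e => hab (by rw [e])).mem_link hK

namespace IsCAT0

variable (hK : K.IsCAT0)
include hK

/-- A halfspace which separates the ends of an edge separates the ends of the opposite edges. -/
theorem side_of_isSquare {A : Set V} (hA : K.IsHalfspace A) {u a c d : V} (h : K.IsSquare u a c d)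
    (hu : u ∈ A) (ha : a ∉ A) : d ∈ A ∧ c ∉ A := by
  refine ⟨?_, fun hc => ha (hA.convex u hu c hc a (hK.between_of_adj h.adj₁ h.adj₂ h.ne'))⟩
  by_contra hd
  exact hA.convex_compl a ha d hd u (hK.between_of_adj h.adj₁.symm h.adj₃ h.ne) hu

theorem adj_unique {A : Set V} (hA : K.IsHalfspace A) {z w w' : V} (hw : K.graph.Adj z w)
    (hw' : K.graph.Adj z w') (hz : z ∈ A) (h : w ∉ A) (h' : w' ∉ A) : w = w' := by
  by_contra hne
  exact hA.convex_compl w h w' h' z (hK.between_of_adj hw.symm hw' hne) hz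

theorem dist_of_halfspace {A : Set V} (hA : K.IsHalfspace A) {z w y : V} (hw : K.graph.Adj z w)
    (hz : z ∈ A) (h : w ∉ A) (hy : y ∉ A) : K.graph.dist w y + 1 = K.graph.dist z y := by
  rw [hK.halfspace_eq_near hw hA hz h, Set.mem_ofPred_eq] at hy
  have := hK.dist_of_adj' hw y
  rw [SimpleGraph.dist_comm, SimpleGraph.dist_comm (u := z)]
  omega

/-- Being separated by `A` passes from an edge to its opposite edges in squares, hence to all edges
of the cube in direction `i`. -/
theorem halfspace_coordinate {A : Set V} (hA : K.IsHalfspace A) {C : Set V} {n : ℕ}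
    {φ : (Fin n → Bool) → V} (hφ : K.IsChart C φ) {x : Fin n → Bool} {i : Fin n} (hx : φ x ∈ A)
    (hi : φ (toggle x i) ∉ A) (y : Fin n → Bool) : φ y ∈ A ↔ y i = x i := by
  suffices H : (φ y ∈ A ↔ y i = x i) ∧ (φ (toggle y i) ∈ A ↔ y i ≠ x i) from H.1
  refine hypercube_induction (P := fun y => (φ y ∈ A ↔ y i = x i) ∧
    (φ (toggle y i) ∈ A ↔ y i ≠ x i)) x (by simp [hx, hi]) (fun y j hy => ?_) y
  by_cases hij : i = j
  · subst hij
    rw [toggle_toggle, hy.1, hy.2, toggle_same]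
    cases y i <;> cases x i <;> simp
  · rw [toggle_of_ne _ hij]
    have hs := hφ.isSquare y hij
    by_cases he : y i = x i
    · have h1 := hy.1.2 he
      have h2 : φ (toggle y i) ∉ A := fun h => hy.2.1 h he
      have h3 := hK.side_of_isSquare hA hs h1 h2
      rw [toggle_comm y j i]
      simp [he, h3.1, h3.2]
    · have h1 : φ y ∉ A := fun h => he (hy.1.1 h)
      have h2 := hy.2.2 he
      have h3 := hK.side_of_isSquare hA.compl hs h1 (not_not.2 h2)
      rw [toggle_comm y j i]
      simp [he, show φ (toggle y j) ∉ A from h3.1, not_not.1 h3.2]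

theorem exists_coordinate {A : Set V} (hA : K.IsHalfspace A) {C : Set V} {n : ℕ}
    {φ : (Fin n → Bool) → V} (hφ : K.IsChart C φ) {x : Fin n → Bool} (hx : φ x ∈ A)
    (hCA : ¬ C ⊆ A) : ∃ i, ∀ y, φ y ∈ A ↔ y i = x i := by
  by_contra! hcon
  refine hCA fun v hv => ?_
  obtain ⟨y, rfl⟩ := hφ.exists_eq hv
  refine hypercube_induction (P := fun y => φ y ∈ A) x hx (fun y i hy => ?_) y
  by_contra hi
  have h := hK.halfspace_coordinate hA hφ hy hi
  obtain ⟨z, hz⟩ := hcon i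
  have hxy := (h x).1 hx
  rw [h, ← hxy] at hz
  rcases hz with hz | hz
  · exact hz.2 hz.1
  · exact hz.1 hz.2

theorem exists_adj_notMem {A : Set V} (hA : K.IsHalfspace A) {C : Set V} (hC : C ∈ K.cubes) {z : V}
    (hz : z ∈ C) (hzA : z ∈ A) (hCA : ¬ C ⊆ A) : ∃ w ∈ C, K.graph.Adj z w ∧ w ∉ A := by
  obtain ⟨n, φ, hφ⟩ := hK.1.chart hC
  obtain ⟨x, rfl⟩ := hφ.exists_eq hz
  obtain ⟨i, hi⟩ := hK.exists_coordinate hA hφ hzA hCA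
  exact ⟨_, hφ.mem (toggle x i), hφ.adj_iff.2 ⟨i, rfl⟩, by simp [hi]⟩

/-- A halfspace cuts a cube along a face. -/
theorem inter_halfspace {A : Set V} (hA : K.IsHalfspace A) {C : Set V} (hC : C ∈ K.cubes)
    (hCA : (C ∩ A).Nonempty) (hCA' : ¬ C ⊆ A) : C ∩ A ∈ K.cubes ∧
      ∀ B, K.IsHalfspace B → (C ∩ A ⊆ B ↔ C ⊆ B ∨ B = A) := by
  obtain ⟨n, φ, hφ⟩ := hK.1.chart hC
  obtain ⟨z, hz, hzA⟩ := hCA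
  obtain ⟨x, rfl⟩ := hφ.exists_eq hz
  obtain ⟨i, hi⟩ := hK.exists_coordinate hA hφ hzA hCA'
  constructor
  · convert hφ.face_mem x {i} using 1
    ext v
    constructor
    · rintro ⟨hv, hvA⟩
      obtain ⟨y, rfl⟩ := hφ.exists_eq hv
      exact ⟨y, by simpa [hypercubeFace] using (hi y).1 hvA, rfl⟩
    · rintro ⟨y, hy, rfl⟩
      exact ⟨hφ.mem y, (hi y).2 (hy i rfl)⟩
  · intro B hB
    constructor
    · intro h
      by_contra! hcon
      obtain ⟨j, hj⟩ := hK.exists_coordinate hB hφ (h ⟨hz, hzA⟩) hcon.1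
      by_cases hij : i = j
      · subst hij
        exact hcon.2 (hK.halfspace_unique (hφ.adj_iff.2 ⟨i, rfl⟩ : K.graph.Adj (φ x) (φ (toggle x i)))
          hB hA (h ⟨hz, hzA⟩) (by simp [hj]) hzA (by simp [hi]))
      · have : φ (toggle x j) ∈ B := h ⟨hφ.mem _, by simp [hi, hij]⟩
        simp [hj] at this
    · rintro (h | rfl)
      · exact Set.inter_subset_left.trans h
      · exact Set.inter_subset_right

/-- A Helly property inside a cube: if the half `C ∩ A` lay in the complement of `B`, then `C`
itself would, or `A` would be this complement. -/
theorem inter_inter_nonempty {A B : Set V} (hA : K.IsHalfspace A) (hB : K.IsHalfspace B)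
    {C : Set V} (hC : C ∈ K.cubes) (hCA : (C ∩ A).Nonempty) (hCB : (C ∩ B).Nonempty)
    (hAB : (A ∩ B).Nonempty ∨ (C ⊆ A ∨ A ≠ Bᶜ)) : (C ∩ A ∩ B).Nonempty := by
  by_cases h : C ⊆ A
  · rwa [Set.inter_eq_left.2 h]
  have hAB : A ≠ Bᶜ := by
    rintro rfl
    rcases hAB with h' | h' | h'
    · simp at h'
    · exact h h'
    · exact h' rfl
  by_contra hne
  have hsub : C ∩ A ⊆ Bᶜ := fun v hv hvB => hne ⟨v, hv, hvB⟩
  rcases ((hK.inter_halfspace hA hC hCA h).2 _ hB.compl).1 hsub with h' | h'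
  · obtain ⟨v, hv, hvB⟩ := hCB
    exact h' hv hvB
  · exact hAB h'.symm

/-- A cube is the intersection of the halfspaces containing it. For `y` outside `D`, the first edge
from a nearest vertex `z` of `D` towards `y` is cut by a halfspace containing `D` and not `y`:
otherwise that edge would lie in `D` and lead nearer to `y`. -/
theorem le_iff_halfspacesAbove {C D : K.cubes} :
    C ≤ D ↔ K.halfspacesAbove D ⊆ K.halfspacesAbove C := by
  refine ⟨fun h A hA => ⟨hA.1, (show (C : Set V) ⊆ D from h).trans hA.2⟩, fun h y hy => ?_⟩
  by_contra hyD
  obtain ⟨z, hz, hmin⟩ := exists_minimalFor_of_wellFoundedLT (· ∈ (D : Set V))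
    (fun z => K.graph.dist z y) (hK.1.nonempty D.2)
  have hzy : z ≠ y := by rintro rfl; exact hyD hz
  obtain ⟨w, hw, hwy⟩ := hK.exists_adj_dist hzy
  obtain ⟨A, hA, hzA, hwA⟩ := hK.exists_halfspace_adj hw
  have hDA : (D : Set V) ⊆ A := by
    by_contra hDA
    obtain ⟨w', hw'D, hw', hw'A⟩ := hK.exists_adj_notMem hA D.2 hz hzA hDA
    obtain rfl := hK.adj_unique hA hw hw' hzA hwA hw'A
    have := hmin hw'D
    simp only at this
    omega
  have hyA : y ∈ A := (h ⟨hA, hDA⟩).2 hy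
  have := hK.dist_of_halfspace hA.compl hw.symm hwA (not_not.2 hzA) (not_not.2 hyA)
  omega

theorem halfspacesAbove_injective : Function.Injective K.halfspacesAbove := fun _ _ h =>
  le_antisymm (hK.le_iff_halfspacesAbove.2 h.ge) (hK.le_iff_halfspacesAbove.2 h.le)

theorem exists_halfspacesAbove_insert {C : K.cubes} {A : Set V} (hA : K.IsHalfspace A)
    (hCA : ((C : Set V) ∩ A).Nonempty) (hA' : A ∉ K.halfspacesAbove C) :
    ∃ D : K.cubes, (D : Set V) = (C : Set V) ∩ A ∧
      K.halfspacesAbove D = insert A (K.halfspacesAbove C) := by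
  obtain ⟨h1, h2⟩ := hK.inter_halfspace hA C.2 hCA fun h => hA' ⟨hA, h⟩
  refine ⟨⟨_, h1⟩, rfl, Set.ext fun B => ⟨fun hB => ?_, ?_⟩⟩
  · exact ((h2 B hB.1).1 hB.2).elim (fun h => Or.inr ⟨hB.1, h⟩) Or.inl
  · rintro (rfl | hB)
    · exact ⟨hA, Set.inter_subset_right⟩
    · exact ⟨hB.1, (h2 B hB.1).2 (Or.inl hB.2)⟩

/-- The cube `Q` is cut successively by the members of `S`; the subcube `P` survives all cuts and so
keeps them non-empty. -/
theorem exists_halfspacesAbove_union {P Q : K.cubes} {S : Set (Set V)} (hS : S.Finite)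
    (hP : S ⊆ K.halfspacesAbove P) (hPQ : P ≤ Q) :
    ∃ R : K.cubes, K.halfspacesAbove R = K.halfspacesAbove Q ∪ S := by
  suffices H : ∃ R : K.cubes, P ≤ R ∧ K.halfspacesAbove R = K.halfspacesAbove Q ∪ S from
    H.imp fun _ h => h.2
  induction S, hS using Set.Finite.induction_on with
  | empty => exact ⟨Q, hPQ, by simp⟩
  | @insert A S _ _ ih =>
    obtain ⟨R, hPR, hR⟩ := ih ((Set.subset_insert _ _).trans hP)
    have hA := hP (Set.mem_insert A S)
    by_cases hAR : A ∈ K.halfspacesAbove R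
    · refine ⟨R, hPR, ?_⟩
      rw [Set.union_insert, ← hR, Set.insert_eq_of_mem hAR]
    · have hPR' : (P : Set V) ⊆ R := hPR
      obtain ⟨D, hD, hD'⟩ := hK.exists_halfspacesAbove_insert hA.1
        ((hK.1.nonempty P.2).mono (Set.subset_inter hPR' hA.2)) hAR
      refine ⟨D, ?_, by rw [hD', hR, Set.union_insert]⟩
      change (P : Set V) ⊆ D
      rw [hD]
      exact Set.subset_inter hPR' hA.2

/-- Extension of a cube in several directions. -/
theorem exists_halfspacesAbove_sdiff {C : K.cubes} {z : V} (hz : z ∈ (C : Set V))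
    {T : Set (Set V)} (hT : T.Finite) (hTC : T ⊆ K.halfspacesAbove C) (w : Set V → V)
    (hw : ∀ A ∈ T, K.graph.Adj z (w A) ∧ w A ∉ A)
    (hww : ∀ A ∈ T, ∀ B ∈ T, A ≠ B → {w A, w B} ∈ K.link z)
    (hwC : ∀ A ∈ T, ∀ u ∈ (C : Set V), K.graph.Adj z u → {w A, u} ∈ K.link z) :
    ∃ D : K.cubes, K.halfspacesAbove D = K.halfspacesAbove C \ T := by
  -- Flagness at `z`, applied to the edges of `C` together with the new edges, which are pairwise
  -- joined in the link.
  obtain ⟨Q, hQ, hzQ, hN⟩ := hK.2 z ({u | u ∈ (C : Set V) ∧ K.graph.Adj z u} ∪ w '' T)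
    (((hK.1.finite C.2).subset fun u hu => hu.1).union (hT.image w)) (by
      rintro _ (hu | ⟨A, hA, rfl⟩)
      exacts [hu.2, (hw A hA).1]) (by
      rintro _ (ha | ⟨A, hA, rfl⟩) _ (hb | ⟨B, hB, rfl⟩) hab
      · exact hK.1.pair_mem_link C.2 hz ha.1 hb.1 ha.2 hb.2 hab
      · exact Set.pair_comm _ _ ▸ hwC B hB _ ha.1 ha.2
      · exact hwC A hA _ hb.1 hb.2
      · exact hww A hA B hB fun e => hab (e ▸ rfl))
  simp only [Set.ext_iff, Set.mem_union, Set.mem_ofPred_eq] at hN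
  have hCQ : (C : Set V) ⊆ Q := hK.1.subset_of_neighbors C.2 hQ hz hzQ fun u hu hzu =>
    ((hN u).1 (Or.inl ⟨hu, hzu⟩)).1
  refine ⟨⟨Q, hQ⟩, Set.ext fun B => ⟨fun hB => ⟨⟨hB.1, hCQ.trans hB.2⟩, fun hBT => ?_⟩, ?_⟩⟩
  · exact (hw B hBT).2 (hB.2 ((hN _).1 (Or.inr ⟨B, hBT, rfl⟩)).1)
  · rintro ⟨hB, hBT⟩
    refine ⟨hB.1, ?_⟩
    by_contra hQB
    obtain ⟨u, hu, hzu, huB⟩ := hK.exists_adj_notMem hB.1 hQ hzQ (hB.2 hz) hQB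
    rcases (hN u).2 ⟨hu, hzu⟩ with h | ⟨A, hA, rfl⟩
    · exact huB (hB.2 h.1)
    · have hA' := hTC hA
      rw [hK.halfspace_unique hzu hB.1 hA'.1 (hB.2 hz) huB (hA'.2 hz) (hw A hA).2] at hBT
      exact hBT hA

theorem finite_symmDiff_halfspacesAbove (C D : K.cubes) :
    (K.halfspacesAbove C ∆ K.halfspacesAbove D).Finite := by
  have key : ∀ C D : K.cubes, (K.halfspacesAbove C \ K.halfspacesAbove D).Finite := by
    intro C D
    obtain ⟨x, hx⟩ := hK.1.nonempty C.2
    refine ((hK.1.finite D.2).biUnion fun y _ => (hK.finite_separating x y).1).subset ?_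
    rintro A ⟨hA, hA'⟩
    obtain ⟨y, hy, hyA⟩ := Set.not_subset.1 fun h => hA' ⟨hA.1, h⟩
    exact Set.mem_biUnion hy ⟨hA.1, hA.2 hx, hyA⟩
  exact (key C D).union (key D C)

end IsCAT0

end CubeSystem

namespace CubeSystem

/-! ### The barycentric subdivision -/

variable {V : Type*} {K : CubeSystem V}

/-- Two cubes are adjacent if exactly one halfspace contains one of them but not the other. -/
def subdivisionGraph (K : CubeSystem V) : SimpleGraph K.cubes where
  Adj C D := ∃ A, K.halfspacesAbove C ∆ K.halfspacesAbove D = {A}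
  symm := ⟨fun C D h => by rwa [symmDiff_comm]⟩
  loopless := ⟨fun C ⟨A, h⟩ => by
    rw [symmDiff_self] at h
    exact Set.singleton_ne_empty A h.symm⟩

theorem symmDiff_singleton_of_notMem {N : Type*} {S : Set N} {i : N} (h : i ∉ S) :
    S ∆ {i} = insert i S := by
  rw [(Set.disjoint_singleton_right.2 h).symmDiff_eq_sup]
  exact Set.union_singleton

theorem symmDiff_of_subset {N : Type*} {S T : Set N} (h : T ⊆ S) : S ∆ T = S \ T :=
  symmDiff_of_ge h

namespace IsCAT0

variable (hK : K.IsCAT0)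
include hK

theorem exists_cube_sdiff_pair {C : K.cubes} {z a b : V} {A B : Set V} (hz : z ∈ (C : Set V))
    (hA : A ∈ K.halfspacesAbove C) (hB : B ∈ K.halfspacesAbove C) (hAB : A ≠ B)
    (ha : K.graph.Adj z a) (haA : a ∉ A) (hb : K.graph.Adj z b) (hbB : b ∉ B)
    (hab : {a, b} ∈ K.link z) (haC : ∀ u ∈ (C : Set V), K.graph.Adj z u → {a, u} ∈ K.link z)
    (hbC : ∀ u ∈ (C : Set V), K.graph.Adj z u → {b, u} ∈ K.link z) :
    ∃ D : K.cubes, K.halfspacesAbove D = K.halfspacesAbove C \ {A, B} := by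
  classical
  refine hK.exists_halfspacesAbove_sdiff hz (by simp) (by rintro _ (rfl | rfl) <;> assumption)
    (fun X => if X = A then a else b) ?_ ?_ ?_
  · rintro _ (rfl | rfl)
    · simpa using ⟨ha, haA⟩
    · simpa [hAB.symm] using ⟨hb, hbB⟩
  · rintro _ (rfl | rfl) _ (rfl | rfl) hne
    · exact absurd rfl hne
    · simpa [hAB.symm] using hab
    · simpa [hAB.symm, Set.pair_comm b a] using hab
    · exact absurd rfl hne
  · rintro _ (rfl | rfl) u hu hzu
    · simpa using haC u hu hzu
    · simpa [hAB.symm] using hbC u hu hzu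

/-- A cube whose halfspaces differ from those of `C` by the removal of `A` contains a neighbour of
any given vertex of `C` in the complement of `A`. -/
theorem exists_adj_of_sdiff {C D : K.cubes} {A : Set V} (hA : A ∈ K.halfspacesAbove C)
    (hD : K.halfspacesAbove D = K.halfspacesAbove C \ {A}) {z : V} (hz : z ∈ (C : Set V)) :
    C ≤ D ∧ ∃ w ∈ (D : Set V), K.graph.Adj z w ∧ w ∉ A ∧
      ∀ u ∈ (C : Set V), K.graph.Adj z u → {w, u} ∈ K.link z := by
  have hCD : C ≤ D := hK.le_iff_halfspacesAbove.2 (hD ▸ Set.sdiff_subset)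
  have hCD' : (C : Set V) ⊆ D := hCD
  have hDA : ¬ (D : Set V) ⊆ A := fun h => by
    have : A ∈ K.halfspacesAbove D := ⟨hA.1, h⟩
    rw [hD] at this
    exact this.2 rfl
  obtain ⟨w, hw, hzw, hwA⟩ := hK.exists_adj_notMem hA.1 D.2 (hCD' hz) (hA.2 hz) hDA
  refine ⟨hCD, w, hw, hzw, hwA, fun u hu hzu => ?_⟩
  exact hK.1.pair_mem_link D.2 (hCD' hz) hw (hCD' hu) hzw hzu fun e => hwA (e ▸ hA.2 hu)

/-! ### The code of a cube by the halfspaces containing it -/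

/-- If a halfspace containing `D` cuts `C` properly, it is used to cut `C`. Otherwise, if the cubes
meet, `C` is a proper face of `D` and can be enlarged by one direction inside `D`; if they are
disjoint, `C` is extended across the first hyperplane on a shortest geodesic to `D`. -/
theorem exists_descent (C D : K.cubes) (hCD : C ≠ D) :
    ∃ A ∈ K.halfspacesAbove C ∆ K.halfspacesAbove D, ∃ E : K.cubes,
      K.halfspacesAbove E = K.halfspacesAbove C ∆ {A} := by
  by_cases hcut : ∃ A ∈ K.halfspacesAbove D \ K.halfspacesAbove C, ((C : Set V) ∩ A).Nonempty
  · obtain ⟨A, ⟨hAD, hAC⟩, hne⟩ := hcut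
    obtain ⟨E, -, hE⟩ := hK.exists_halfspacesAbove_insert hAD.1 hne hAC
    exact ⟨A, Or.inr ⟨hAD, hAC⟩, E, by rw [hE, symmDiff_singleton_of_notMem hAC]⟩
  have hcut : ∀ A ∈ K.halfspacesAbove D, ((C : Set V) ∩ A).Nonempty → (C : Set V) ⊆ A := by
    intro A hA hne
    by_contra h
    exact hcut ⟨A, ⟨hA, fun h' => h h'.2⟩, hne⟩
  obtain ⟨⟨z, y⟩, ⟨hz, hy⟩, hmin⟩ := exists_minimalFor_of_wellFoundedLT
    (fun p : V × V => p.1 ∈ (C : Set V) ∧ p.2 ∈ (D : Set V)) (fun p => K.graph.dist p.1 p.2)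
    (by
      obtain ⟨z, hz⟩ := hK.1.nonempty C.2
      obtain ⟨y, hy⟩ := hK.1.nonempty D.2
      exact ⟨(z, y), hz, hy⟩)
  have hmin : ∀ z' ∈ (C : Set V), ∀ y' ∈ (D : Set V), K.graph.dist z y ≤ K.graph.dist z' y' := by
    intro z' hz' y' hy'
    have := @hmin (z', y') ⟨hz', hy'⟩
    simp only at this hz hy
    omega
  simp only at hz hy
  by_cases hzy : z = y
  · subst hzy
    have hsub : K.halfspacesAbove D ⊆ K.halfspacesAbove C := fun A hA =>
      ⟨hA.1, hcut A hA ⟨z, hz, hA.2 hy⟩⟩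
    obtain ⟨A, hAC, hAD⟩ : ∃ A ∈ K.halfspacesAbove C, A ∉ K.halfspacesAbove D := by
      by_contra! h
      exact hCD (hK.halfspacesAbove_injective (Set.Subset.antisymm h hsub))
    obtain ⟨E, hE⟩ := hK.exists_halfspacesAbove_union (P := C) (Q := D)
      (S := (K.halfspacesAbove C \ K.halfspacesAbove D) \ {A})
      (((hK.finite_symmDiff_halfspacesAbove C D).subset Set.subset_union_left).sdiff)
      (fun B hB => hB.1.1) (hK.le_iff_halfspacesAbove.2 hsub)
    refine ⟨A, Or.inl ⟨hAC, hAD⟩, E, ?_⟩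
    rw [hE, symmDiff_of_subset (by simpa using hAC)]
    ext B
    simp only [Set.mem_union, Set.mem_sdiff, Set.mem_singleton_iff]
    constructor
    · rintro (h | h)
      · exact ⟨hsub h, by rintro rfl; exact hAD h⟩
      · exact ⟨h.1.1, h.2⟩
    · rintro ⟨h1, h2⟩
      by_cases h : B ∈ K.halfspacesAbove D
      · exact Or.inl h
      · exact Or.inr ⟨⟨h1, h⟩, h2⟩
  obtain ⟨w, hw, hwy⟩ := hK.exists_adj_dist hzy
  obtain ⟨A, hA, hzA, hwA⟩ := hK.exists_halfspace_adj hw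
  have hCA : (C : Set V) ⊆ A := by
    by_contra hCA
    obtain ⟨w', hw'C, hw', hw'A⟩ := hK.exists_adj_notMem hA C.2 hz hzA hCA
    obtain rfl := hK.adj_unique hA hw hw' hzA hwA hw'A
    have := hmin w hw'C y hy
    omega
  have hyA : y ∉ A := by
    intro hyA
    have := hK.dist_of_halfspace hA.compl hw.symm hwA (not_not.2 hzA) (not_not.2 hyA)
    omega
  have hDA : (D : Set V) ⊆ Aᶜ := by
    by_contra hDA
    obtain ⟨y', hy'D, hy', hy'A⟩ := hK.exists_adj_notMem hA.compl D.2 hy hyA hDA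
    have h1 := hK.dist_of_halfspace hA.compl hy' hyA hy'A (not_not.2 hzA)
    have h2 := hmin z hz y' hy'D
    rw [SimpleGraph.dist_comm, SimpleGraph.dist_comm (u := y)] at h1
    omega
  refine ⟨A, Or.inl ⟨⟨hA, hCA⟩, fun h => hyA (h.2 hy)⟩, ?_⟩
  rw [symmDiff_of_subset (by simpa using ⟨hA, hCA⟩)]
  refine hK.exists_halfspacesAbove_sdiff hz (by simp) (by simpa using ⟨hA, hCA⟩) (fun _ => w)
    (by simpa using ⟨hw, hwA⟩) (by simp) ?_
  rintro _ rfl u hu hzu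
  have hwu : w ≠ u := by rintro rfl; exact hwA (hCA hu)
  obtain ⟨B, hB, hzB, huB⟩ := hK.exists_halfspace_adj hzu
  have hyB : y ∈ B := by
    by_contra hyB
    have h1 := hK.dist_of_halfspace hB hzu hzB huB hyB
    have h2 := hmin u hu y hy
    omega
  -- The hyperplane of the edge from `z` to `u` must also cut `D`, since no halfspace containing `D`
  -- cuts `C`. From `y'`, both `u` and `w` are nearer than `z`, and the quadrangle condition gives
  -- the square needed for the link.
  obtain ⟨y', hy'D, hyy', hy'B⟩ : ∃ y' ∈ (D : Set V), K.graph.Adj y y' ∧ y' ∉ B :=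
    hK.exists_adj_notMem hB D.2 hy hyB fun h => huB (hcut B ⟨hB, h⟩ ⟨z, hz, hzB⟩ hu)
  have h1 := hK.dist_of_halfspace hB hzu hzB huB hy'B
  have h2 := hK.dist_of_halfspace hA hw hzA hwA (hDA hy'D)
  obtain ⟨c, hc, -⟩ := hK.quadrangle (b := y') hw hzu hwu h2 h1
  exact hc.mem_link hK.1

/-- `C` is cut successively; the Helly property `inter_inter_nonempty` ensures that each remaining
member of `T` still meets the cube obtained. -/
theorem exists_flag_lower {C : K.cubes} {T : Set (Set V)} (hT : T.Finite)
    (hTC : ∀ A ∈ T, A ∉ K.halfspacesAbove C)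
    (hp : ∀ A ∈ T, ∀ B ∈ T, ∃ D : K.cubes, K.halfspacesAbove D = K.halfspacesAbove C ∪ {A, B}) :
    ∃ D : K.cubes, K.halfspacesAbove D = K.halfspacesAbove C ∪ T := by
  have hp' : ∀ A ∈ T, ∀ B ∈ T, K.IsHalfspace A ∧ ((C : Set V) ∩ A).Nonempty ∧
      (A ∩ B).Nonempty := by
    intro A hA B hB
    obtain ⟨D, hD⟩ := hp A hA B hB
    obtain ⟨y, hy⟩ := hK.1.nonempty D.2
    have hDC : (D : Set V) ⊆ C := hK.le_iff_halfspacesAbove.2 (hD ▸ Set.subset_union_left)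
    have hA' : A ∈ K.halfspacesAbove D := hD ▸ Or.inr (by simp)
    have hB' : B ∈ K.halfspacesAbove D := hD ▸ Or.inr (by simp)
    exact ⟨hA'.1, ⟨y, hDC hy, hA'.2 hy⟩, y, hA'.2 hy, hB'.2 hy⟩
  suffices H : ∀ S : Set (Set V), S.Finite → S ⊆ T → ∃ D : K.cubes,
      K.halfspacesAbove D = K.halfspacesAbove C ∪ S ∧ ∀ A ∈ T, ((D : Set V) ∩ A).Nonempty from
    (H T hT subset_rfl).imp fun _ h => h.1
  intro S hS
  induction S, hS using Set.Finite.induction_on with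
  | empty => exact fun _ => ⟨C, by simp, fun A hA => (hp' A hA A hA).2.1⟩
  | @insert A S hAS _ ih =>
    intro hST
    obtain ⟨D, hD, hDT⟩ := ih ((Set.subset_insert _ _).trans hST)
    have hA := hST (Set.mem_insert A S)
    have hAD : A ∉ K.halfspacesAbove D := by
      rw [hD]
      rintro (h | h)
      exacts [hTC A hA h, hAS h]
    obtain ⟨E, hE, hE'⟩ := hK.exists_halfspacesAbove_insert (hp' A hA A hA).1 (hDT A hA) hAD
    refine ⟨E, by rw [hE', hD, Set.union_insert], fun B hB => ?_⟩
    rw [hE]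
    exact hK.inter_inter_nonempty (hp' A hA B hB).1 (hp' B hB A hA).1 D.2 (hDT A hA) (hDT B hB)
      (Or.inl (hp' A hA B hB).2.2)

/-- At a vertex `z` of `C`, each single removal yields an edge out of `C` and each pair of removals
yields a square, so the flag condition at `z` gives the common extension. -/
theorem exists_flag_upper {C : K.cubes} {T : Set (Set V)} (hT : T.Finite)
    (hTC : T ⊆ K.halfspacesAbove C)
    (hp : ∀ A ∈ T, ∀ B ∈ T, ∃ D : K.cubes, K.halfspacesAbove D = K.halfspacesAbove C \ {A, B}) :
    ∃ D : K.cubes, K.halfspacesAbove D = K.halfspacesAbove C \ T := by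
  classical
  obtain ⟨z, hz⟩ := hK.1.nonempty C.2
  have h1 : ∀ A : T, ∃ w, ∃ D : K.cubes, K.halfspacesAbove D = K.halfspacesAbove C \ {A.1} ∧ C ≤ D ∧
      w ∈ (D : Set V) ∧ K.graph.Adj z w ∧ w ∉ A.1 ∧
      ∀ u ∈ (C : Set V), K.graph.Adj z u → {w, u} ∈ K.link z := by
    rintro ⟨A, hA⟩
    obtain ⟨D, hD⟩ := hp A hA A hA
    rw [Set.pair_eq_singleton] at hD
    obtain ⟨h, w, hw⟩ := hK.exists_adj_of_sdiff (hTC hA) hD hz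
    exact ⟨w, D, hD, h, hw⟩
  choose w D hD hCD hwD hzw hwA hwl using h1
  refine hK.exists_halfspacesAbove_sdiff hz hT hTC (fun A => if h : A ∈ T then w ⟨A, h⟩ else z)
    (fun A hA => ?_) (fun A hA B hB hAB => ?_) (fun A hA => ?_)
  · simp only [hA, dite_true]
    exact ⟨hzw ⟨A, hA⟩, hwA ⟨A, hA⟩⟩
  · simp only [hA, hB, dite_true]
    obtain ⟨Q, hQ⟩ := hp A hA B hB
    have hCQ : (C : Set V) ⊆ Q := hK.le_iff_halfspacesAbove.2 (hQ ▸ Set.sdiff_subset)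
    have hsub : ∀ X : T, X.1 ∈ ({A, B} : Set (Set V)) → (D X : Set V) ⊆ Q := fun X hX =>
      hK.le_iff_halfspacesAbove.2 (by
        rw [hQ, hD]
        exact Set.sdiff_subset_sdiff_right (Set.singleton_subset_iff.2 hX))
    refine hK.1.pair_mem_link Q.2 (hCQ hz) (hsub _ (by simp) (hwD _)) (hsub _ (by simp) (hwD _))
      (hzw _) (hzw _) fun e => hAB ?_
    exact hK.halfspace_unique (hzw ⟨A, hA⟩) (hTC hA).1 (hTC hB).1 ((hTC hA).2 hz) (hwA ⟨A, hA⟩)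
      ((hTC hB).2 hz) (e ▸ hwA ⟨B, hB⟩)
  · simp only [hA, dite_true]
    exact hwl _

/-- For `flag`, the removals give a larger cube `Q` and the additions a smaller cube `P`; cutting
`Q` by the halfspaces to be added combines them, with `P` as witness. The same device settles the
mixed case of `quad`. -/
theorem isCode_subdivision : IsCode K.subdivisionGraph K.halfspacesAbove where
  inj := hK.halfspacesAbove_injective
  adj_iff _ _ := Iff.rfl
  finite := hK.finite_symmDiff_halfspacesAbove
  descent := hK.exists_descent
  flag := by
    intro C T hT hp
    obtain ⟨Q, hQ⟩ := hK.exists_flag_upper (C := C) (T := T ∩ K.halfspacesAbove C)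
      (hT.inter_of_left _) Set.inter_subset_right fun A hA B hB => by
        obtain ⟨D, hD⟩ := hp A hA.1 B hB.1
        refine ⟨D, hD.trans (symmDiff_of_subset ?_)⟩
        rintro _ (rfl | rfl)
        exacts [hA.2, hB.2]
    obtain ⟨P, hP⟩ := hK.exists_flag_lower (C := C) (T := T \ K.halfspacesAbove C)
      hT.sdiff (fun A hA => hA.2) fun A hA B hB => by
        obtain ⟨D, hD⟩ := hp A hA.1 B hB.1
        refine ⟨D, hD.trans (Disjoint.symmDiff_eq_sup ?_)⟩
        rw [Set.disjoint_right]
        rintro _ (rfl | rfl)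
        exacts [hA.2, hB.2]
    obtain ⟨R, hR⟩ := hK.exists_halfspacesAbove_union (P := P) (Q := Q)
      (S := T \ K.halfspacesAbove C) hT.sdiff (hP ▸ Set.subset_union_right)
      (hK.le_iff_halfspacesAbove.2 (by
        rw [hP, hQ]
        exact Set.sdiff_subset.trans Set.subset_union_left))
    refine ⟨R, ?_⟩
    rw [hR, hQ]
    ext A
    simp only [Set.mem_union, Set.mem_sdiff, Set.mem_inter_iff, Set.mem_symmDiff]
    tauto
  quad := by
    rintro C D A hA B hB ⟨a, ha⟩ ⟨b, hb⟩
    by_cases hAB : A = B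
    · subst hAB
      exact ⟨a, by rw [ha, Set.pair_eq_singleton]⟩
    rw [← singleton_symmDiff_singleton hAB]
    have mixed : ∀ {A B : Set V} {a b : K.cubes}, A ≠ B → A ∈ K.halfspacesAbove C →
        B ∉ K.halfspacesAbove C → K.halfspacesAbove a = K.halfspacesAbove C ∆ {A} →
        K.halfspacesAbove b = K.halfspacesAbove C ∆ {B} → ∃ c : K.cubes,
          K.halfspacesAbove c = K.halfspacesAbove C ∆ ({A} ∆ {B}) := by
      intro A B a b hAB hAC hBC ha hb
      rw [symmDiff_of_subset (by simpa using hAC)] at ha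
      rw [symmDiff_singleton_of_notMem hBC] at hb
      obtain ⟨c, hc⟩ := hK.exists_halfspacesAbove_union (P := b) (Q := a) (S := {B})
        (Set.finite_singleton _) (by simp [hb]) (hK.le_iff_halfspacesAbove.2 (by
          rw [ha, hb]; exact Set.sdiff_subset.trans (Set.subset_insert _ _)))
      refine ⟨c, ?_⟩
      rw [← symmDiff_assoc, symmDiff_of_subset (S := K.halfspacesAbove C) (by simpa using hAC),
        symmDiff_singleton_of_notMem (fun h => hBC h.1), hc, ha, Set.union_singleton]
    rcases hA with ⟨hAC, hAD⟩ | ⟨hAD, hAC⟩ <;> rcases hB with ⟨hBC, hBD⟩ | ⟨hBD, hBC⟩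
    · rw [singleton_symmDiff_singleton hAB, symmDiff_of_subset (by
        rintro _ (rfl | rfl) <;> assumption)]
      rw [symmDiff_of_subset (by simpa using hAC)] at ha
      rw [symmDiff_of_subset (by simpa using hBC)] at hb
      obtain ⟨z, hz⟩ := hK.1.nonempty C.2
      obtain ⟨-, v, -, hzv, hvA, hv⟩ := hK.exists_adj_of_sdiff hAC ha hz
      obtain ⟨-, w, -, hzw, hwB, hw⟩ := hK.exists_adj_of_sdiff hBC hb hz
      refine hK.exists_cube_sdiff_pair hz hAC hBC hAB hzv hvA hzw hwB ?_ hv hw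
      have hne : ∀ {X}, X ∈ K.halfspacesAbove C → X ∉ K.halfspacesAbove D →
          ((D : Set V) ∩ Xᶜ).Nonempty := by
        intro X hX hX'
        obtain ⟨y, hy, hyX⟩ := Set.not_subset.1 fun h => hX' ⟨hX.1, h⟩
        exact ⟨y, hy, hyX⟩
      -- When both halfspaces are to be removed, a vertex of `D` beyond both hyperplanes makes `v`
      -- and `w` nearer than `z`, and the quadrangle condition joins them in the link.
      obtain ⟨y, ⟨hy, hyA⟩, hyB⟩ := hK.inter_inter_nonempty hAC.1.compl hBC.1.compl D.2
        (hne hAC hAD) (hne hBC hBD) (Or.inr (Or.inr (by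
          rw [compl_compl]
          rintro rfl
          exact hBC.2 hz (hAC.2 hz) |>.elim)))
      have hvw : v ≠ w := by
        rintro rfl
        exact hAB (hK.halfspace_unique hzv hAC.1 hBC.1 (hAC.2 hz) hvA (hBC.2 hz) hwB)
      obtain ⟨c, hc, -⟩ := hK.quadrangle (b := y) hzv hzw hvw
        (hK.dist_of_halfspace hAC.1 hzv (hAC.2 hz) hvA hyA)
        (hK.dist_of_halfspace hBC.1 hzw (hBC.2 hz) hwB hyB)
      exact hc.mem_link hK.1
    · exact mixed hAB hAC hBC ha hb
    · rw [symmDiff_comm ({A} : Set (Set V))]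
      exact mixed (Ne.symm hAB) hBC hAC hb ha
    · have hsub : ∀ {X x}, X ∉ K.halfspacesAbove C → X ∈ K.halfspacesAbove D →
          K.halfspacesAbove x = K.halfspacesAbove C ∆ {X} → ((C : Set V) ∩ X).Nonempty := by
        intro X x hXC hXD hx
        rw [symmDiff_singleton_of_notMem hXC] at hx
        obtain ⟨y, hy⟩ := hK.1.nonempty x.2
        have hxC : (x : Set V) ⊆ C := hK.le_iff_halfspacesAbove.2 (hx ▸ Set.subset_insert _ _)
        have hX : X ∈ K.halfspacesAbove x := hx ▸ Set.mem_insert _ _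
        exact ⟨y, hxC hy, hX.2 hy⟩
      obtain ⟨d, hd⟩ := hK.1.nonempty D.2
      have hne := hK.inter_inter_nonempty hAD.1 hBD.1 C.2 (hsub hAC hAD ha) (hsub hBC hBD hb)
        (Or.inl ⟨d, hAD.2 hd, hBD.2 hd⟩)
      obtain ⟨E, hE, hE'⟩ := hK.exists_halfspacesAbove_insert hAD.1 (hsub hAC hAD ha) hAC
      have hBE : B ∉ K.halfspacesAbove E := by
        rw [hE']
        rintro (h | h)
        exacts [hAB h.symm, hBC h]
      obtain ⟨F, -, hF⟩ := hK.exists_halfspacesAbove_insert hBD.1 (hE ▸ hne) hBE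
      refine ⟨F, ?_⟩
      rw [← symmDiff_assoc, symmDiff_singleton_of_notMem hAC, ← hE',
        symmDiff_singleton_of_notMem hBE, hF]

/-- The interval from `P` to `Q` consists of the cubes obtained from `Q` by adding halfspaces that
contain `P` but not `Q`. Conversely, in a cube of the code graph with direction set `T`, adding all
of `T` gives the least element and removing all of `T` the greatest. -/
theorem subdivision_eq_fillCubes : K.subdivision = K.subdivisionGraph.fillCubes := by
  have hc := hK.isCode_subdivision
  have hIcc : ∀ P Q : K.cubes, P ≤ Q → Set.Icc P Q = {C | K.halfspacesAbove Q ∆ K.halfspacesAbove C ⊆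
      K.halfspacesAbove P \ K.halfspacesAbove Q} := by
    intro P Q hPQ
    have hPQ := hK.le_iff_halfspacesAbove.1 hPQ
    ext C
    simp only [Set.mem_Icc, hK.le_iff_halfspacesAbove, Set.mem_ofPred_eq]
    constructor
    · rintro ⟨h1, h2⟩ A (⟨h3, h4⟩ | ⟨h3, h4⟩)
      exacts [absurd (h2 h3) h4, ⟨h1 h3, h4⟩]
    · intro h
      have h2 : K.halfspacesAbove Q ⊆ K.halfspacesAbove C := fun A hA => by
        by_contra hAC
        exact (h (Or.inl ⟨hA, hAC⟩)).2 hA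
      refine ⟨fun A hA => ?_, h2⟩
      by_cases hAQ : A ∈ K.halfspacesAbove Q
      · exact hPQ hAQ
      · exact (h (Or.inr ⟨hA, hAQ⟩)).1
  suffices H : K.subdivision.cubes = K.subdivisionGraph.fillCubes.cubes by
    cases h : K.subdivision
    cases h' : K.subdivisionGraph.fillCubes
    rw [h, h'] at H
    exact congrArg _ H
  ext S
  constructor
  · rintro ⟨P, Q, hPQ, rfl⟩
    rw [hIcc P Q hPQ]
    have hfin : (K.halfspacesAbove P \ K.halfspacesAbove Q).Finite :=
      (hK.finite_symmDiff_halfspacesAbove P Q).subset Set.subset_union_left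
    refine hc.mem_cubes_of hfin fun S hS => ?_
    obtain ⟨R, hR⟩ := hK.exists_halfspacesAbove_union (hfin.subset hS)
      (hS.trans Set.sdiff_subset) hPQ
    exact ⟨R, hR.trans (Disjoint.symmDiff_eq_sup
      (Set.disjoint_right.2 fun A hA => (hS hA).2)).symm⟩
  · intro hS
    obtain ⟨n, φ, -, -, hφ⟩ := id hS
    obtain ⟨σ, hσ⟩ : S.Nonempty := hφ ▸ Set.range_nonempty φ
    obtain ⟨T, -, hT, rfl⟩ := hc.exists_of_mem_cubes hS hσ
    obtain ⟨P, hP⟩ := hT (T \ K.halfspacesAbove σ) Set.sdiff_subset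
    obtain ⟨Q, hQ⟩ := hT (T ∩ K.halfspacesAbove σ) Set.inter_subset_left
    have hP' : K.halfspacesAbove P = K.halfspacesAbove σ ∪ T := by
      rw [hP]; ext A; simp only [Set.mem_symmDiff, Set.mem_sdiff, Set.mem_union]; tauto
    have hQ' : K.halfspacesAbove Q = K.halfspacesAbove σ \ T := by
      rw [hQ]; ext A; simp only [Set.mem_symmDiff, Set.mem_sdiff, Set.mem_inter_iff]; tauto
    have hPQ : P ≤ Q := hK.le_iff_halfspacesAbove.2 (by
      rw [hP', hQ']; exact Set.sdiff_subset.trans Set.subset_union_left)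
    refine ⟨P, Q, hPQ, ?_⟩
    ext C
    simp only [Set.mem_Icc, hK.le_iff_halfspacesAbove, Set.mem_ofPred_eq, hP', hQ',
      Set.subset_def, Set.mem_symmDiff, Set.mem_sdiff, Set.mem_union]
    refine ⟨fun h => ⟨fun A hA => ?_, fun A hA => ?_⟩, fun h A hA => ?_⟩
    · have := h A; tauto
    · have := h A; tauto
    · have h1 := h.1 A
      have h2 := h.2 A
      tauto

theorem isCAT0_subdivision : K.subdivision.IsCAT0 := by
  have hne : Nonempty K.cubes :=
    hK.connected.nonempty.map fun v => ⟨{v}, hK.1.singleton_mem v⟩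
  rw [hK.subdivision_eq_fillCubes]
  exact hK.isCode_subdivision.isCAT0

theorem subdivision_adj {C D : K.cubes} : K.subdivision.graph.Adj C D ↔
    ∃ A, K.halfspacesAbove C ∆ K.halfspacesAbove D = {A} := by
  rw [hK.subdivision_eq_fillCubes]
  exact hK.isCode_subdivision.graph_adj C D

end IsCAT0

end CubeSystem

namespace CubeSystem

/-! ### Inversions -/

section

variable {V : Type*} {K : CubeSystem V}

theorem reachable_deleteEdges_eq (hK : K.IsCAT0) {A : Set V} (hA : K.IsHalfspace A)
    {J : Set (Sym2 V)} (hJ : ∀ x y, K.graph.Adj x y → (s(x, y) ∈ J ↔ (x ∈ A ↔ y ∉ A))) {v : V}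
    (hv : v ∈ A) : {w | (K.graph.deleteEdges J).Reachable v w} = A := by
  ext w
  constructor
  · rintro ⟨p⟩
    induction p with
    | nil => exact hv
    | @cons a b c h p ih =>
      rw [SimpleGraph.deleteEdges_adj, hJ _ _ h.1] at h
      exact ih (by tauto)
  · intro hw
    induction hn : K.graph.dist w v generalizing w with
    | zero => rw [hK.dist_eq_zero.1 hn]; exact SimpleGraph.Reachable.refl _
    | succ n ih =>
      obtain ⟨u, hu, hud⟩ := hK.exists_adj_dist (x := w) (b := v) (by
        rintro rfl; simp at hn)
      have hbet : K.Between w u v := by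
        rw [Between, SimpleGraph.dist_eq_one_iff_adj.2 hu]; omega
      have huA := hA.convex w hw v hv u hbet
      refine (ih u huA (by omega)).trans (SimpleGraph.Adj.reachable ?_)
      rw [SimpleGraph.deleteEdges_adj, hJ _ _ hu.symm]
      exact ⟨hu.symm, by tauto⟩

/-- The halfspaces delimited by an inverted hyperplane are swapped. -/
theorem Inverts.exists_halfspace (hK : K.IsCAT0) {f : K.Aut} {J : Set (Sym2 V)}
    (hJ : J ∈ K.hyperplanes) (hf : K.Inverts f J) :
    ∃ A, K.IsHalfspace A ∧ (f • ·) '' A = Aᶜ := by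
  obtain ⟨e, he, rfl⟩ := hJ
  induction e with | _ a b =>
  have hab : K.graph.Adj a b := he
  obtain ⟨A, hA, ha, hb⟩ := hK.exists_halfspace_adj hab
  set J := {e' | Relation.EqvGen K.OppositeEdges s(a, b) e'} with hJdef
  have hsq : ∀ {a b c d : V}, a ≠ c → b ≠ d → K.graph.Adj a b → K.graph.Adj b c →
      K.graph.Adj c d → K.graph.Adj d a → {a, b, c, d} ∈ K.cubes → K.IsSquare a b c d :=
    fun h1 h2 h3 h4 h5 h6 h7 => ⟨h3, h4, h6.symm, h5.symm, h2, h1, h7⟩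
  -- An edge belongs to `J` exactly when it crosses `A`: crossing is invariant under opposite edges
  -- in squares, and conversely `dual_edge_induction` links all crossing edges. Hence `A` and its
  -- complement are the sides of `J`.
  let crosses : Sym2 V → Prop := fun e => ∃ x y, e = s(x, y) ∧ x ∈ A ∧ y ∉ A
  have hcross : ∀ {a b c d : V}, K.IsSquare a b c d → crosses s(a, b) → crosses s(d, c) := by
    rintro a b c d h ⟨x, y, hxy, hx, hy⟩
    rcases Sym2.eq_iff.1 hxy with ⟨rfl, rfl⟩ | ⟨rfl, rfl⟩
    · obtain ⟨h1, h2⟩ := hK.side_of_isSquare hA h hx hy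
      exact ⟨d, c, rfl, h1, h2⟩
    · obtain ⟨h1, h2⟩ := hK.side_of_isSquare hA h.rotate.swap hx hy
      exact ⟨c, d, Sym2.eq_swap, h1, h2⟩
  have hiff : ∀ {e e'}, Relation.EqvGen K.OppositeEdges e e' → (crosses e ↔ crosses e') := by
    intro e e' h
    induction h with
    | rel _ _ h =>
      obtain ⟨a, b, c, d, h1, h2, h3, h4, h5, h6, h7, rfl, rfl⟩ := h
      have hs := hsq h1 h2 h3 h4 h5 h6 h7
      exact ⟨hcross hs, hcross hs.swap.rotate⟩
    | refl _ => exact Iff.rfl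
    | symm _ _ _ ih => exact ih.symm
    | trans _ _ _ _ _ ih ih' => exact ih.trans ih'
  have hmem : ∀ x y, K.graph.Adj x y → x ∈ A → y ∉ A → s(x, y) ∈ J := by
    intro x y hxy hx hy
    refine hK.dual_edge_induction hA (P := fun x y => s(x, y) ∈ J) ?_ hab ha hb hxy hx hy (.refl _)
    intro a b c d hs _ _ _ _ h
    refine .trans _ _ _ h (.rel _ _ ⟨a, d, c, b, hs.ne', hs.ne.symm, hs.adj₃, hs.adj₄, hs.adj₂.symm,
      hs.adj₁.symm, hs.swap.mem, rfl, rfl⟩)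
  have hJ : ∀ x y, K.graph.Adj x y → (s(x, y) ∈ J ↔ (x ∈ A ↔ y ∉ A)) := by
    intro x y hxy
    constructor
    · intro h
      obtain ⟨x', y', h', hx, hy⟩ := (hiff h).1 ⟨a, b, rfl, ha, hb⟩
      rcases Sym2.eq_iff.1 h' with ⟨rfl, rfl⟩ | ⟨rfl, rfl⟩ <;> tauto
    · intro h
      by_cases hx : x ∈ A
      · exact hmem x y hxy hx (h.1 hx)
      · rw [Sym2.eq_swap]
        exact hmem y x hxy.symm (by tauto) hx
  have hJ' : ∀ x y, K.graph.Adj x y → (s(x, y) ∈ J ↔ (x ∈ Aᶜ ↔ y ∉ Aᶜ)) := by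
    intro x y hxy
    rw [hJ x y hxy]
    simp only [Set.mem_compl_iff]
    tauto
  obtain ⟨⟨v, hv⟩, hne⟩ := hf.2 A ⟨a, (reachable_deleteEdges_eq hK hA hJ ha).symm⟩
  by_cases hvA : v ∈ A
  · exact absurd (hv.trans (reachable_deleteEdges_eq hK hA hJ hvA)) hne
  · exact ⟨A, hA, hv.trans (reachable_deleteEdges_eq hK hA.compl hJ' hvA)⟩

theorem exists_adj_of_halfspace (hc : K.graph.Connected) {A : Set V} (hA : K.IsHalfspace A) :
    ∃ a b, K.graph.Adj a b ∧ a ∈ A ∧ b ∉ A := by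
  obtain ⟨x, hx⟩ := hA.nonempty
  obtain ⟨y, hy⟩ := hA.nonempty_compl
  obtain ⟨p⟩ := hc.preconnected x y
  obtain ⟨d, -, h1, h2⟩ := p.exists_boundary_dart A hx hy
  exact ⟨d.fst, d.snd, d.adj, h1, h2⟩

variable (hK : K.IsCAT0)
include hK

theorem IsCAT0.le_or_le_of_adj {C D : K.cubes} (h : K.subdivision.graph.Adj C D) :
    C ≤ D ∨ D ≤ C := by
  obtain ⟨A, hA⟩ := hK.subdivision_adj.1 h
  simp only [hK.le_iff_halfspacesAbove]
  by_contra! hcon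
  obtain ⟨B, hB, hB'⟩ := Set.not_subset.1 hcon.1
  obtain ⟨B', hB₁, hB₁'⟩ := Set.not_subset.1 hcon.2
  have h1 : B ∈ ({A} : Set (Set V)) := hA ▸ Or.inr ⟨hB, hB'⟩
  have h2 : B' ∈ ({A} : Set (Set V)) := hA ▸ Or.inl ⟨hB₁, hB₁'⟩
  rw [Set.mem_singleton_iff] at h1 h2
  subst h1 h2
  exact hB' hB₁

/-- In the barycentric subdivision, the order orients all the edges which are dual to a given
hyperplane in the same direction. -/
theorem IsCAT0.le_of_halfspace {A : Set K.cubes} (hA : K.subdivision.IsHalfspace A)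
    {a b a' b' : K.cubes} (hab : K.subdivision.graph.Adj a b) (ha : a ∈ A) (hb : b ∉ A)
    (hab' : K.subdivision.graph.Adj a' b') (ha' : a' ∈ A) (hb' : b' ∉ A) (h : a ≤ b) : a' ≤ b' := by
  refine hK.isCAT0_subdivision.dual_edge_induction hA (P := fun a b => a ≤ b) ?_ hab ha hb hab' ha'
    hb' h
  intro a b c d hs _ _ _ _ had
  rw [hK.le_iff_halfspacesAbove] at had ⊢
  obtain ⟨i, hi⟩ := hK.subdivision_adj.1 hs.adj₁
  obtain ⟨j, hj⟩ := hK.subdivision_adj.1 hs.adj₃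
  obtain ⟨k, hk⟩ := hK.subdivision_adj.1 hs.adj₂
  obtain ⟨l, hl⟩ := hK.subdivision_adj.1 hs.adj₄
  have hinj := hK.halfspacesAbove_injective
  rw [symmDiff_eq_iff] at hi hj hk hl
  have hij : i ≠ j := by rintro rfl; exact hs.ne (hinj (hi.trans hj.symm))
  have hik : i ≠ k := by
    rintro rfl
    rw [hi, symmDiff_symmDiff_cancel_right] at hk
    exact hs.ne' (hinj hk.symm)
  -- Opposite edges of a square toggle the same halfspace.
  have hkj : k = j := by
    have h1 := hk.symm.trans hl
    rw [hi, hj, symmDiff_assoc, symmDiff_assoc] at h1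
    have h2 := symmDiff_right_injective _ h1
    rw [singleton_symmDiff_singleton hik] at h2
    have hjl : j ≠ l := by
      rintro rfl
      rw [symmDiff_self] at h2
      exact (Set.insert_nonempty i {k}).ne_empty h2
    rw [singleton_symmDiff_singleton hjl] at h2
    have : j ∈ ({i, k} : Set (Set V)) := h2 ▸ by simp
    rcases this with h | h
    exacts [absurd h.symm hij, h.symm]
  subst hkj
  have hka : k ∈ K.halfspacesAbove a := by
    by_contra hka
    exact hka (had (hj ▸ Or.inr ⟨rfl, hka⟩))
  rw [hk, symmDiff_of_subset]
  · exact Set.sdiff_subset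
  · rw [Set.singleton_subset_iff, hi]
    exact Or.inl ⟨hka, hik.symm⟩

/-- The automorphisms of a complex do not invert the hyperplanes of its subdivision. -/
theorem IsCAT0.subdivision_image_ne_compl (f : K.Aut) {A : Set K.cubes}
    (hA : K.subdivision.IsHalfspace A) : (K.subdivisionHom f • ·) '' A ≠ Aᶜ := by
  have key : ∀ {A : Set K.cubes}, K.subdivision.IsHalfspace A →
      (K.subdivisionHom f • ·) '' A = Aᶜ → ∀ {a b : K.cubes}, K.subdivision.graph.Adj a b → a ∈ A →
      b ∉ A → ¬ a ≤ b := by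
    intro A hA h a b hab ha hb hle
    have ha' : K.subdivisionHom f • a ∉ A := by
      have : K.subdivisionHom f • a ∈ Aᶜ := h ▸ ⟨a, ha, rfl⟩
      exact this
    have hb' : K.subdivisionHom f • b ∈ A := by
      by_contra hb'
      have : K.subdivisionHom f • b ∈ (K.subdivisionHom f • ·) '' A := h ▸ hb'
      rw [(MulAction.injective _).mem_set_image] at this
      exact hb this
    -- If `f` swapped the two sides, the image of the edge would cross the hyperplane in the
    -- opposite direction, and coherence of the order would reverse the inclusion that `f`
    -- preserves.
    have hle' := hK.le_of_halfspace hA hab ha hb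
      ((K.subdivision.aut_adj_iff (K.subdivisionHom f) b a).2 hab.symm) hb' ha' hle
    exact hab.ne (hle.antisymm ((K.cubesPerm_le_iff f b a).1 hle'))
  intro h
  obtain ⟨a, b, hab, ha, hb⟩ := exists_adj_of_halfspace hK.isCAT0_subdivision.connected hA
  rcases hK.le_or_le_of_adj hab with hle | hle
  · exact key hA h hab ha hb hle
  · refine key hA.compl ?_ hab.symm hb (not_not.2 ha) hle
    rw [Set.image_compl_eq (MulAction.bijective _), h]

theorem IsCAT0.not_isInverting_subdivisionHom (f : K.Aut) :
    ¬ K.subdivision.IsInverting (K.subdivisionHom f) := by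
  rintro ⟨-, J, hJ, n, hn⟩
  rw [← map_zpow] at hn
  obtain ⟨A, hA, h⟩ := hn.exists_halfspace hK.isCAT0_subdivision hJ
  exact hK.subdivision_image_ne_compl _ hA h

end

/-! ### Finiteness properties of geometric actions -/

section

variable {V G : Type*} [Group G] {K : CubeSystem V} {ρ : G →* K.Aut}

theorem ActsGeometrically.finite_stabilizer (hρ : ActsGeometrically ρ) (v w : V) :
    {h : G | ρ h • v = w}.Finite :=
  (hρ.proper v (K.graph.dist v w)).subset fun h hh =>
    (congrArg (K.graph.dist v) (show ρ h • v = w from hh)).le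

/-- There are finitely many orbits of vertices, and two neighbours of `v` in the same orbit are at
distance at most two, so properness bounds the neighbours in each orbit. -/
theorem ActsGeometrically.locallyFinite (hρ : ActsGeometrically ρ) (hK : K.IsCAT0) (v : V) :
    {w | K.graph.Adj v w}.Finite := by
  obtain ⟨F, -, hF, hFo⟩ := hρ.cocompact
  have h1 : ∀ w : V, ∃ h : G, ∃ D ∈ F, (ρ h : Equiv.Perm V) '' D = {w} := fun w =>
    hFo _ (hK.1.singleton_mem w)
  choose h D hD hh using h1
  refine Set.Finite.of_finite_fibers D (hF.subset (by rintro _ ⟨w, -, rfl⟩; exact hD w)) ?_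
  rintro _ ⟨w₀, hw₀, rfl⟩
  have hw₀ : K.graph.Adj v w₀ := hw₀
  refine ((hρ.proper w₀ 2).image fun k => ρ k • w₀).subset ?_
  rintro w ⟨hw, hwD⟩
  have hw : K.graph.Adj v w := hw
  have hwD : D w = D w₀ := hwD
  have hd : ∃ d, D w₀ = {d} := by
    obtain ⟨d, hd, h'⟩ := (hh w₀ ▸ rfl : w₀ ∈ (ρ (h w₀) : Equiv.Perm V) '' D w₀)
    refine ⟨d, Set.Subset.antisymm (fun x hx => ?_) (Set.singleton_subset_iff.2 hd)⟩
    have : (ρ (h w₀) : Equiv.Perm V) x ∈ ({w₀} : Set V) := hh w₀ ▸ ⟨x, hx, rfl⟩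
    exact (ρ (h w₀) : Equiv.Perm V).injective (this.trans h'.symm)
  obtain ⟨d, hd⟩ := hd
  have e₀ : ρ (h w₀) • d = w₀ := by
    have := hh w₀
    rw [hd, Set.image_singleton] at this
    exact Set.singleton_injective this
  have e : ρ (h w) • d = w := by
    have := hh w
    rw [hwD, hd, Set.image_singleton] at this
    exact Set.singleton_injective this
  have e' : ρ (h w * (h w₀)⁻¹) • w₀ = w := by
    have e₁ : (ρ (h w₀))⁻¹ • w₀ = d := by rw [inv_smul_eq_iff, e₀]
    rw [map_mul, map_inv, mul_smul, e₁, e]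
  refine ⟨_, ?_, e'⟩
  change K.graph.dist w₀ (ρ (h w * (h w₀)⁻¹) • w₀) ≤ 2
  rw [e']
  have := hK.dist_triangle w₀ v w
  rw [SimpleGraph.dist_eq_one_iff_adj.2 hw₀.symm, SimpleGraph.dist_eq_one_iff_adj.2 hw] at this
  exact this

theorem ActsGeometrically.finite_stabilizer_cubes (hρ : ActsGeometrically ρ) (hK : K.IsCAT0)
    (C D : K.cubes) : {h : G | K.subdivisionHom (ρ h) • C = D}.Finite := by
  obtain ⟨v, hv⟩ := hK.1.nonempty C.2
  refine ((hK.1.finite D.2).biUnion fun w _ => hρ.finite_stabilizer v w).subset fun h hh => ?_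
  have hh : K.subdivisionHom (ρ h) • C = D := hh
  have hm : ρ h • v ∈ (D : Set V) := hh ▸ (⟨v, hv, rfl⟩ : ρ h • v ∈ (ρ h : Equiv.Perm V) '' C)
  exact Set.mem_biUnion hm rfl

/-- A neighbour of `C` is comparable with it: it either contains a fixed vertex of `C` or is a
subset of `C`. -/
theorem ActsGeometrically.locallyFinite_subdivision (hρ : ActsGeometrically ρ) (hK : K.IsCAT0)
    (C : K.cubes) : {D | K.subdivision.graph.Adj C D}.Finite := by
  obtain ⟨v, hv⟩ := hK.1.nonempty C.2
  refine (((hK.1.finite_cubes (hρ.locallyFinite hK v)).preimage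
    Subtype.val_injective.injOn).union ((hK.1.finite C.2).finite_subsets.preimage
    Subtype.val_injective.injOn)).subset fun D hD => ?_
  rcases hK.le_or_le_of_adj hD with h | h
  · exact Or.inl ⟨D.2, (show (C : Set V) ⊆ D from h) hv⟩
  · exact Or.inr h

end

end CubeSystem

theorem mainTheorem5 {V : Type*} {G : Type*} [Group G] (X : CubeSystem V) (hX : X.IsCAT0)
    (ρ : G →* X.Aut) (hρ : CubeSystem.ActsGeometrically ρ) (g : G) (hg : ¬ IsOfFinOrder g) :
    X.subdivision.IsCAT0 ∧
    X.subdivision.IsMedianSubalgebra (X.subdivisionMedianSet (ρ g)) ∧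
    (X.subdivision.medianCubulation (X.subdivisionMedianSet (ρ g))).IsCAT0 ∧
    -- the centraliser stabilises the median set of `g`: it acts on it by restriction
    ∃ τ : Subgroup.centralizer {g} →* Equiv.Perm (X.subdivisionMedianSet (ρ g)),
      (∀ h x, (τ h x : X.cubes) = (X.subdivisionHom (ρ h)).1 x) ∧
      -- and the action induced on the cubulation of the median set is geometric
      ∃ κ : Subgroup.centralizer {g} →*
          (X.subdivision.medianCubulation (X.subdivisionMedianSet (ρ g))).Aut,
        (∀ h σ, ((κ h).1 σ).1 = (fun A => τ h '' A) '' σ.1) ∧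
        CubeSystem.ActsGeometrically κ := by
  have hX' := hX.isCAT0_subdivision
  have hst := hρ.finite_stabilizer_cubes hX
  have hinv : ∀ n : ℕ, ∀ A, X.subdivision.IsHalfspace A →
      (X.subdivisionHom (ρ g) ^ n • ·) '' A ≠ Aᶜ := by
    intro n A hA
    rw [← map_pow]
    exact hX.subdivision_image_ne_compl _ hA
  -- The powers of `g` are pairwise distinct, so they cannot all lie in the finite stabiliser of a
  -- cube.
  have hfix : ∀ C : X.cubes, X.subdivisionHom (ρ g) • C ≠ C := by
    intro C hC
    refine (Set.infinite_range_of_injective (injective_pow_iff_not_isOfFinOrder.2 hg))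
      ((hst C C).subset ?_)
    rintro _ ⟨n, rfl⟩
    change X.subdivisionHom (ρ (g ^ n)) • C = C
    rw [map_pow, map_pow]
    induction n with
    | zero => simp
    | succ n ih => rw [pow_succ, mul_smul, hC, ih]
  obtain ⟨F, -, hF, hFo⟩ := hρ.cocompact
  refine ⟨hX', CubeSystem.exists_actsGeometrically hX' (hρ.locallyFinite_subdivision hX)
    (X.subdivisionHom.comp ρ) hst (hF.preimage Subtype.val_injective.injOn) (fun C => ?_) g hinv
    (CubeSystem.medianSet_eq hX' hinv hfix (hX.not_isInverting_subdivisionHom _))⟩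
  obtain ⟨h, D, hD, hh⟩ := hFo C C.2
  have hD' : D ∈ X.cubes := ((ρ h).2 D).1 (hh ▸ C.2)
  exact ⟨h, ⟨D, hD'⟩, hD, Subtype.ext hh⟩
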